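/- A $\mathbb Z$-lattice is a finitely generated free abelian group. A pair $(H,h)$ of a $\mathbb Z$-lattice $H$ of rank $n\ge 1$ and an endomorphism $h$ of $H$ is a companion block if there is $a_0\in H$ such that $a_0,h(a_0),\dots,h^{n-1}(a_0)$ is a $\mathbb Z$-basis of $H$; it is an Orlik block if moreover $h$ is an automorphism of finite order. A standard decomposition of $(H,h)$ into Orlik blocks is a decomposition $H=\bigoplus_{i=1}^kH^{(i)}$ into $h$-invariant sublattices such that each $(H^{(i)},h|_{H^{(i)}})$ is an Orlik block and the characteristic polynomials $p_i$ of $h|_{H^{(i)}}$ satisfy $p_k\mid p_{k-1}\mid\dots\mid p_1$. For positive integers $m,n,l$ let $v_p$ be the $p$-adic valuation, $\varphi$ the Euler function, $\beta(m,n)=\prod_{p\text{ prime},\,v_p(m)=v_p(n)>0}p^{v_p(m)}$, and $$\delta(m,n,l)=\varphi(\gcd(m,n))\prod_{p\text{ prime},\;0=v_p(c)<v_p(\beta(m,n))}\frac{p-2}{p-1}$$ if $\operatorname{lcm}(m,n)=c\,l$ with $c\mid\beta(m,n)$, and $\delta(m,n,l)=0$ otherwise. For a prime $p$ let $\pi_p(m)=m\,p^{-v_p(m)}$.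 For finite non-empty sets $M,N$ of positive integers put $$\chi(l)=\sum_{(m,n)\in M\times N}\delta(m,n,l),\qquad L=\{l\ge 1: \chi(l)>0\},$$ and for $(m_0,n_0)\in\pi_p(M)\times\pi_p(N)$ $$\chi_{p,m_0,n_0}(l)=\sum_{\substack{m\in M,\ \pi_p(m)=m_0\\ n\in N,\ \pi_p(n)=n_0}}\delta(m,n,l).$$ The pair $(M,N)$ is called sdiOb-sufficient if for every prime $p$ and all $l_a,l_b\in L$ with $l_a/l_b=p^k$ for some $k\ge 1$, at least one of the following holds: $\chi_{p,m_0,n_0}(l_b)\le\chi_{p,m_0,n_0}(l_a)$ for all $(m_0,n_0)\in\pi_p(M)\times\pi_p(N)$, or $\chi_{p,m_0,n_0}(l_b)\ge\chi_{p,m_0,n_0}(l_a)$ for all $(m_0,n_0)\in\pi_p(M)\times\pi_p(N)$. Theorem. Let $(G,g)$ and $(H,h)$ be Orlik blocks, and let $M$ and $N$ be the (finite) sets of orders, as roots of unity, of the eigenvalues of $g$ on $G\otimes_{\mathbb Z}\mathbb C$ and of $h$ on $H\otimes_{\mathbb Z}\mathbb C$. If $(M,N)$ is sdiOb-sufficient,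 then $(G\otimes_{\mathbb Z} H,\,g\otimes h)$ admits a standard decomposition into Orlik blocks. -/

import Mathlib

open scoped TensorProduct

namespace Orlik

/-! ### Companion blocks, Orlik blocks and standard decompositions -/

section Blocks

-- `H` is an abelian group with its `ℤ`-module structure. The canonical instance is switched off in this
-- section, so that submodules and tensor products carry their usual module instances.
attribute [-instance] AddCommGroup.toIntModule

variable {H : Type*} [AddCommGroup H] [Module ℤ H]

/-- A `ℤ`-lattice `H` of some rank `n ≥ 1` with an endomorphism `h` is a companion block if for some
`a₀ ∈ H` (a generating element) the elements `a₀, h a₀, …, h ^ (n - 1) a₀` form a `ℤ`-basis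
of `H`. -/
def IsCompanionBlock (h : Module.End ℤ H) : Prop :=
  ∃ n : ℕ, 0 < n ∧ ∃ (a₀ : H) (b : Module.Basis (Fin n) ℤ H), ∀ j : Fin n, b j = (h ^ (j : ℕ)) a₀

/-- An Orlik block is a companion block whose endomorphism is an automorphism of finite order. -/
def IsOrlikBlock (h : Module.End ℤ H) : Prop :=
  IsCompanionBlock h ∧ IsUnit h ∧ IsOfFinOrder h

/-- `H = B 0 ⊕ … ⊕ B (k - 1)` is a decomposition into `h`-invariant sublattices which are
Orlik blocks with respect to the restrictions of `h`. -/
structure IsOrlikDecomposition (h : Module.End ℤ H) {k : ℕ} (B : Fin k → Submodule ℤ H) :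
    Prop where
  invariant : ∀ i, ∀ x ∈ B i, h x ∈ B i
  isInternal : DirectSum.IsInternal B
  isOrlikBlock : ∀ i, IsOrlikBlock (h.restrict (invariant i))

/-- `(H, h)` admits a standard decomposition into Orlik blocks: a decomposition into Orlik blocks
whose characteristic polynomials satisfy `p_{k-1} ∣ … ∣ p₁ ∣ p₀`. -/
def HasStandardOrlikDecomposition [Module.Free ℤ H] [Module.Finite ℤ H]
    (h : Module.End ℤ H) : Prop :=
  ∃ (k : ℕ) (B : Fin k → Submodule ℤ H) (hB : IsOrlikDecomposition h B),
    ∀ i j : Fin k, i ≤ j →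
      (h.restrict (hB.invariant j)).charpoly ∣ (h.restrict (hB.invariant i)).charpoly

/-- The set of the orders (as roots of unity) of the eigenvalues of `h` on `H_ℂ = ℂ ⊗ H`. -/
def eigenvalueOrders (h : Module.End ℤ H) : Set ℕ :=
  {m | 0 < m ∧ ∃ z : ℂ, Module.End.HasEigenvalue (LinearMap.baseChange ℂ h) z ∧ orderOf z = m}

end Blocks

/-! ### The combinatorial condition

Here `v_p(m)` is `m.factorization p`, and the positive integers of the mathematics are modelled
inside `ℕ`. -/

/-- `β(m, n)` is the product of `p ^ v_p(m)` over the primes `p` with `v_p(m) = v_p(n) > 0`. -/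
def beta (m n : ℕ) : ℕ :=
  ∏ p ∈ m.primeFactors with m.factorization p = n.factorization p, p ^ m.factorization p

/-- `δ(m, n, l)`: if `lcm(m, n) = c * l` with `c ∣ β(m, n)`, it is `φ(gcd(m, n))` times the product
of `(p - 2) / (p - 1)` over the primes `p` with `0 = v_p(c) < v_p(β(m, n))`; otherwise it
is `0`. For `l ∣ lcm(m, n)`, the number `c` is `lcm(m, n) / l`. -/
def delta (m n l : ℕ) : ℚ :=
  if l ∣ m.lcm n ∧ m.lcm n / l ∣ beta m n then
    ((m.gcd n).totient : ℚ) *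
      ∏ p ∈ (beta m n).primeFactors with (m.lcm n / l).factorization p = 0,
        ((p : ℚ) - 2) / ((p : ℚ) - 1)
  else 0

/-- `π_p(m) = m * p ^ (- v_p(m))`. -/
def primeToPart (p m : ℕ) : ℕ := m / p ^ m.factorization p

/-- `χ(l)`, the sum of `δ(m, n, l)` over `(m, n) ∈ M × N`. -/
def chi (M N : Finset ℕ) (l : ℕ) : ℚ :=
  ∑ x ∈ M ×ˢ N, delta x.1 x.2 l

/-- `L(M, N)`, the set of positive integers `l` with `χ(l) > 0`. -/
def orderSet (M N : Finset ℕ) : Set ℕ := {l | 0 < l ∧ 0 < chi M N l}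

/-- `χ_{p,m₀,n₀}(l)`, the part of `χ(l)` coming from the pairs `(m, n) ∈ M × N` with
`π_p(m) = m₀` and `π_p(n) = n₀`. -/
def chiPart (M N : Finset ℕ) (p m₀ n₀ l : ℕ) : ℚ :=
  ∑ x ∈ (M.filter fun m => primeToPart p m = m₀) ×ˢ (N.filter fun n => primeToPart p n = n₀),
    delta x.1 x.2 l

/-- `(a, b)` is a `p`-edge of the directed graph with vertex set `L`: both ends are in `L`, and
`a / b = p ^ k` for some `k ≥ 1`. -/
def IsPrimeEdge (L : Set ℕ) (p a b : ℕ) : Prop :=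
  a ∈ L ∧ b ∈ L ∧ ∃ k : ℕ, 1 ≤ k ∧ a = p ^ k * b

/-- The pair `(M, N)` of finite sets of positive integers is sdiOb-sufficient: for every prime `p`
and every `p`-edge `(a, b)` of `L(M, N)`, the inequality between `χ_{p,m₀,n₀}(b)` and
`χ_{p,m₀,n₀}(a)` has the same direction for all `(m₀, n₀) ∈ π_p(M) × π_p(N)`. -/
def SdiObSufficient (M N : Finset ℕ) : Prop :=
  ∀ p : ℕ, p.Prime → ∀ a b : ℕ, IsPrimeEdge (orderSet M N) p a b →
    (∀ m₀ ∈ M.image (primeToPart p), ∀ n₀ ∈ N.image (primeToPart p),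
      chiPart M N p m₀ n₀ b ≤ chiPart M N p m₀ n₀ a) ∨
    (∀ m₀ ∈ M.image (primeToPart p), ∀ n₀ ∈ N.image (primeToPart p),
      chiPart M N p m₀ n₀ b ≥ chiPart M N p m₀ n₀ a)

end Orlik

/-!
# Tensor products of Orlik blocks

Let `t = g ⊗ 1`, `s = 1 ⊗ h`, and `x = t s = g ⊗ h`, acting on `X = G ⊗ H`, and let `v = a ⊗ b` be
the tensor product of two generating elements. The characteristic polynomial of an Orlik block is
the product of the cyclotomic polynomials `Φ_m` with `m` an eigenvalue order
(`IsOrlikBlock.exists_charpoly_eq`), so `X` is the regular module of `ℤ[T, S] / (f(T), g(S))` with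
`f = ∏_{m ∈ M} Φ_m` and `g = ∏_{n ∈ N} Φ_n`. It is filtered by the `ℤ[x]`-modules `X_j = ∑_{i < j}
ℤ[x] s ^ i v` (`polySpan`). The blocks are obtained by splitting this filtration.

*Characteristic zero.* Let `n` be a common multiple of the elements of `M` and `N`. The
eigenvalues of `t` and `s` are indexed by the elements of `ℤ / n` with order in `M` and in `N`
respectively, and `χ(y) = sumCount _ _ y` is the multiplicity of the eigenvalue of `x` with index
`y`. It depends only on the order of `y`, so `P_j = ∏ Φ_d`, over the orders `d` of the `y` with
`χ(y) > j`, is an integral polynomial with `P_{j+1} ∣ P_j`. For an eigenvalue of multiplicity at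
most `j`, the component of `s ^ j v` in its eigenspace is a combination of those of `s ^ i v`, `i
< j`. Hence `P_j(x) s ^ j v` is in the rational span of `X_j` (`exists_smul_aeval_mem_polySpan`),
and `X_j` has rank `∑_{i < j} deg P_i = ∑_y min(j, χ(y))`.

*Splitting.* Suppose that for all primes `p` and all `j` the image of `X_j` in `k ⊗ X`, for a
field `k` of characteristic `p`, still has at least this dimension. Then `X_j` is a pure subgroup,
`P_j(x) s ^ j v` is in `X_j`, and since `P_0` is squarefree, `s ^ j v` can be corrected by an
element of `X_j` to some `w_j` with `P_j(x) w_j = 0`. The cyclic modules `ℤ[x] w_j` are then Orlik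
blocks with characteristic polynomials `P_j`, and `X` is their direct sum
(`hasStandardOrlikDecomposition_of_filtration`).

*Characteristic `p`.* It remains to bound the dimension of the image of `X_j`. Write the common
multiple as `n p ^ m` with `p ∤ n`. Over `k`, each root `ζ ^ z` of `f` has a multiplicity `|S_z|`,
where `S_z` is the set of the `w ∈ ℤ / p ^ m` such that `(z, w)` has its order in `M`, and
similarly for `g` and sets `S'_z`. At a given root of `x`, the increments of the dimensions of the
quotients by powers of `x - ζ ^ y` bound the dimension from below (`imageDim_add_min_le`), and
these increments are sums over `z` of the numbers `unipotentStep` for the unipotent Jordan blocks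
of sizes `|S_z|` and `|S'_{y-z}|`. As `S_z` and `S'_{y-z}` are unions of layers of elements of
equal order, the function `unipotentStep` is the decreasing rearrangement of the function that
counts the representations `w = u + u'` with `u ∈ S_z`, `u' ∈ S'_{y-z}` (`isRearranged_layers`);
the induction uses the duality `unipotentDim_sub`, which passes to complements. The numbers `δ`
count such representations on cyclic groups, so `χ_{p,m₀,n₀}` is a positive multiple of one of
these functions (`chiPart_eq_delta_mul_sumCount`), and sdiOb-sufficiency says that for fixed `y`
the functions for the different `z` are comonotone (`SdiObSufficient.comonotone`). Rearrangement
is additive on comonotone functions, whence the bound is `∑_y min(j, χ(y))`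
(`SdiObSufficient.sum_min_sumCount_le`).
-/

namespace Orlik

open Polynomial Module

/-! ### Dimensions of quotients by ideals -/

section QuotientDimension

variable {k R : Type*} [Field k] [CommRing R] [Algebra k R]

theorem finite_quotient_of_le {I J : Ideal R} (h : I ≤ J) [Module.Finite k (R ⧸ I)] :
    Module.Finite k (R ⧸ J) :=
  Module.Finite.of_surjective (Ideal.Quotient.factorₐ k h).toLinearMap
    (Ideal.Quotient.factor_surjective h)

theorem finrank_quotient_le_of_le {I J : Ideal R} (h : I ≤ J) [Module.Finite k (R ⧸ I)] :
    finrank k (R ⧸ J) ≤ finrank k (R ⧸ I) :=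
  LinearMap.finrank_le_finrank_of_surjective (f := (Ideal.Quotient.factorₐ k h).toLinearMap)
    (Ideal.Quotient.factor_surjective h)

theorem eq_of_finrank_quotient_eq {I J : Ideal R} (h : I ≤ J) [Module.Finite k (R ⧸ I)]
    (hd : finrank k (R ⧸ I) = finrank k (R ⧸ J)) : I = J := by
  refine le_antisymm h fun x hx => ?_
  have := finite_quotient_of_le (k := k) h
  have hinj : Function.Injective (Ideal.Quotient.factorₐ k h).toLinearMap :=
    (LinearMap.injective_iff_surjective_of_finrank_eq_finrank hd).2
      (Ideal.Quotient.factor_surjective h)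
  rw [← Ideal.Quotient.eq_zero_iff_mem]
  apply hinj
  rw [map_zero]
  exact Ideal.Quotient.eq_zero_iff_mem.2 hx

/-- The short exact sequence `0 → R / (K : t) → R / K → R / (K + (t)) → 0`, on dimensions. -/
theorem finrank_quotient_eq_add_colon (K : Ideal R) (t : R) [Module.Finite k (R ⧸ K)] :
    finrank k (R ⧸ K) = finrank k (R ⧸ (K ⊔ Ideal.span {t})) +
      finrank k (R ⧸ Submodule.comap (LinearMap.mulLeft R t) K) := by
  have hle : K ≤ K ⊔ Ideal.span {t} := le_sup_left
  set ψ := (Ideal.Quotient.factorₐ k hle).toLinearMap with hψ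
  have hs : Function.Surjective ψ := Ideal.Quotient.factor_surjective hle
  rw [← LinearMap.finrank_range_add_finrank_ker ψ, LinearMap.range_eq_top.2 hs, finrank_top]
  congr 1
  let φ : (R ⧸ Submodule.comap (LinearMap.mulLeft R t) K) →ₗ[k] R ⧸ K :=
    (Submodule.mapQ _ K (LinearMap.mulLeft R t) le_rfl).restrictScalars k
  have hφ : Function.Injective φ := by
    rw [← LinearMap.ker_eq_bot, LinearMap.ker_eq_bot']
    intro m hm
    obtain ⟨r, rfl⟩ := Submodule.Quotient.mk_surjective _ m
    exact (Submodule.Quotient.mk_eq_zero _).2 ((Submodule.Quotient.mk_eq_zero K).1 hm)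
  have hr : LinearMap.range φ = LinearMap.ker ψ := by
    ext m
    obtain ⟨r, rfl⟩ := Ideal.Quotient.mk_surjective m
    constructor
    · rintro ⟨z, hz⟩
      obtain ⟨y, rfl⟩ := Submodule.Quotient.mk_surjective _ z
      rw [← hz]
      change Ideal.Quotient.mk (K ⊔ Ideal.span {t}) (t * y) = 0
      exact Ideal.Quotient.eq_zero_iff_mem.2
        (Ideal.mul_mem_right _ _ (Ideal.mem_sup_right (Ideal.mem_span_singleton_self t)))
    · intro h
      have h' : r ∈ K ⊔ Ideal.span {t} := Ideal.Quotient.eq_zero_iff_mem.1 h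
      obtain ⟨a, ha, b, hb, rfl⟩ := Submodule.mem_sup.1 h'
      obtain ⟨c, rfl⟩ := Ideal.mem_span_singleton.1 hb
      refine ⟨Submodule.Quotient.mk c, ?_⟩
      change Ideal.Quotient.mk K (t * c) = _
      rw [Ideal.Quotient.mk_eq_mk_iff_sub_mem]
      simpa using ha
  rw [← hr, LinearMap.finrank_range_of_inj hφ]

/-- If `t t' ∈ J` and the dimensions show that `(t')` is the whole annihilator of `t` modulo `J`,
then `R / (J + (t u))` splits off `R / (J + (t))` with remainder `R / (J + (t', u))`. -/
theorem finrank_quotient_sup_mul_of_annihilator (J : Ideal R) [Module.Finite k (R ⧸ J)]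
    {t t' : R} (u : R) (h0 : t * t' ∈ J)
    (hd : finrank k (R ⧸ (J ⊔ Ideal.span {t})) + finrank k (R ⧸ (J ⊔ Ideal.span {t'})) =
      finrank k (R ⧸ J)) :
    finrank k (R ⧸ (J ⊔ Ideal.span {t * u})) =
      finrank k (R ⧸ (J ⊔ Ideal.span {t})) +
        finrank k (R ⧸ (J ⊔ Ideal.span {t'} ⊔ Ideal.span {u})) := by
  have hfin : Module.Finite k (R ⧸ (J ⊔ Ideal.span {t * u})) := finite_quotient_of_le le_sup_left
  have hfin' : Module.Finite k (R ⧸ (J ⊔ Ideal.span {t'})) := finite_quotient_of_le le_sup_left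
  have h1 := finrank_quotient_eq_add_colon (k := k) J t
  have hle : J ⊔ Ideal.span {t'} ≤ Submodule.comap (LinearMap.mulLeft R t) J := by
    refine sup_le (fun x hx => ?_) ((Ideal.span_singleton_le_iff_mem _).2 h0)
    exact Ideal.mul_mem_left _ _ hx
  have h2 : J ⊔ Ideal.span {t'} = Submodule.comap (LinearMap.mulLeft R t) J :=
    eq_of_finrank_quotient_eq (k := k) hle (by omega)
  rw [finrank_quotient_eq_add_colon (k := k) (J ⊔ Ideal.span {t * u}) t]
  have h3 : J ⊔ Ideal.span {t * u} ⊔ Ideal.span {t} = J ⊔ Ideal.span {t} := by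
    refine le_antisymm (sup_le (sup_le le_sup_left ?_) le_sup_right)
      (sup_le (le_sup_left.trans le_sup_left) le_sup_right)
    rw [Ideal.span_singleton_le_iff_mem]
    exact Ideal.mul_mem_right _ _ (Ideal.mem_sup_right (Ideal.mem_span_singleton_self t))
  have h4 : Submodule.comap (LinearMap.mulLeft R t) (J ⊔ Ideal.span {t * u}) =
      J ⊔ Ideal.span {t'} ⊔ Ideal.span {u} := by
    rw [h2]
    apply le_antisymm
    · intro z hz
      obtain ⟨a, ha, b, hb, hab⟩ := Submodule.mem_sup.1 (Submodule.mem_comap.1 hz)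
      obtain ⟨w, rfl⟩ := Ideal.mem_span_singleton.1 hb
      have : z = (z - u * w) + u * w := by ring
      rw [this]
      refine Ideal.add_mem _ (Ideal.mem_sup_left ?_)
        (Ideal.mul_mem_right _ _ (Ideal.mem_sup_right (Ideal.mem_span_singleton_self u)))
      change t * (z - u * w) ∈ J
      have hab' : a + t * u * w = t * z := hab
      have : t * (z - u * w) = a := by linear_combination -hab'
      rwa [this]
    · refine sup_le (fun z hz => Ideal.mem_sup_left hz) ?_
      rw [Ideal.span_singleton_le_iff_mem]
      exact Ideal.mem_sup_right (Ideal.mem_span_singleton_self (t * u))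
  rw [h3, h4]

theorem finrank_quotient_sup_mul_of_isCoprime (J : Ideal R) {a b : R} (hab : IsCoprime a b)
    [Module.Finite k (R ⧸ (J ⊔ Ideal.span {a * b}))] :
    finrank k (R ⧸ (J ⊔ Ideal.span {a * b})) =
      finrank k (R ⧸ (J ⊔ Ideal.span {a})) + finrank k (R ⧸ (J ⊔ Ideal.span {b})) := by
  rw [finrank_quotient_eq_add_colon (k := k) (J ⊔ Ideal.span {a * b}) a]
  have h3 : J ⊔ Ideal.span {a * b} ⊔ Ideal.span {a} = J ⊔ Ideal.span {a} := by
    refine le_antisymm (sup_le (sup_le le_sup_left ?_) le_sup_right)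
      (sup_le (le_sup_left.trans le_sup_left) le_sup_right)
    rw [Ideal.span_singleton_le_iff_mem]
    exact Ideal.mul_mem_right _ _ (Ideal.mem_sup_right (Ideal.mem_span_singleton_self a))
  have h4 : Submodule.comap (LinearMap.mulLeft R a) (J ⊔ Ideal.span {a * b}) =
      J ⊔ Ideal.span {b} := by
    obtain ⟨r, s, hrs⟩ := hab
    apply le_antisymm
    · intro z hz
      obtain ⟨j, hj, c, hc, hjc⟩ := Submodule.mem_sup.1 (Submodule.mem_comap.1 hz)
      obtain ⟨w, rfl⟩ := Ideal.mem_span_singleton.1 hc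
      have hjc' : j + a * b * w = a * z := hjc
      have : z = r * j + b * (r * a * w + s * z) := by
        linear_combination (-z) * hrs - r * hjc'
      rw [this]
      exact Ideal.add_mem _ (Ideal.mem_sup_left (Ideal.mul_mem_left _ _ hj))
        (Ideal.mul_mem_right _ _ (Ideal.mem_sup_right (Ideal.mem_span_singleton_self b)))
    · refine sup_le (fun z hz => Ideal.mem_sup_left (Ideal.mul_mem_left _ _ hz)) ?_
      rw [Ideal.span_singleton_le_iff_mem]
      exact Ideal.mem_sup_right (Ideal.mem_span_singleton_self (a * b))
  rw [h3, h4]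

end QuotientDimension

/-! ### Quotients of the polynomial ring in two variables -/

section PlanarIdeals

variable {k : Type*} [Field k]

/-- The ideal `(f(T), g(S))` of `k[T, S]`; here `T = X 0` and `S = X 1`. -/
noncomputable def gridIdeal (f g : k[X]) : Ideal (MvPolynomial (Fin 2) k) :=
  Ideal.span {aeval (MvPolynomial.X 0) f} ⊔ Ideal.span {aeval (MvPolynomial.X 1) g}

/-- The dimension of `k[T, S] / (f(T), g(S), F(T S))`. -/
noncomputable def tripleDim (f g F : k[X]) : ℕ :=
  finrank k (MvPolynomial (Fin 2) k ⧸
    (gridIdeal f g ⊔ Ideal.span {aeval (MvPolynomial.X 0 * MvPolynomial.X 1) F}))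

/-- `k[T, S] / (f(T), g(S))` is `k[T] / (f) ⊗ k[S] / (g)`. -/
noncomputable def gridQuotientEquiv (f g : k[X]) :
    (MvPolynomial (Fin 2) k ⧸ gridIdeal f g) ≃ₐ[k] AdjoinRoot f ⊗[k] AdjoinRoot g :=
  have h0 : aeval (Ideal.Quotient.mk (gridIdeal f g) (MvPolynomial.X 0)) f = 0 := by
    rw [← Ideal.Quotient.mkₐ_eq_mk k, aeval_algHom_apply, Ideal.Quotient.mkₐ_eq_mk,
      Ideal.Quotient.eq_zero_iff_mem]
    exact Ideal.mem_sup_left (Ideal.mem_span_singleton_self _)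
  have h1 : aeval (Ideal.Quotient.mk (gridIdeal f g) (MvPolynomial.X 1)) g = 0 := by
    rw [← Ideal.Quotient.mkₐ_eq_mk k, aeval_algHom_apply, Ideal.Quotient.mkₐ_eq_mk,
      Ideal.Quotient.eq_zero_iff_mem]
    exact Ideal.mem_sup_right (Ideal.mem_span_singleton_self _)
  have h2 : aeval (AdjoinRoot.root f ⊗ₜ[k] (1 : AdjoinRoot g)) f = 0 := by
    have := aeval_algHom_apply
      (Algebra.TensorProduct.includeLeft : AdjoinRoot f →ₐ[k] AdjoinRoot f ⊗[k] AdjoinRoot g)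
      (AdjoinRoot.root f) f
    rwa [AdjoinRoot.aeval_eq, AdjoinRoot.mk_self, map_zero] at this
  have h3 : aeval ((1 : AdjoinRoot f) ⊗ₜ[k] AdjoinRoot.root g) g = 0 := by
    have := aeval_algHom_apply
      (Algebra.TensorProduct.includeRight : AdjoinRoot g →ₐ[k] AdjoinRoot f ⊗[k] AdjoinRoot g)
      (AdjoinRoot.root g) g
    rwa [AdjoinRoot.aeval_eq, AdjoinRoot.mk_self, map_zero] at this
  AlgEquiv.ofAlgHom
    (Ideal.Quotient.liftₐ _
      (MvPolynomial.aeval ![AdjoinRoot.root f ⊗ₜ[k] 1, 1 ⊗ₜ[k] AdjoinRoot.root g]) (by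
        intro a ha
        have : gridIdeal f g ≤ RingHom.ker (MvPolynomial.aeval (R := k)
            ![AdjoinRoot.root f ⊗ₜ[k] (1 : AdjoinRoot g), 1 ⊗ₜ[k] AdjoinRoot.root g]) := by
          refine sup_le ?_ ?_
          · rw [Ideal.span_singleton_le_iff_mem, RingHom.mem_ker, ← aeval_algHom_apply,
              MvPolynomial.aeval_X]
            exact h2
          · rw [Ideal.span_singleton_le_iff_mem, RingHom.mem_ker, ← aeval_algHom_apply,
              MvPolynomial.aeval_X]
            exact h3
        exact this ha))
    (Algebra.TensorProduct.lift
      (AdjoinRoot.liftAlgHom f (Algebra.ofId k _) _ h0)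
      (AdjoinRoot.liftAlgHom g (Algebra.ofId k _) _ h1) (fun _ _ => Commute.all _ _))
    (by
      ext
      · simp [AdjoinRoot.liftAlgHom]
        exact MvPolynomial.aeval_X (R := k) _ (0 : Fin 2)
      · simp [AdjoinRoot.liftAlgHom]
        exact MvPolynomial.aeval_X (R := k) _ (1 : Fin 2))
    (by
      refine Ideal.Quotient.algHom_ext _ (MvPolynomial.algHom_ext fun i => ?_)
      change Algebra.TensorProduct.lift _ _ (fun _ _ => Commute.all _ _) (MvPolynomial.aeval
        ![AdjoinRoot.root f ⊗ₜ[k] (1 : AdjoinRoot g), 1 ⊗ₜ[k] AdjoinRoot.root g]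
        (MvPolynomial.X i)) = Ideal.Quotient.mk (gridIdeal f g) (MvPolynomial.X i)
      rw [MvPolynomial.aeval_X]
      fin_cases i
      · simp [AdjoinRoot.liftAlgHom]
      · simp [AdjoinRoot.liftAlgHom])

theorem finrank_quotient_gridIdeal {f g : k[X]} (hf : f.Monic) (hg : g.Monic) :
    finrank k (MvPolynomial (Fin 2) k ⧸ gridIdeal f g) = f.natDegree * g.natDegree := by
  rw [(gridQuotientEquiv f g).toLinearEquiv.finrank_eq, finrank_tensorProduct,
    (AdjoinRoot.powerBasis' hf).finrank, (AdjoinRoot.powerBasis' hg).finrank]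
  rfl

theorem finite_quotient_gridIdeal {f g : k[X]} (hf : f.Monic) (hg : g.Monic) :
    Module.Finite k (MvPolynomial (Fin 2) k ⧸ gridIdeal f g) := by
  have := (AdjoinRoot.powerBasis' hf).finite
  have := (AdjoinRoot.powerBasis' hg).finite
  exact Module.Finite.equiv (gridQuotientEquiv f g).symm.toLinearEquiv

theorem finite_quotient_of_gridIdeal_le {f g : k[X]} (hf : f.Monic) (hg : g.Monic)
    {I : Ideal (MvPolynomial (Fin 2) k)} (hI : gridIdeal f g ≤ I) :
    Module.Finite k (MvPolynomial (Fin 2) k ⧸ I) :=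
  have := finite_quotient_gridIdeal hf hg
  finite_quotient_of_le hI

theorem finrank_quotient_eq_of_map_eq {I J : Ideal (MvPolynomial (Fin 2) k)}
    (e : MvPolynomial (Fin 2) k ≃ₐ[k] MvPolynomial (Fin 2) k)
    (h : J = I.map (e : MvPolynomial (Fin 2) k →+* MvPolynomial (Fin 2) k)) :
    finrank k (MvPolynomial (Fin 2) k ⧸ I) = finrank k (MvPolynomial (Fin 2) k ⧸ J) :=
  (Ideal.quotientEquivAlg I J e h).toLinearEquiv.finrank_eq

theorem tripleDim_comm (f g F : k[X]) : tripleDim f g F = tripleDim g f F := by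
  refine finrank_quotient_eq_of_map_eq (MvPolynomial.renameEquiv k (Equiv.swap 0 1)) ?_
  have key (P : k[X]) (z : MvPolynomial (Fin 2) k) :
      ((MvPolynomial.renameEquiv k (Equiv.swap (0 : Fin 2) 1) :
        MvPolynomial (Fin 2) k →+* MvPolynomial (Fin 2) k)) (aeval z P) =
      aeval (MvPolynomial.renameEquiv k (Equiv.swap (0 : Fin 2) 1) z) P :=
    (aeval_algHom_apply (MvPolynomial.renameEquiv k (Equiv.swap (0 : Fin 2) 1)) z P).symm
  simp only [gridIdeal, Ideal.map_sup, Ideal.map_span, Set.image_singleton, key]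
  simp only [map_mul, MvPolynomial.renameEquiv_apply, MvPolynomial.rename_X,
    Equiv.swap_apply_left, Equiv.swap_apply_right]
  rw [mul_comm (MvPolynomial.X (R := k) (1 : Fin 2)) (MvPolynomial.X 0),
    sup_comm (Ideal.span {aeval (MvPolynomial.X (R := k) (1 : Fin 2)) f})]

theorem tripleDim_mul_left {f₁ f₂ g : k[X]} (hf₁ : f₁.Monic) (hf₂ : f₂.Monic) (hg : g.Monic)
    (h : IsCoprime f₁ f₂) (F : k[X]) :
    tripleDim (f₁ * f₂) g F = tripleDim f₁ g F + tripleDim f₂ g F := by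
  have e (f : k[X]) : gridIdeal f g ⊔
      Ideal.span {aeval (MvPolynomial.X 0 * MvPolynomial.X (R := k) (1 : Fin 2)) F} =
      (Ideal.span {aeval (MvPolynomial.X 1) g} ⊔
        Ideal.span {aeval (MvPolynomial.X 0 * MvPolynomial.X 1) F}) ⊔
      Ideal.span {aeval (MvPolynomial.X 0) f} := by
    rw [gridIdeal, sup_assoc, sup_comm]
  unfold tripleDim
  have := finite_quotient_of_gridIdeal_le (hf₁.mul hf₂) hg (I := gridIdeal (f₁ * f₂) g ⊔
      Ideal.span {aeval (MvPolynomial.X 0 * MvPolynomial.X (R := k) (1 : Fin 2)) F}) le_sup_left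
  rw [e, map_mul] at this
  rw [e, e, e, map_mul]
  exact finrank_quotient_sup_mul_of_isCoprime _ (h.map (aeval (MvPolynomial.X 0) :
    k[X] →ₐ[k] MvPolynomial (Fin 2) k).toRingHom)

theorem tripleDim_one_left (g F : k[X]) : tripleDim 1 g F = 0 := by
  have : gridIdeal 1 g ⊔ Ideal.span {aeval (MvPolynomial.X 0 * MvPolynomial.X (R := k) (1 : Fin 2))
      F} = ⊤ := by
    rw [Ideal.eq_top_iff_one]
    refine Ideal.mem_sup_left (Ideal.mem_sup_left ?_)
    rw [map_one]
    exact Ideal.mem_span_singleton_self _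
  rw [tripleDim, this]
  exact finrank_zero_of_subsingleton

theorem tripleDim_prod_left {ι : Type*} (s : Finset ι) (f : ι → k[X]) {g : k[X]}
    (hf : ∀ i ∈ s, (f i).Monic) (hg : g.Monic)
    (hc : (s : Set ι).Pairwise fun i j => IsCoprime (f i) (f j)) (F : k[X]) :
    tripleDim (∏ i ∈ s, f i) g F = ∑ i ∈ s, tripleDim (f i) g F := by
  classical
  induction s using Finset.induction_on with
  | empty => simp [tripleDim_one_left]
  | insert i s hi ih =>
    rw [Finset.prod_insert hi, Finset.sum_insert hi, tripleDim_mul_left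
      (hf i (Finset.mem_insert_self _ _))
      (monic_prod_of_monic _ _ fun j hj => hf j (Finset.mem_insert_of_mem hj)) hg, ih]
    · exact fun j hj => hf j (Finset.mem_insert_of_mem hj)
    · exact hc.mono (by simp)
    · refine IsCoprime.prod_right fun j hj => hc (by simp) (by simp [hj]) ?_
      rintro rfl
      exact hi hj

/-- The dimension of `k[T, S] / ((T - 1) ^ a, (S - 1) ^ b, (T S - 1) ^ c)`. -/
noncomputable def unipotentDim (k : Type*) [Field k] (a b c : ℕ) : ℕ :=
  tripleDim ((X - 1 : k[X]) ^ a) ((X - 1 : k[X]) ^ b) ((X - 1 : k[X]) ^ c)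

theorem monic_X_sub_one_pow (a : ℕ) : ((X - 1 : k[X]) ^ a).Monic := by
  simpa using (monic_X_sub_C (1 : k)).pow a

theorem natDegree_X_sub_one_pow (a : ℕ) : ((X - 1 : k[X]) ^ a).natDegree = a := by
  rw [natDegree_pow, ← C_1, natDegree_X_sub_C, mul_one]

theorem unipotentDim_comm (a b c : ℕ) : unipotentDim k a b c = unipotentDim k b a c :=
  tripleDim_comm _ _ _

theorem unipotentDim_zero_left (b c : ℕ) : unipotentDim k 0 b c = 0 := by
  rw [unipotentDim, pow_zero, tripleDim_one_left]

/-- Near `(t, s)` only the root `t s` of `F` matters, and scaling moves `(t, s)` to `(1, 1)`. -/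
theorem tripleDim_X_sub_C_pow {t s : k} (ht : t ≠ 0) (hs : s ≠ 0) (a b : ℕ) {F : k[X]}
    (hF : F ≠ 0) :
    tripleDim ((X - C t) ^ a) ((X - C s) ^ b) F =
      unipotentDim k a b (F.rootMultiplicity (t * s)) := by
  obtain ⟨G, hFG, hG⟩ := exists_eq_pow_rootMultiplicity_mul_and_not_dvd F hF (t * s)
  set c := F.rootMultiplicity (t * s)
  set T : MvPolynomial (Fin 2) k := MvPolynomial.X 0
  set S : MvPolynomial (Fin 2) k := MvPolynomial.X 1
  set I := gridIdeal ((X - C t) ^ a) ((X - C s) ^ b) with hI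
  have hTI : (T - MvPolynomial.C t) ^ a ∈ I := by
    refine Ideal.mem_sup_left ?_
    simp only [map_pow, map_sub, aeval_X, aeval_C]
    exact Ideal.mem_span_singleton_self _
  have hSI : (S - MvPolynomial.C s) ^ b ∈ I := by
    refine Ideal.mem_sup_right ?_
    simp only [map_pow, map_sub, aeval_X, aeval_C]
    exact Ideal.mem_span_singleton_self _
  have hnil : (T * S - MvPolynomial.C (t * s)) ^ (a + b) ∈ I := by
    have : T * S - MvPolynomial.C (t * s) =
        (T - MvPolynomial.C t) * S + MvPolynomial.C t * (S - MvPolynomial.C s) := by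
      rw [map_mul]; ring
    rw [this]
    refine Ideal.add_pow_mem_of_pow_mem_of_le I (m := a) (n := b) ?_ ?_ (by omega)
    · rw [mul_pow]; exact Ideal.mul_mem_right _ _ hTI
    · rw [mul_pow]; exact Ideal.mul_mem_left _ _ hSI
  have hcop : IsCoprime ((X - C (t * s)) ^ (a + b)) G :=
    IsCoprime.pow_left ((irreducible_X_sub_C _).coprime_iff_not_dvd.2 hG)
  have hideal : I ⊔ Ideal.span {aeval (T * S) F} =
      I ⊔ Ideal.span {(T * S - MvPolynomial.C (t * s)) ^ c} := by
    have e1 : aeval (T * S) F = (T * S - MvPolynomial.C (t * s)) ^ c * aeval (T * S) G := by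
      conv_lhs => rw [hFG]
      simp only [map_mul, map_pow, map_sub, aeval_X, aeval_C, MvPolynomial.algebraMap_eq]
    apply le_antisymm
    · refine sup_le le_sup_left ?_
      rw [Ideal.span_singleton_le_iff_mem, e1]
      exact Ideal.mul_mem_right _ _ (Ideal.mem_sup_right (Ideal.mem_span_singleton_self _))
    · refine sup_le le_sup_left ?_
      rw [Ideal.span_singleton_le_iff_mem]
      obtain ⟨u, w, huw⟩ := hcop
      have e2 : aeval (T * S) u * (T * S - MvPolynomial.C (t * s)) ^ (a + b) +
          aeval (T * S) w * aeval (T * S) G = 1 := by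
        have := congrArg (aeval (T * S)) huw
        rwa [map_add, map_mul (aeval (T * S)) u, map_mul (aeval (T * S)) w, map_pow, map_sub, aeval_X, aeval_C,
          MvPolynomial.algebraMap_eq, map_one] at this
      have e3 : (T * S - MvPolynomial.C (t * s)) ^ c =
          ((T * S - MvPolynomial.C (t * s)) ^ c * aeval (T * S) u) *
            (T * S - MvPolynomial.C (t * s)) ^ (a + b) + aeval (T * S) w * aeval (T * S) F := by
        rw [e1]
        linear_combination (-(T * S - MvPolynomial.C (t * s)) ^ c) * e2
      rw [e3]
      exact Ideal.add_mem _ (Ideal.mul_mem_left _ _ (Ideal.mem_sup_left hnil))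
        (Ideal.mul_mem_left _ _ (Ideal.mem_sup_right (Ideal.mem_span_singleton_self _)))
  unfold tripleDim unipotentDim
  rw [hideal]
  let e : MvPolynomial (Fin 2) k ≃ₐ[k] MvPolynomial (Fin 2) k :=
    AlgEquiv.ofAlgHom
      (MvPolynomial.aeval ![MvPolynomial.C t * T, MvPolynomial.C s * S])
      (MvPolynomial.aeval ![MvPolynomial.C t⁻¹ * T, MvPolynomial.C s⁻¹ * S])
      (by
        ext i
        fin_cases i
        · simp [T, ← mul_assoc, ← MvPolynomial.C_mul, ht]
        · simp [S, ← mul_assoc, ← MvPolynomial.C_mul, hs])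
      (by
        ext i
        fin_cases i
        · simp [T, ← mul_assoc, ← MvPolynomial.C_mul, ht]
        · simp [S, ← mul_assoc, ← MvPolynomial.C_mul, hs])
  have eT : e T = MvPolynomial.C t * T := by simp [e, T]
  have eS : e S = MvPolynomial.C s * S := by simp [e, S]
  have eC (r : k) : e (MvPolynomial.C r) = MvPolynomial.C r := e.commutes r
  have span_unit (r : k) (hr : r ≠ 0) (m : ℕ) (z : MvPolynomial (Fin 2) k) :
      Ideal.span {(MvPolynomial.C r * z - MvPolynomial.C r) ^ m} = Ideal.span {(z - 1) ^ m} := by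
    have : (MvPolynomial.C r * z - MvPolynomial.C r) ^ m =
        MvPolynomial.C (r ^ m) * (z - 1) ^ m := by
      rw [map_pow, ← mul_pow]; ring
    rw [this]
    exact Ideal.span_singleton_mul_left_unit
      ((isUnit_iff_ne_zero.2 (pow_ne_zero m hr)).map MvPolynomial.C) _
  refine finrank_quotient_eq_of_map_eq e ?_
  simp only [hI, gridIdeal, Ideal.map_sup, Ideal.map_span, Set.image_singleton, map_pow, map_sub,
    aeval_X, aeval_C, MvPolynomial.algebraMap_eq, map_one, RingHom.coe_coe, eC]
  change _ = Ideal.span {(e T - MvPolynomial.C t) ^ a} ⊔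
    Ideal.span {(e S - MvPolynomial.C s) ^ b} ⊔
    Ideal.span {(e (T * S) - MvPolynomial.C (t * s)) ^ c}
  rw [map_mul, eT, eS, span_unit t ht, span_unit s hs]
  have : MvPolynomial.C t * T * (MvPolynomial.C s * S) =
      MvPolynomial.C (t * s) * (T * S) := by rw [map_mul]; ring
  rw [this, span_unit (t * s) (mul_ne_zero ht hs)]

end PlanarIdeals

/-! ### Duality for pairs of unipotent Jordan blocks -/

section UnipotentDuality

variable {k : Type*} [Field k] {p : ℕ} [Fact p.Prime] [CharP k p]

theorem gridIdeal_X_sub_one_pow (a b : ℕ) :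
    gridIdeal ((X - 1 : k[X]) ^ a) ((X - 1 : k[X]) ^ b) =
      Ideal.span {(MvPolynomial.X 0 - 1) ^ a} ⊔ Ideal.span {(MvPolynomial.X 1 - 1) ^ b} := by
  simp [gridIdeal]

theorem unipotentDim_eq (a b c : ℕ) :
    unipotentDim k a b c = finrank k (MvPolynomial (Fin 2) k ⧸
      (Ideal.span {(MvPolynomial.X 0 - 1) ^ a} ⊔ Ideal.span {(MvPolynomial.X 1 - 1) ^ b} ⊔
        Ideal.span {(MvPolynomial.X (R := k) (0 : Fin 2) * MvPolynomial.X 1 - 1) ^ c})) := by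
  have : aeval (MvPolynomial.X (R := k) (0 : Fin 2) * MvPolynomial.X 1) ((X - 1 : k[X]) ^ c) =
      (MvPolynomial.X 0 * MvPolynomial.X 1 - 1) ^ c := by simp
  rw [unipotentDim, tripleDim, gridIdeal_X_sub_one_pow, this]

theorem finrank_quotient_unipotent (a b : ℕ) :
    finrank k (MvPolynomial (Fin 2) k ⧸
      (Ideal.span {(MvPolynomial.X 0 - 1) ^ a} ⊔
        Ideal.span {(MvPolynomial.X (R := k) (1 : Fin 2) - 1) ^ b})) = a * b := by
  rw [← gridIdeal_X_sub_one_pow, finrank_quotient_gridIdeal (monic_X_sub_one_pow a)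
    (monic_X_sub_one_pow b), natDegree_X_sub_one_pow, natDegree_X_sub_one_pow]

theorem pow_mem_of_mem_span_pow {R : Type*} [CommRing R] (z : R) {b q : ℕ} (hb : b ≤ q) :
    z ^ q ∈ Ideal.span {z ^ b} :=
  Ideal.mem_span_singleton.2 (pow_dvd_pow z hb)

variable (k p) in
theorem X_one_pow_sub_one_mem {n b : ℕ} (hb : b ≤ p ^ n) :
    (MvPolynomial.X (R := k) (1 : Fin 2)) ^ p ^ n - 1 ∈
      Ideal.span {(MvPolynomial.X (R := k) (1 : Fin 2) - 1) ^ b} := by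
  rw [show (MvPolynomial.X (R := k) (1 : Fin 2)) ^ p ^ n - 1 = (MvPolynomial.X 1 - 1) ^ p ^ n by
    rw [sub_pow_char_pow, one_pow]]
  exact pow_mem_of_mem_span_pow _ hb

variable (k p) in
/-- Modulo `(S - 1) ^ b` with `b ≤ q = p ^ n`, the variable `S` is invertible with inverse
`S ^ (q - 1)`, so `T ↦ T S` is an automorphism that carries `T - 1` to `T S - 1`. -/
theorem finrank_quotient_unipotent_mul {n b : ℕ} (c : ℕ) (hb : b ≤ p ^ n) :
    finrank k (MvPolynomial (Fin 2) k ⧸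
      (Ideal.span {(MvPolynomial.X 0 * MvPolynomial.X 1 - 1) ^ c} ⊔
        Ideal.span {(MvPolynomial.X (R := k) (1 : Fin 2) - 1) ^ b})) = c * b := by
  set I := Ideal.span {(MvPolynomial.X 0 - 1) ^ c} ⊔
        Ideal.span {(MvPolynomial.X (R := k) (1 : Fin 2) - 1) ^ b} with hI
  set J := Ideal.span {(MvPolynomial.X 0 * MvPolynomial.X 1 - 1) ^ c} ⊔
        Ideal.span {(MvPolynomial.X (R := k) (1 : Fin 2) - 1) ^ b} with hJ
  rw [← finrank_quotient_unipotent (k := k) c b]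
  have hq : p ^ n = (p ^ n - 1) + 1 :=
    (Nat.sub_add_cancel (Nat.one_le_pow _ _ (Fact.out : p.Prime).pos)).symm
  have hSI : (Ideal.Quotient.mk I (MvPolynomial.X 1)) ^ (p ^ n - 1) *
      (Ideal.Quotient.mk I (MvPolynomial.X 1)) = 1 := by
    rw [← pow_succ, ← hq, ← map_pow, ← map_one (Ideal.Quotient.mk I),
      Ideal.Quotient.mk_eq_mk_iff_sub_mem]
    exact Ideal.mem_sup_right (X_one_pow_sub_one_mem k p hb)
  have hSJ : (Ideal.Quotient.mk J (MvPolynomial.X 1)) ^ (p ^ n - 1) *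
      (Ideal.Quotient.mk J (MvPolynomial.X 1)) = 1 := by
    rw [← pow_succ, ← hq, ← map_pow, ← map_one (Ideal.Quotient.mk J),
      Ideal.Quotient.mk_eq_mk_iff_sub_mem]
    exact Ideal.mem_sup_right (X_one_pow_sub_one_mem k p hb)
  let φ : MvPolynomial (Fin 2) k →ₐ[k] MvPolynomial (Fin 2) k ⧸ I :=
    MvPolynomial.aeval ![Ideal.Quotient.mk I (MvPolynomial.X 0) *
      Ideal.Quotient.mk I (MvPolynomial.X 1) ^ (p ^ n - 1), Ideal.Quotient.mk I (MvPolynomial.X 1)]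
  let ψ : MvPolynomial (Fin 2) k →ₐ[k] MvPolynomial (Fin 2) k ⧸ J :=
    MvPolynomial.aeval ![Ideal.Quotient.mk J (MvPolynomial.X 0) *
      Ideal.Quotient.mk J (MvPolynomial.X 1), Ideal.Quotient.mk J (MvPolynomial.X 1)]
  have φ0 : φ (MvPolynomial.X 0) = Ideal.Quotient.mk I (MvPolynomial.X 0) *
      Ideal.Quotient.mk I (MvPolynomial.X 1) ^ (p ^ n - 1) := by simp [φ]
  have φ1 : φ (MvPolynomial.X 1) = Ideal.Quotient.mk I (MvPolynomial.X 1) := by simp [φ]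
  have ψ0 : ψ (MvPolynomial.X 0) = Ideal.Quotient.mk J (MvPolynomial.X 0) *
      Ideal.Quotient.mk J (MvPolynomial.X 1) := by simp [ψ]
  have ψ1 : ψ (MvPolynomial.X 1) = Ideal.Quotient.mk J (MvPolynomial.X 1) := by simp [ψ]
  have hφ : ∀ a ∈ J, φ a = 0 := by
    intro a ha
    have hle : J ≤ RingHom.ker φ := by
      refine sup_le ?_ ?_
      · rw [Ideal.span_singleton_le_iff_mem, RingHom.mem_ker, map_pow, map_sub, map_mul, φ0, φ1,
          map_one, mul_assoc, hSI, mul_one, ← map_one (Ideal.Quotient.mk I), ← map_sub, ← map_pow,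
          Ideal.Quotient.eq_zero_iff_mem]
        exact Ideal.mem_sup_left (Ideal.mem_span_singleton_self _)
      · rw [Ideal.span_singleton_le_iff_mem, RingHom.mem_ker, map_pow, map_sub, φ1,
          map_one, ← map_one (Ideal.Quotient.mk I), ← map_sub, ← map_pow,
          Ideal.Quotient.eq_zero_iff_mem]
        exact Ideal.mem_sup_right (Ideal.mem_span_singleton_self _)
    exact hle ha
  have hψ : ∀ a ∈ I, ψ a = 0 := by
    intro a ha
    have hle : I ≤ RingHom.ker ψ := by
      refine sup_le ?_ ?_
      · rw [Ideal.span_singleton_le_iff_mem, RingHom.mem_ker, map_pow, map_sub, ψ0,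
          map_one, ← map_mul, ← map_one (Ideal.Quotient.mk J), ← map_sub, ← map_pow,
          Ideal.Quotient.eq_zero_iff_mem]
        exact Ideal.mem_sup_left (Ideal.mem_span_singleton_self _)
      · rw [Ideal.span_singleton_le_iff_mem, RingHom.mem_ker, map_pow, map_sub, ψ1,
          map_one, ← map_one (Ideal.Quotient.mk J), ← map_sub, ← map_pow,
          Ideal.Quotient.eq_zero_iff_mem]
        exact Ideal.mem_sup_right (Ideal.mem_span_singleton_self _)
    exact hle ha
  let Φ := Ideal.Quotient.liftₐ J φ hφ
  let Ψ := Ideal.Quotient.liftₐ I ψ hψ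
  have hΦ (z) : Φ (Ideal.Quotient.mk J z) = φ z := rfl
  have hΨ (z) : Ψ (Ideal.Quotient.mk I z) = ψ z := rfl
  refine (AlgEquiv.ofAlgHom Φ Ψ ?_ ?_).toLinearEquiv.finrank_eq
  · refine Ideal.Quotient.algHom_ext _ (MvPolynomial.algHom_ext fun i => ?_)
    change Φ (Ψ (Ideal.Quotient.mk I (MvPolynomial.X i))) = Ideal.Quotient.mk I (MvPolynomial.X i)
    rw [hΨ]
    fin_cases i
    · change Φ (ψ (MvPolynomial.X 0)) = Ideal.Quotient.mk I (MvPolynomial.X 0)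
      rw [ψ0, map_mul, hΦ, hΦ, φ0, φ1, mul_assoc, hSI, mul_one]
    · change Φ (ψ (MvPolynomial.X 1)) = Ideal.Quotient.mk I (MvPolynomial.X 1)
      rw [ψ1, hΦ, φ1]
  · refine Ideal.Quotient.algHom_ext _ (MvPolynomial.algHom_ext fun i => ?_)
    change Ψ (Φ (Ideal.Quotient.mk J (MvPolynomial.X i))) = Ideal.Quotient.mk J (MvPolynomial.X i)
    rw [hΦ]
    fin_cases i
    · change Ψ (φ (MvPolynomial.X 0)) = Ideal.Quotient.mk J (MvPolynomial.X 0)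
      rw [φ0, map_mul, map_pow, hΨ, hΨ, ψ0, ψ1, mul_assoc, mul_comm _ (_ ^ _), hSJ, mul_one]
    · change Ψ (φ (MvPolynomial.X 1)) = Ideal.Quotient.mk J (MvPolynomial.X 1)
      rw [φ1, hΨ, ψ1]

variable (k p) in
theorem mul_pow_sub_one_mem {n a b : ℕ} (ha : a ≤ p ^ n) (hb : b ≤ p ^ n) :
    (MvPolynomial.X (R := k) (0 : Fin 2) * MvPolynomial.X 1 - 1) ^ p ^ n ∈
      Ideal.span {(MvPolynomial.X 0 - 1) ^ a} ⊔
        Ideal.span {(MvPolynomial.X (R := k) (1 : Fin 2) - 1) ^ b} := by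
  have h0 : (MvPolynomial.X (R := k) (0 : Fin 2)) ^ p ^ n - 1 ∈
      Ideal.span {(MvPolynomial.X (R := k) (0 : Fin 2) - 1) ^ a} := by
    rw [show (MvPolynomial.X (R := k) (0 : Fin 2)) ^ p ^ n - 1 = (MvPolynomial.X 0 - 1) ^ p ^ n by
      rw [sub_pow_char_pow, one_pow]]
    exact pow_mem_of_mem_span_pow _ ha
  have h1 := X_one_pow_sub_one_mem k p hb
  rw [sub_pow_char_pow, one_pow, mul_pow]
  have : (MvPolynomial.X (R := k) (0 : Fin 2)) ^ p ^ n * MvPolynomial.X 1 ^ p ^ n - 1 =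
      ((MvPolynomial.X (R := k) (0 : Fin 2)) ^ p ^ n - 1) * MvPolynomial.X 1 ^ p ^ n +
        (MvPolynomial.X 1 ^ p ^ n - 1) := by ring
  rw [this]
  exact Ideal.add_mem _ (Ideal.mul_mem_right _ _ (Ideal.mem_sup_left h0)) (Ideal.mem_sup_right h1)

variable (k p) in
theorem unipotentDim_of_le {n a b c : ℕ} (ha : a ≤ p ^ n) (hb : b ≤ p ^ n) (hc : p ^ n ≤ c) :
    unipotentDim k a b c = a * b := by
  rw [unipotentDim_eq, ← finrank_quotient_unipotent (k := k) a b]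
  have h : Ideal.span {(MvPolynomial.X (R := k) (0 : Fin 2) * MvPolynomial.X 1 - 1) ^ c} ≤
      Ideal.span {(MvPolynomial.X 0 - 1) ^ a} ⊔
        Ideal.span {(MvPolynomial.X (R := k) (1 : Fin 2) - 1) ^ b} := by
    rw [Ideal.span_singleton_le_iff_mem]
    exact Ideal.mem_of_dvd _ (pow_dvd_pow _ hc) (mul_pow_sub_one_mem k p ha hb)
  rw [sup_eq_left.2 h]

variable (k p) in
/-- Linkage in `A = k[T, S] / ((T - 1) ^ q, (S - 1) ^ b)`: in `A` the annihilators of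
`(T - 1) ^ a` and `(T S - 1) ^ c` are generated by `(T - 1) ^ (q - a)` and `(T S - 1) ^ (q - c)`.
Computing the dimension of the quotient of `A` by the product `(T - 1) ^ a * (T S - 1) ^ c` in
two ways gives the identity. -/
theorem unipotentDim_sub {n a b c : ℕ} (ha : a ≤ p ^ n) (hb : b ≤ p ^ n) (hc : c ≤ p ^ n) :
    unipotentDim k (p ^ n - a) b c + a * b = unipotentDim k a b (p ^ n - c) + c * b := by
  set q := p ^ n
  set τ : MvPolynomial (Fin 2) k := MvPolynomial.X 0 - 1 with hτ
  set σ : MvPolynomial (Fin 2) k := MvPolynomial.X 1 - 1 with hσ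
  set υ : MvPolynomial (Fin 2) k := MvPolynomial.X 0 * MvPolynomial.X 1 - 1 with hυ
  set J := Ideal.span {τ ^ q} ⊔ Ideal.span {σ ^ b} with hJ
  have hfin : Module.Finite k (MvPolynomial (Fin 2) k ⧸ J) := by
    rw [hJ, hτ, hσ, ← gridIdeal_X_sub_one_pow]
    exact finite_quotient_gridIdeal (monic_X_sub_one_pow _) (monic_X_sub_one_pow _)
  have hdJ : finrank k (MvPolynomial (Fin 2) k ⧸ J) = q * b := finrank_quotient_unipotent q b
  have hτJ {i : ℕ} (hi : i ≤ q) : J ⊔ Ideal.span {τ ^ i} =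
      Ideal.span {τ ^ i} ⊔ Ideal.span {σ ^ b} := by
    refine le_antisymm (sup_le (sup_le ?_ le_sup_right) le_sup_left)
      (sup_le le_sup_right (le_sup_right.trans le_sup_left))
    rw [Ideal.span_singleton_le_iff_mem]
    exact Ideal.mem_sup_left (pow_mem_of_mem_span_pow _ hi)
  have hυq : υ ^ q ∈ J := mul_pow_sub_one_mem k p le_rfl hb
  have hτq : τ ^ q ∈ Ideal.span {υ ^ q} ⊔ Ideal.span {σ ^ b} := by
    -- modulo `σ ^ b` one has `S ^ q = 1`, so that `(T S) ^ q = T ^ q`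
    have e : τ ^ q = υ ^ q - MvPolynomial.X 0 ^ q * (MvPolynomial.X 1 ^ q - 1) := by
      rw [hτ, hυ, sub_pow_char_pow, sub_pow_char_pow]; ring
    rw [e]
    exact Ideal.sub_mem _ (Ideal.mem_sup_left (Ideal.mem_span_singleton_self _))
      (Ideal.mul_mem_left _ _ (Ideal.mem_sup_right (X_one_pow_sub_one_mem k p hb)))
  have hυJ {i : ℕ} (hi : i ≤ q) : J ⊔ Ideal.span {υ ^ i} =
      Ideal.span {υ ^ i} ⊔ Ideal.span {σ ^ b} := by
    refine le_antisymm (sup_le (sup_le ?_ le_sup_right) le_sup_left)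
      (sup_le le_sup_right (le_sup_right.trans le_sup_left))
    rw [Ideal.span_singleton_le_iff_mem]
    refine (sup_le_sup_right ?_ _ : Ideal.span {υ ^ q} ⊔ _ ≤ _) hτq
    rw [Ideal.span_singleton_le_iff_mem]
    exact pow_mem_of_mem_span_pow _ hi
  have hdτ {i : ℕ} (hi : i ≤ q) : finrank k (MvPolynomial (Fin 2) k ⧸ (J ⊔ Ideal.span {τ ^ i})) =
      i * b := by
    rw [hτJ hi]; exact finrank_quotient_unipotent i b
  have hdυ {i : ℕ} (hi : i ≤ q) : finrank k (MvPolynomial (Fin 2) k ⧸ (J ⊔ Ideal.span {υ ^ i})) =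
      i * b := by
    rw [hυJ hi]; exact finrank_quotient_unipotent_mul k p i hb
  have e1 := finrank_quotient_sup_mul_of_annihilator (k := k) J (t := τ ^ a) (t' := τ ^ (q - a))
    (υ ^ c) (by
      rw [← pow_add, Nat.add_sub_cancel' ha]
      exact Ideal.mem_sup_left (Ideal.mem_span_singleton_self _))
    (by rw [hdτ ha, hdτ (Nat.sub_le _ _), hdJ, ← add_mul, Nat.add_sub_cancel' ha])
  have e2 := finrank_quotient_sup_mul_of_annihilator (k := k) J (t := υ ^ c) (t' := υ ^ (q - c))
    (τ ^ a) (by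
      rw [← pow_add, Nat.add_sub_cancel' hc]
      exact hυq)
    (by rw [hdυ hc, hdυ (Nat.sub_le _ _), hdJ, ← add_mul, Nat.add_sub_cancel' hc])
  rw [hdτ ha, hτJ (Nat.sub_le _ _)] at e1
  rw [mul_comm (υ ^ c), hdυ hc, sup_right_comm J, hτJ ha] at e2
  rw [unipotentDim_eq, unipotentDim_eq, add_comm, ← e1, e2, add_comm]

end UnipotentDuality

/-! ### Jordan types from counting sums -/

section Layers

variable (k : Type*) [Field k]

/-- The increment `dim k[T, S] / (τ ^ a, σ ^ b, υ ^ (c + 1)) - dim k[T, S] / (τ ^ a, σ ^ b, υ ^ c)`,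
where `τ = T - 1`, `σ = S - 1`, `υ = T S - 1`. It counts the Jordan blocks of size greater
than `c` of the tensor product of unipotent Jordan blocks of sizes `a` and `b`. -/
noncomputable def unipotentStep (a b c : ℕ) : ℤ :=
  (unipotentDim k a b (c + 1) : ℤ) - unipotentDim k a b c

theorem unipotentStep_comm (a b c : ℕ) : unipotentStep k a b c = unipotentStep k b a c := by
  simp only [unipotentStep, unipotentDim_comm a b]

theorem unipotentStep_zero_left (b c : ℕ) : unipotentStep k 0 b c = 0 := by
  simp [unipotentStep, unipotentDim_zero_left]

variable (p : ℕ)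

theorem unipotentStep_of_le [Fact p.Prime] [CharP k p] {n a b c : ℕ} (ha : a ≤ p ^ n) (hb : b ≤ p ^ n) (hc : p ^ n ≤ c) :
    unipotentStep k a b c = 0 := by
  rw [unipotentStep, unipotentDim_of_le k p ha hb hc, unipotentDim_of_le k p ha hb (by omega),
    sub_self]

theorem unipotentStep_sub [Fact p.Prime] [CharP k p] {n a b c : ℕ} (ha : a ≤ p ^ n) (hb : b ≤ p ^ n) (hc : c < p ^ n) :
    unipotentStep k (p ^ n - a) b c = b - unipotentStep k a b (p ^ n - 1 - c) := by
  have h1 := unipotentDim_sub k p ha hb (c := c + 1) hc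
  have h2 := unipotentDim_sub k p ha hb (c := c) hc.le
  have h3 : p ^ n - 1 - c + 1 = p ^ n - c := by omega
  have h4 : p ^ n - 1 - c = p ^ n - (c + 1) := by omega
  rw [unipotentStep, unipotentStep, h3, h4]
  zify at h1 h2
  linarith

variable {A : Type*} [AddCommGroup A] [DecidableEq A]

/-- The number of ways to write `w` as the sum of an element of `S` and an element of `S'`. -/
def sumCount (S S' : Finset A) (w : A) : ℕ := (S.filter fun z => w - z ∈ S').card

theorem sumCount_comm (S S' : Finset A) (w : A) : sumCount S S' w = sumCount S' S w := by
  refine Finset.card_bij' (fun z _ => w - z) (fun z _ => w - z) ?_ ?_ ?_ ?_ <;>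
    simp +contextual

/-- The function `c ↦ unipotentStep k |S| |S'| c` on `c < p ^ n` is the decreasing rearrangement
of the function `sumCount S S'` on `U`. -/
structure IsRearranged (n : ℕ) (U S S' : Finset A) : Prop where
  antitone : ∀ c c', c ≤ c' → c' < p ^ n →
    unipotentStep k S.card S'.card c' ≤ unipotentStep k S.card S'.card c
  sum_eq : ∀ φ : ℤ → ℤ, ∑ c ∈ Finset.range (p ^ n), φ (unipotentStep k S.card S'.card c) =
    ∑ w ∈ U, φ (sumCount S S' w)

namespace IsRearranged

variable {k p} {n : ℕ} {U S S' : Finset A}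

theorem symm (h : IsRearranged k p n U S S') : IsRearranged k p n U S' S where
  antitone c c' := by
    simpa only [unipotentStep_comm k S'.card] using h.antitone c c'
  sum_eq φ := by
    simpa only [unipotentStep_comm k S'.card, sumCount_comm S'] using h.sum_eq φ

theorem empty (hU : U.card = p ^ n) : IsRearranged k p n U ∅ S' where
  antitone c c' _ _ := by simp [unipotentStep_zero_left]
  sum_eq φ := by simp [unipotentStep_zero_left, sumCount, hU]

/-- By duality, `unipotentStep` for the sizes `q - a, b` is the reflected difference of `b` and
`unipotentStep` for `a, b`; sum counts behave in the same way under complements. -/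
theorem sdiff [Fact p.Prime] [CharP k p] (hU : U.card = p ^ n) (hsub : ∀ x ∈ U, ∀ y ∈ U, x - y ∈ U)
    (hS : S ⊆ U) (hS' : S' ⊆ U) (h : IsRearranged k p n U S S') :
    IsRearranged k p n U (U \ S) S' := by
  have ha : S.card ≤ p ^ n := hU ▸ Finset.card_le_card hS
  have hb : S'.card ≤ p ^ n := hU ▸ Finset.card_le_card hS'
  have hc : (U \ S).card = p ^ n - S.card := by rw [Finset.card_sdiff_of_subset hS, hU]
  have hcount : ∀ w ∈ U, (sumCount (U \ S) S' w : ℤ) = S'.card - sumCount S S' w := by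
    intro w hw
    have h1 : sumCount (U \ S) S' w + sumCount S S' w = S'.card := by
      unfold sumCount
      rw [← Finset.card_union_of_disjoint
        (Finset.disjoint_filter_filter Finset.sdiff_disjoint),
        ← Finset.filter_union, Finset.sdiff_union_of_subset hS]
      refine Finset.card_bij' (fun z _ => w - z) (fun z _ => w - z) ?_ ?_ ?_ ?_
      · simp +contextual
      · intro z hz
        simp only [Finset.mem_filter, sub_sub_cancel]
        exact ⟨hsub w hw z (hS' hz), hz⟩
      · simp
      · simp
    linarith
  constructor
  · intro c c' hcc hc'
    rw [hc, unipotentStep_sub k p ha hb hc', unipotentStep_sub k p ha hb (hcc.trans_lt hc')]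
    have := h.antitone (p ^ n - 1 - c') (p ^ n - 1 - c) (by omega) (by omega)
    linarith
  · intro φ
    rw [hc, Finset.sum_congr rfl fun c hc => by
        rw [unipotentStep_sub k p ha hb (Finset.mem_range.1 hc)],
      Finset.sum_range_reflect (fun c => φ (S'.card - unipotentStep k S.card S'.card c)),
      h.sum_eq fun z => φ (S'.card - z)]
    exact Finset.sum_congr rfl fun w hw => by rw [hcount w hw]

/-- Enlarging the subgroup `U` of order `p ^ n` to `V` of order `p ^ (n + 1)` adds only zeros on both sides. -/
theorem succ [Fact p.Prime] [CharP k p] {V : Finset A} (hU : U.card = p ^ n) (hV : V.card = p ^ (n + 1)) (hUV : U ⊆ V)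
    (hadd : ∀ x ∈ U, ∀ y ∈ U, x + y ∈ U)
    (hS : S ⊆ U) (hS' : S' ⊆ U) (h : IsRearranged k p n U S S') :
    IsRearranged k p (n + 1) V S S' := by
  have ha : S.card ≤ p ^ n := hU ▸ Finset.card_le_card hS
  have hb : S'.card ≤ p ^ n := hU ▸ Finset.card_le_card hS'
  have hpow : p ^ n ≤ p ^ (n + 1) := Nat.pow_le_pow_right (Fact.out : p.Prime).pos (by omega)
  have hnonneg : ∀ c, 0 ≤ unipotentStep k S.card S'.card c := by
    intro c
    rcases lt_or_ge c (p ^ n) with hc | hc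
    · -- the values of the step function are values of `sumCount`
      by_contra hneg
      have := h.sum_eq fun z => if z < 0 then 1 else 0
      have h2 : ∑ w ∈ U, (if ((sumCount S S' w : ℕ) : ℤ) < 0 then 1 else 0 : ℤ) = 0 :=
        Finset.sum_eq_zero fun w _ => by simp
      rw [h2] at this
      rw [Finset.sum_eq_zero_iff_of_nonneg (fun i _ => by split_ifs <;> simp)] at this
      have := this c (Finset.mem_range.2 hc)
      simp only [ite_eq_right_iff, one_ne_zero, imp_false] at this
      exact this (not_le.1 hneg)
    · rw [unipotentStep_of_le k p ha hb hc]
  constructor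
  · intro c c' hcc hc'
    rcases lt_or_ge c' (p ^ n) with hlt | hge
    · exact h.antitone c c' hcc hlt
    · rw [unipotentStep_of_le k p ha hb hge]
      exact hnonneg c
  · intro φ
    rw [← Finset.sum_range_add_sum_Ico _ hpow, h.sum_eq, ← Finset.sum_sdiff hUV, add_comm]
    congr 1
    rw [Finset.sum_congr rfl (g := fun _ => φ 0) fun c hc => by
        rw [unipotentStep_of_le k p ha hb (Finset.mem_Ico.1 hc).1],
      Finset.sum_congr (s₁ := V \ U) rfl (g := fun _ => φ 0) fun w hw => by
        have : sumCount S S' w = 0 := by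
          rw [sumCount, Finset.card_eq_zero, Finset.filter_eq_empty_iff]
          intro z hz hwz
          refine (Finset.mem_sdiff.1 hw).2 ?_
          simpa using hadd _ (hS hz) _ (hS' hwz)
        rw [this, Nat.cast_zero]]
    rw [Finset.sum_const, Finset.sum_const, Nat.card_Ico, Finset.card_sdiff_of_subset hUV, hU, hV]

end IsRearranged

open Classical in
/-- The elements `w` with `lev w ≤ n` whose level belongs to `K`. -/
noncomputable def layers {B : Type*} [Fintype B] (lev : B → ℕ) (n : ℕ) (K : Set ℕ) : Finset B :=
  Finset.univ.filter fun w => lev w ≤ n ∧ lev w ∈ K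

theorem mem_layers {B : Type*} [Fintype B] {lev : B → ℕ} {n : ℕ} {K : Set ℕ} {w : B} :
    w ∈ layers lev n K ↔ lev w ≤ n ∧ lev w ∈ K := by
  simp [layers]

/-- If `|{lev ≤ i}| = p ^ i`, then tensor products of unipotent Jordan blocks whose sizes are the
cardinalities of unions of layers `{lev = i}` have the Jordan type which is read off from the sums
of elements of these unions. The induction passes to the complement of a union of layers that
contains the top layer. -/
theorem isRearranged_layers [Fact p.Prime] [CharP k p] [Fintype A] (lev : A → ℕ) (m : ℕ)
    (hcard : ∀ n ≤ m, (Finset.univ.filter fun w => lev w ≤ n).card = p ^ n)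
    (hsub : ∀ n x y, lev x ≤ n → lev y ≤ n → lev (x - y) ≤ n) :
    ∀ n ≤ m, ∀ K K' : Set ℕ, IsRearranged k p n (Finset.univ.filter fun w => lev w ≤ n)
      (layers lev n K)
      (layers lev n K') := by
  intro n
  have hss (n : ℕ) (K : Set ℕ) : (layers lev n K) ⊆
      Finset.univ.filter fun w => lev w ≤ n := by
    intro w; simp +contextual [mem_layers]
  have hsub' (n : ℕ) : ∀ x ∈ Finset.univ.filter (fun w => lev w ≤ n),
      ∀ y ∈ Finset.univ.filter (fun w => lev w ≤ n),
      x - y ∈ Finset.univ.filter (fun w => lev w ≤ n) := by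
    intro x hx y hy
    simp only [Finset.mem_filter, Finset.mem_univ, true_and] at hx hy ⊢
    exact hsub n x y hx hy
  have hadd (n : ℕ) : ∀ x ∈ Finset.univ.filter (fun w => lev w ≤ n),
      ∀ y ∈ Finset.univ.filter (fun w => lev w ≤ n),
      x + y ∈ Finset.univ.filter (fun w => lev w ≤ n) := by
    intro x hx y hy
    have h0 : -y ∈ Finset.univ.filter (fun w => lev w ≤ n) := by
      have := hsub' n _ (hsub' n y hy y hy) y hy
      rwa [sub_self, zero_sub] at this
    have := hsub' n x hx _ h0
    rwa [sub_neg_eq_add] at this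
  have hcompl (n : ℕ) (K : Set ℕ) : (layers lev n K) =
      (Finset.univ.filter fun w => lev w ≤ n) \
        (layers lev n Kᶜ) := by
    ext w
    simp only [mem_layers, Finset.mem_filter, Finset.mem_univ, true_and, Finset.mem_sdiff, Set.mem_compl_iff]
    tauto
  -- passing to complements, the top layer may be assumed to be absent
  have hred (n : ℕ) (hn : n ≤ m) (h : ∀ K K' : Set ℕ, n ∉ K → n ∉ K' →
      IsRearranged k p n (Finset.univ.filter fun w => lev w ≤ n)
      (layers lev n K)
      (layers lev n K')) (K K' : Set ℕ) :
      IsRearranged k p n (Finset.univ.filter fun w => lev w ≤ n)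
      (layers lev n K)
      (layers lev n K') := by
    have h1 (K K' : Set ℕ) (hK' : n ∉ K') :
        IsRearranged k p n (Finset.univ.filter fun w => lev w ≤ n)
        (layers lev n K)
        (layers lev n K') := by
      by_cases hK : n ∈ K
      · rw [hcompl n K]
        exact (h Kᶜ K' (by simpa using hK) hK').sdiff (hcard n hn) (hsub' n) (hss n _) (hss n _)
      · exact h K K' hK hK'
    by_cases hK' : n ∈ K'
    · rw [hcompl n K']
      exact ((h1 K K'ᶜ (by simpa using hK')).symm.sdiff (hcard n hn) (hsub' n) (hss n _)
        (hss n _)).symm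
    · exact h1 K K' hK'
  induction n with
  | zero =>
    intro hm
    refine hred 0 hm fun K K' hK _ => ?_
    have : layers lev 0 K = ∅ := by
      rw [Finset.eq_empty_iff_forall_notMem]
      intro w hw
      obtain ⟨h0, hw⟩ := mem_layers.1 hw
      exact hK (by rwa [Nat.le_zero.1 h0] at hw)
    rw [this]
    exact IsRearranged.empty (hcard 0 hm)
  | succ n ih =>
    intro hm
    refine hred (n + 1) hm fun K K' hK hK' => ?_
    have hlow (K : Set ℕ) (hK : n + 1 ∉ K) :
        layers lev (n + 1) K =
        (layers lev n K) := by
      ext w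
      simp only [mem_layers]
      refine ⟨fun ⟨h1, h2⟩ => ⟨?_, h2⟩, fun ⟨h1, h2⟩ => ⟨by omega, h2⟩⟩
      have : lev w ≠ n + 1 := fun h => hK (h ▸ h2)
      omega
    rw [hlow K hK, hlow K' hK']
    refine (ih (by omega) K K').succ (hcard n (by omega)) (hcard (n + 1) hm) ?_ (hadd n)
      (hss n _) (hss n _)
    intro w
    simp only [Finset.mem_filter, Finset.mem_univ, true_and]
    omega

end Layers

/-! ### The dimension of the image of the span of `1, s, …, s ^ (j - 1)` over `k[x]` -/

section Chain

variable {k : Type*} [Field k]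

/-- For a linear map on `k[X]` whose kernel is an ideal, the polynomials of degree `< j` have an
image of dimension `j`, unless they already have the full image. -/
theorem min_le_finrank_map_degreeLT {V : Type*} [AddCommGroup V] [Module k V] [Module.Finite k V]
    (θ : k[X] →ₗ[k] V) (hθ : ∀ P Q, θ P = 0 → θ (Q * P) = 0) (j : ℕ) :
    min j (finrank k (LinearMap.range θ)) ≤ finrank k ((degreeLT k j).map θ) := by
  by_cases h : ∀ P ∈ degreeLT k j, θ P = 0 → P = 0
  · have hinj : Function.Injective (θ.domRestrict (degreeLT k j)) := by
      rw [← LinearMap.ker_eq_bot, LinearMap.ker_eq_bot']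
      exact fun m hm => Subtype.ext (h m m.2 hm)
    have h1 : finrank k ((degreeLT k j).map θ) = j := by
      rw [← LinearMap.range_domRestrict, LinearMap.finrank_range_of_inj hinj,
        (degreeLTEquiv k j).finrank_eq, finrank_fin_fun]
    rw [h1]
    exact min_le_left _ _
  · push Not at h
    obtain ⟨P, hP, hP0, hne⟩ := h
    have h1 : (degreeLT k j).map θ = LinearMap.range θ := by
      refine le_antisymm (LinearMap.map_le_range) ?_
      rintro _ ⟨Q, rfl⟩
      refine ⟨Q % P, ?_, ?_⟩
      · rw [SetLike.mem_coe, mem_degreeLT] at *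
        exact (EuclideanDomain.mod_lt Q hne).trans hP
      · have h2 := congrArg θ (EuclideanDomain.div_add_mod Q P)
        rw [map_add, mul_comm, hθ P _ hP0, zero_add] at h2
        exact h2
    rw [h1]
    exact min_le_right _ _

variable {R : Type*} [CommRing R] [Algebra k R]

variable (k) in
/-- The `k`-span of the elements `x ^ e * s ^ i` with `i < j`. -/
def powerSpan (x s : R) (j : ℕ) : Submodule k R :=
  Submodule.span k {r | ∃ e i : ℕ, i < j ∧ r = x ^ e * s ^ i}

variable (k) in
/-- The dimension of the image of `powerSpan k x s j` in `R / J`. -/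
noncomputable def imageDim (x s : R) (j : ℕ) (J : Ideal R) : ℕ :=
  finrank k ((powerSpan k x s j).map (Ideal.Quotient.mkₐ k J).toLinearMap)

theorem imageDim_le_of_le (x s : R) (j : ℕ) {I J : Ideal R} [Module.Finite k (R ⧸ I)]
    (h : I ≤ J) : imageDim k x s j J ≤ imageDim k x s j I := by
  have : (powerSpan k x s j).map (Ideal.Quotient.mkₐ k J).toLinearMap =
      ((powerSpan k x s j).map (Ideal.Quotient.mkₐ k I).toLinearMap).map
        (Ideal.Quotient.factorₐ k h).toLinearMap := by
    rw [← Submodule.map_comp]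
    congr 1
  rw [imageDim, this]
  exact Submodule.finrank_map_le _ _

theorem mul_aeval_mem_powerSpan (x s : R) (F : k[X]) {j : ℕ} {P : k[X]} (hP : P ∈ degreeLT k j) :
    aeval x F * aeval s P ∈ powerSpan k x s j := by
  rw [aeval_eq_sum_range, aeval_eq_sum_range, Finset.sum_mul_sum]
  refine Submodule.sum_mem _ fun e _ => Submodule.sum_mem _ fun i hi => ?_
  rw [smul_mul_smul_comm]
  by_cases h : P.coeff i = 0
  · rw [h, mul_zero, zero_smul]; exact Submodule.zero_mem _
  · refine Submodule.smul_mem _ _ (Submodule.subset_span ⟨e, i, ?_, rfl⟩)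
    exact_mod_cast (le_degree_of_ne_zero h).trans_lt (mem_degreeLT.1 hP)

/-- In the kernel of `R / (F(x) (x - z)) → R / (F(x))` the element `x` acts as the scalar `z`, so
this kernel is generated by `F(x)` under `s`, and `F(x) s ^ i` with `i < j` span
the full kernel or a subspace of dimension `j`. -/
theorem imageDim_add_min_le (x s : R) (j : ℕ) (I : Ideal R) [Module.Finite k (R ⧸ I)]
    (hgen : ∀ r : R, ∃ n, ∃ y ∈ powerSpan k x s n, r - y ∈ I) (F : k[X]) (z : k) :
    imageDim k x s j (I ⊔ Ideal.span {aeval x F}) +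
      min j (finrank k (R ⧸ (I ⊔ Ideal.span {aeval x (F * (X - C z))})) -
        finrank k (R ⧸ (I ⊔ Ideal.span {aeval x F}))) ≤
      imageDim k x s j (I ⊔ Ideal.span {aeval x (F * (X - C z))}) := by
  set J := I ⊔ Ideal.span {aeval x F} with hJ
  set J' := I ⊔ Ideal.span {aeval x (F * (X - C z))} with hJ'
  have hle : J' ≤ J := by
    refine sup_le_sup_left ?_ _
    rw [Ideal.span_singleton_le_iff_mem, map_mul]
    exact Ideal.mul_mem_right _ _ (Ideal.mem_span_singleton_self _)
  have : Module.Finite k (R ⧸ J') := finite_quotient_of_le le_sup_left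
  set π := (Ideal.Quotient.factorₐ k hle).toLinearMap with hπ
  have hπs : Function.Surjective π := Ideal.Quotient.factor_surjective hle
  let θ : k[X] →ₗ[k] R ⧸ J' := (Ideal.Quotient.mkₐ k J').toLinearMap ∘ₗ
    LinearMap.mulLeft k (aeval x F) ∘ₗ (aeval s : k[X] →ₐ[k] R).toLinearMap
  have hθ (P) : θ P = Ideal.Quotient.mk J' (aeval x F * aeval s P) := rfl
  have hrange : LinearMap.range θ = LinearMap.ker π := by
    apply le_antisymm
    · rintro _ ⟨P, rfl⟩
      rw [LinearMap.mem_ker, hθ]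
      change Ideal.Quotient.mk J _ = 0
      rw [Ideal.Quotient.eq_zero_iff_mem]
      exact Ideal.mul_mem_right _ _ (Ideal.mem_sup_right (Ideal.mem_span_singleton_self _))
    · intro m hm
      obtain ⟨r, rfl⟩ := Ideal.Quotient.mk_surjective m
      have hr : r ∈ J := Ideal.Quotient.eq_zero_iff_mem.1 hm
      obtain ⟨a, ha, b, hb, rfl⟩ := Submodule.mem_sup.1 hr
      obtain ⟨w, rfl⟩ := Ideal.mem_span_singleton.1 hb
      obtain ⟨n, y, hy, hwy⟩ := hgen w
      have e1 : Ideal.Quotient.mk J' (a + aeval x F * w) =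
          Ideal.Quotient.mk J' (aeval x F * y) := by
        rw [Ideal.Quotient.mk_eq_mk_iff_sub_mem]
        have : a + aeval x F * w - aeval x F * y = a + aeval x F * (w - y) := by ring
        rw [this]
        exact Ideal.mem_sup_left (Ideal.add_mem _ ha (Ideal.mul_mem_left _ _ hwy))
      rw [e1]
      clear e1 hwy hr hm hb
      refine Submodule.span_induction (p := fun y _ =>
        Ideal.Quotient.mk J' (aeval x F * y) ∈ LinearMap.range θ) ?_ ?_ ?_ ?_ hy
      · rintro _ ⟨e, i, -, rfl⟩
        refine ⟨C (z ^ e) * X ^ i, ?_⟩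
        rw [hθ, Ideal.Quotient.mk_eq_mk_iff_sub_mem]
        obtain ⟨q, hq⟩ := sub_dvd_pow_sub_pow x (algebraMap k R z) e
        have : aeval x F * aeval s (C (z ^ e) * X ^ i) - aeval x F * (x ^ e * s ^ i) =
            aeval x (F * (X - C z)) * (-(q * s ^ i)) := by
          simp only [map_mul, map_sub, aeval_X, aeval_C, map_pow]
          linear_combination (-aeval x F * s ^ i) * hq
        rw [this]
        exact Ideal.mul_mem_right _ _ (Ideal.mem_sup_right (Ideal.mem_span_singleton_self _))
      · rw [mul_zero, map_zero]; exact Submodule.zero_mem _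
      · intro a b _ _ h1 h2
        rw [mul_add, map_add]; exact Submodule.add_mem _ h1 h2
      · intro c a _ h1
        rw [mul_smul_comm]
        exact Submodule.smul_mem _ c h1
  have hmin := min_le_finrank_map_degreeLT θ (fun P Q hP => by
    rw [hθ, Ideal.Quotient.eq_zero_iff_mem] at hP ⊢
    rw [map_mul, mul_left_comm]
    exact Ideal.mul_mem_left _ _ hP) j
  have hker : finrank k (LinearMap.ker π) = finrank k (R ⧸ J') - finrank k (R ⧸ J) := by
    rw [← LinearMap.finrank_range_add_finrank_ker π, LinearMap.range_eq_top.2 hπs, finrank_top]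
    omega
  rw [hrange, hker] at hmin
  set V' := (powerSpan k x s j).map (Ideal.Quotient.mkₐ k J').toLinearMap with hV'
  have hV : (powerSpan k x s j).map (Ideal.Quotient.mkₐ k J).toLinearMap = V'.map π := by
    rw [hV', ← Submodule.map_comp]
    congr 1
  have hYV : (degreeLT k j).map θ ≤ V' := by
    rintro _ ⟨P, hP, rfl⟩
    exact ⟨_, mul_aeval_mem_powerSpan x s F hP, rfl⟩
  have hYk : (degreeLT k j).map θ ≤ LinearMap.ker π := hrange ▸ LinearMap.map_le_range
  have hY : finrank k ((degreeLT k j).map θ) ≤ finrank k (LinearMap.ker (π.domRestrict V')) := by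
    rw [← (Submodule.comapSubtypeEquivOfLe hYV).finrank_eq]
    refine Submodule.finrank_mono fun m hm => ?_
    exact hYk hm
  rw [imageDim, imageDim, ← hV', hV, ← LinearMap.range_domRestrict]
  have := LinearMap.finrank_range_add_finrank_ker (π.domRestrict V')
  omega

theorem imageDim_add_sum_min_le (x s : R) (j : ℕ) (I : Ideal R) [Module.Finite k (R ⧸ I)]
    (hgen : ∀ r : R, ∃ n, ∃ y ∈ powerSpan k x s n, r - y ∈ I) (F : k[X]) (z : k) (n : ℕ) :
    imageDim k x s j (I ⊔ Ideal.span {aeval x F}) + ∑ c ∈ Finset.range n,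
      min j (finrank k (R ⧸ (I ⊔ Ideal.span {aeval x (F * (X - C z) ^ (c + 1))})) -
        finrank k (R ⧸ (I ⊔ Ideal.span {aeval x (F * (X - C z) ^ c)}))) ≤
      imageDim k x s j (I ⊔ Ideal.span {aeval x (F * (X - C z) ^ n)}) := by
  induction n with
  | zero => simp
  | succ n ih =>
    rw [Finset.sum_range_succ, ← add_assoc]
    have := imageDim_add_min_le x s j I hgen (F * (X - C z) ^ n) z
    rw [mul_assoc, ← pow_succ] at this
    exact (Nat.add_le_add_right ih _).trans this

/-- The bounds of `imageDim_add_sum_min_le` add up along a finite set of roots `ζ i` of `x`, with `w i c` the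
increment of the dimension at the `(c + 1)`-st power of `x - ζ i`. -/
theorem sum_min_le_imageDim (x s : R) (j : ℕ) (I : Ideal R) [Module.Finite k (R ⧸ I)]
    (hgen : ∀ r : R, ∃ n, ∃ y ∈ powerSpan k x s n, r - y ∈ I) {ι : Type*} [Fintype ι]
    [DecidableEq ι] (ζ : ι → k) (q : ℕ) (w : ι → ℕ → ℕ)
    (hw : ∀ (t : Finset ι) (i : ι), i ∉ t → ∀ c < q,
      finrank k (R ⧸ (I ⊔ Ideal.span
        {aeval x ((∏ l ∈ t, (X - C (ζ l)) ^ q) * (X - C (ζ i)) ^ (c + 1))})) =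
      finrank k (R ⧸ (I ⊔ Ideal.span
        {aeval x ((∏ l ∈ t, (X - C (ζ l)) ^ q) * (X - C (ζ i)) ^ c)})) + w i c) :
    ∑ i, ∑ c ∈ Finset.range q, min j (w i c) ≤ imageDim k x s j I := by
  have key : ∀ t : Finset ι, ∑ i ∈ t, ∑ c ∈ Finset.range q, min j (w i c) ≤
      imageDim k x s j (I ⊔ Ideal.span {aeval x (∏ l ∈ t, (X - C (ζ l)) ^ q)}) := by
    intro t
    induction t using Finset.induction_on with
    | empty => simp
    | insert i t hi ih =>
      rw [Finset.sum_insert hi, Finset.prod_insert hi, mul_comm (_ ^ q), add_comm]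
      refine le_trans ?_ (imageDim_add_sum_min_le x s j I hgen _ _ _)
      refine Nat.add_le_add ih (Finset.sum_le_sum fun c hc => ?_)
      rw [hw t i hi c (Finset.mem_range.1 hc), Nat.add_sub_cancel_left]
  exact (key Finset.univ).trans (imageDim_le_of_le _ _ _ le_sup_left)

end Chain

/-! ### The lower bound for `k[T, S] / (f(T), g(S))` -/

section Grid

variable {k : Type*} [Field k]

theorem powerSpan_mono {R : Type*} [CommRing R] [Algebra k R] (x s : R) {i j : ℕ} (h : i ≤ j) :
    powerSpan k x s i ≤ powerSpan k x s j :=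
  Submodule.span_mono fun _ ⟨e, l, hl, hr⟩ => ⟨e, l, hl.trans_le h, hr⟩

theorem aeval_mem_powerSpan {R : Type*} [CommRing R] [Algebra k R] (x s : R)
    (P : MvPolynomial (Fin 2) k) : ∃ n, MvPolynomial.aeval ![x, s] P ∈ powerSpan k x s n := by
  induction P using MvPolynomial.induction_on' with
  | monomial u a =>
    refine ⟨u 1 + 1, ?_⟩
    rw [MvPolynomial.aeval_monomial, Finsupp.prod_fintype _ _ (by simp), Fin.prod_univ_two,
      ← Algebra.smul_def]
    exact Submodule.smul_mem _ _ (Submodule.subset_span ⟨u 0, u 1, by omega, rfl⟩)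
  | add P Q hP hQ =>
    obtain ⟨n, hn⟩ := hP
    obtain ⟨m, hm⟩ := hQ
    refine ⟨max n m, ?_⟩
    rw [map_add]
    exact Submodule.add_mem _ (powerSpan_mono x s (le_max_left n m) hn)
      (powerSpan_mono x s (le_max_right n m) hm)

/-- Modulo `g(S)` with `g(0) ≠ 0` the variable `S` is invertible, so that `T S` and `S`
generate `k[T, S] / (f(T), g(S))`. -/
theorem exists_powerSpan_sub_mem_gridIdeal (f : k[X]) {g : k[X]} (hg : IsCoprime X g)
    (r : MvPolynomial (Fin 2) k) :
    ∃ n, ∃ y ∈ powerSpan k (MvPolynomial.X 0 * MvPolynomial.X 1) (MvPolynomial.X 1) n,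
      r - y ∈ gridIdeal f g := by
  set I := gridIdeal f g with hI
  set x : MvPolynomial (Fin 2) k := MvPolynomial.X 0 * MvPolynomial.X 1 with hx
  set s : MvPolynomial (Fin 2) k := MvPolynomial.X 1 with hs
  obtain ⟨u, w, huw⟩ := hg
  have hinv : Ideal.Quotient.mk I (aeval s u * s) = 1 := by
    rw [← map_one (Ideal.Quotient.mk I), Ideal.Quotient.mk_eq_mk_iff_sub_mem]
    have h1 := congrArg (aeval s) huw
    rw [map_add, map_mul, map_mul, aeval_X, map_one] at h1
    have h2 : aeval s u * s - 1 = -(aeval s w) * aeval s g := by linear_combination h1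
    rw [h2]
    exact Ideal.mul_mem_left _ _ (Ideal.mem_sup_right (Ideal.mem_span_singleton_self _))
  let φ : MvPolynomial (Fin 2) k →ₐ[k] MvPolynomial (Fin 2) k ⧸ I :=
    (Ideal.Quotient.mkₐ k I).comp (MvPolynomial.aeval ![x, s])
  have hφ (P) : φ P = Ideal.Quotient.mk I (MvPolynomial.aeval ![x, s] P) := rfl
  have hX1 : Ideal.Quotient.mk I (MvPolynomial.X 1) ∈ φ.range :=
    ⟨MvPolynomial.X 1, congrArg (Ideal.Quotient.mk I) (MvPolynomial.aeval_X ![x, s] 1)⟩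
  have hX0 : Ideal.Quotient.mk I (MvPolynomial.X 0) ∈ φ.range := by
    refine ⟨MvPolynomial.X 0 * aeval (MvPolynomial.X 1) u, ?_⟩
    change φ (MvPolynomial.X 0 * aeval (MvPolynomial.X 1) u) = _
    have h3 : MvPolynomial.aeval ![x, s] (aeval (MvPolynomial.X (R := k) (1 : Fin 2)) u) =
        aeval s u := by
      rw [← aeval_algHom_apply]; simp
    rw [hφ, map_mul, h3]
    have h4 : MvPolynomial.aeval ![x, s] (MvPolynomial.X (R := k) 0) * aeval s u =
        MvPolynomial.X 0 * (aeval s u * s) := by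
      simp [hx, hs]; ring
    rw [h4, map_mul, hinv, mul_one]
  have hr : Ideal.Quotient.mk I r ∈ φ.range := by
    induction r using MvPolynomial.induction_on with
    | C a => exact φ.range.algebraMap_mem a
    | add P Q hP hQ => rw [map_add]; exact add_mem hP hQ
    | mul_X P i hP =>
      rw [map_mul]
      refine mul_mem hP ?_
      fin_cases i
      · exact hX0
      · exact hX1
  obtain ⟨P, hP⟩ := hr
  obtain ⟨n, hn⟩ := aeval_mem_powerSpan x s P
  refine ⟨n, _, hn, ?_⟩
  rw [← Ideal.Quotient.mk_eq_mk_iff_sub_mem]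
  exact hP.symm

theorem unipotentDim_le_succ (a b c : ℕ) : unipotentDim k a b c ≤ unipotentDim k a b (c + 1) := by
  have := finite_quotient_of_gridIdeal_le (monic_X_sub_one_pow (k := k) a)
    (monic_X_sub_one_pow b) (I := gridIdeal ((X - 1 : k[X]) ^ a) ((X - 1 : k[X]) ^ b) ⊔
    Ideal.span {aeval (MvPolynomial.X 0 * MvPolynomial.X 1) ((X - 1 : k[X]) ^ (c + 1))})
    le_sup_left
  refine finrank_quotient_le_of_le (sup_le_sup_left ?_ _)
  rw [Ideal.span_singleton_le_iff_mem, pow_succ, map_mul]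
  exact Ideal.mul_mem_right _ _ (Ideal.mem_span_singleton_self _)

theorem isCoprime_X_sub_C_pow {Z : Type*} {ζ : Z → k} (hinj : Function.Injective ζ) (a : Z → ℕ) {z z' : Z}
    (h : z ≠ z') : IsCoprime ((X - C (ζ z)) ^ a z) ((X - C (ζ z')) ^ a z') :=
  IsCoprime.pow (isCoprime_X_sub_C_of_isUnit_sub
    (isUnit_iff_ne_zero.2 (sub_ne_zero.2 (hinj.ne h))))

theorem tripleDim_prod_prod {Z : Type*} [Fintype Z] {ζ : Z → k} (hinj : Function.Injective ζ) (hne : ∀ z, ζ z ≠ 0)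
    (a b : Z → ℕ) {F : k[X]} (hF : F ≠ 0) :
    tripleDim (∏ z, (X - C (ζ z)) ^ a z) (∏ z, (X - C (ζ z)) ^ b z) F =
      ∑ z, ∑ z', unipotentDim k (a z) (b z') (F.rootMultiplicity (ζ z * ζ z')) := by
  rw [tripleDim_prod_left _ _ (fun z _ => (monic_X_sub_C _).pow _)
    (monic_prod_of_monic _ _ fun z _ => (monic_X_sub_C _).pow _)
    (fun z _ z' _ h => isCoprime_X_sub_C_pow hinj a h)]
  refine Finset.sum_congr rfl fun z _ => ?_
  rw [tripleDim_comm, tripleDim_prod_left _ _ (fun z _ => (monic_X_sub_C _).pow _)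
    ((monic_X_sub_C _).pow _) (fun z _ z' _ h => isCoprime_X_sub_C_pow hinj b h)]
  refine Finset.sum_congr rfl fun z' _ => ?_
  rw [tripleDim_comm, tripleDim_X_sub_C_pow (hne z) (hne z') _ _ hF]

/-- A lower bound for the dimension of `k[x]`-span of `1, S, …, S ^ (j - 1)` in
`k[T, S] / (f(T), g(S))`, where `x = T S` and where the roots of `f` and `g` are values of an
injective character `ζ`. -/
theorem sum_min_le_imageDim_gridIdeal {Z : Type*} [AddCommGroup Z] [Fintype Z]
    [DecidableEq Z] {ζ : Z → k} (hinj : Function.Injective ζ)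
    (hne : ∀ z, ζ z ≠ 0) (hadd : ∀ z z', ζ (z + z') = ζ z * ζ z') (a b : Z → ℕ) (q j : ℕ) :
    ∑ y, ∑ c ∈ Finset.range q, min (j : ℤ) (∑ z, unipotentStep k (a z) (b (y - z)) c) ≤
      imageDim k (MvPolynomial.X 0 * MvPolynomial.X 1) (MvPolynomial.X 1) j
        (gridIdeal (∏ z, (X - C (ζ z)) ^ a z) (∏ z, (X - C (ζ z)) ^ b z)) := by
  set f := ∏ z, (X - C (ζ z)) ^ a z with hf
  set g := ∏ z, (X - C (ζ z)) ^ b z with hg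
  have hfm : f.Monic := monic_prod_of_monic _ _ fun z _ => (monic_X_sub_C _).pow _
  have hgm : g.Monic := monic_prod_of_monic _ _ fun z _ => (monic_X_sub_C _).pow _
  have hcop : IsCoprime X g := by
    refine IsCoprime.prod_right fun z _ => IsCoprime.pow_right ?_
    have := isCoprime_X_sub_C_of_isUnit_sub (a := (0 : k)) (b := ζ z)
      (isUnit_iff_ne_zero.2 (by rw [zero_sub]; exact neg_ne_zero.2 (hne z)))
    simpa using this
  have hfin := finite_quotient_gridIdeal hfm hgm
  have hstep (α β c : ℕ) : unipotentStep k α β c =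
      ((unipotentDim k α β (c + 1) - unipotentDim k α β c : ℕ) : ℤ) := by
    rw [Nat.cast_sub (unipotentDim_le_succ α β c)]
    rfl
  have key := sum_min_le_imageDim (k := k) (MvPolynomial.X 0 * MvPolynomial.X 1)
    (MvPolynomial.X (1 : Fin 2)) j (gridIdeal f g)
    (exists_powerSpan_sub_mem_gridIdeal f hcop) ζ q
    (fun y c => ∑ z, (unipotentDim k (a z) (b (y - z)) (c + 1) -
      unipotentDim k (a z) (b (y - z)) c)) ?_
  · refine le_trans (le_of_eq ?_) (Nat.cast_le.2 key)
    simp only [hstep]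
    push_cast
    rfl
  · intro t i hi c hc
    classical
    have hm (e : ℕ) : (∏ l ∈ t, (X - C (ζ l)) ^ q) * (X - C (ζ i)) ^ e ≠ 0 :=
      ((monic_prod_of_monic _ _ fun z _ => (monic_X_sub_C _).pow _).mul
        ((monic_X_sub_C _).pow _)).ne_zero
    -- the multiplicity of a root of unity in the polynomials of the chain
    have hmult (e : ℕ) (y : Z) : ((∏ l ∈ t, (X - C (ζ l)) ^ q) *
        (X - C (ζ i)) ^ e).rootMultiplicity (ζ y) =
        (if y ∈ t then q else 0) + if y = i then e else 0 := by
      rw [rootMultiplicity_mul (hm e), ← count_roots, ← count_roots,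
        roots_prod _ _ (monic_prod_of_monic _ _ fun z _ => (monic_X_sub_C _).pow _).ne_zero]
      simp only [roots_pow, roots_X_sub_C, Multiset.count_bind, Multiset.count_nsmul,
        Multiset.count_singleton, hinj.eq_iff, mul_ite, mul_one, mul_zero]
      congr 1
      change ∑ l ∈ t, _ = _
      rw [Finset.sum_ite_eq]
    have hdim (e : ℕ) : finrank k (MvPolynomial (Fin 2) k ⧸ (gridIdeal f g ⊔ Ideal.span
        {aeval (MvPolynomial.X 0 * MvPolynomial.X 1)
          ((∏ l ∈ t, (X - C (ζ l)) ^ q) * (X - C (ζ i)) ^ e)})) =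
        ∑ z, ∑ y, unipotentDim k (a z) (b (y - z))
          ((if y ∈ t then q else 0) + if y = i then e else 0) := by
      refine (tripleDim_prod_prod hinj hne a b (hm e)).trans ?_
      refine Finset.sum_congr rfl fun z _ => ?_
      refine Fintype.sum_equiv (Equiv.addLeft z) _ _ fun z' => ?_
      rw [← hadd, hmult]
      simp only [Equiv.coe_addLeft, add_sub_cancel_left]
      congr!
    rw [hdim, hdim, ← Finset.sum_add_distrib]
    refine Finset.sum_congr rfl fun z _ => ?_
    rw [← Finset.sum_erase_add _ _ (Finset.mem_univ i),
      ← Finset.sum_erase_add (Finset.univ) (fun y => unipotentDim k (a z) (b (y - z))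
          ((if y ∈ t then q else 0) + if y = i then c else 0)) (Finset.mem_univ i), add_assoc]
    congr 1
    · refine Finset.sum_congr rfl fun y hy => ?_
      rw [if_neg (Finset.ne_of_mem_erase hy), if_neg (Finset.ne_of_mem_erase hy)]
    · simp only [hi, if_false, if_true, zero_add]
      rw [Nat.add_sub_cancel' (unipotentDim_le_succ _ _ _)]

end Grid

/-! ### Rearrangement of comonotone functions -/

section Rearrangement

/-- A decreasing sequence is determined by the multiset of its values. -/
theorem eq_of_antitone_of_sum_eq {q : ℕ} {f g : Fin q → ℤ} (hf : Antitone f) (hg : Antitone g)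
    (h : ∀ φ : ℤ → ℤ, ∑ c, φ (f c) = ∑ c, φ (g c)) : f = g := by
  have key : ∀ {f g : Fin q → ℤ}, Antitone f → Antitone g →
      (∀ φ : ℤ → ℤ, ∑ c, φ (f c) = ∑ c, φ (g c)) → ∀ c, f c ≤ g c := by
    intro f g hf hg h c
    by_contra hlt
    push Not at hlt
    have h1 := h fun z => if f c ≤ z then 1 else 0
    rw [Finset.sum_boole, Finset.sum_boole, Nat.cast_inj] at h1
    have h2 : (Finset.univ.filter fun c' => f c ≤ g c') ⊂
        (Finset.univ.filter fun c' => f c ≤ f c') := by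
      refine Finset.ssubset_iff_subset_ne.2 ⟨fun c' hc' => ?_, fun heq => ?_⟩
      · simp only [Finset.mem_filter, Finset.mem_univ, true_and] at hc' ⊢
        refine hf (le_of_not_gt fun hcc => ?_)
        exact absurd (hc'.trans (hg hcc.le)) (not_le.2 hlt)
      · have : c ∈ Finset.univ.filter fun c' => f c ≤ g c' := by
          rw [heq]; simp
        simp only [Finset.mem_filter, Finset.mem_univ, true_and] at this
        exact absurd this (not_le.2 hlt)
    exact absurd h1 (Finset.card_lt_card h2).ne'
  exact funext fun c => le_antisymm (key hf hg h c) (key hg hf (fun φ => (h φ).symm) c)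

/-- Decreasing rearrangement is additive on families of functions which are pairwise
comonotone: one ordering of `A` makes all of them decreasing. -/
theorem sum_comp_sum_eq_of_comonotone {A ι : Type*} [Fintype A] [Fintype ι] {q : ℕ}
    (hA : Fintype.card A = q) (d : ι → ℕ → ℤ) (u : ι → A → ℤ)
    (hd : ∀ i c c', c ≤ c' → c' < q → d i c' ≤ d i c)
    (hdu : ∀ i (φ : ℤ → ℤ), ∑ c ∈ Finset.range q, φ (d i c) = ∑ w, φ (u i w))
    (hu : ∀ w w', (∀ i, u i w ≤ u i w') ∨ (∀ i, u i w' ≤ u i w)) (φ : ℤ → ℤ) :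
    ∑ c ∈ Finset.range q, φ (∑ i, d i c) = ∑ w, φ (∑ i, u i w) := by
  let e₀ : Fin q ≃ A := (Fintype.equivFinOfCardEq hA).symm
  let σ := Tuple.sort fun c => -∑ i, u i (e₀ c)
  have hσ : Monotone fun c => -∑ i, u i (e₀ (σ c)) :=
    Tuple.monotone_sort fun c => -∑ i, u i (e₀ c)
  let e : Fin q ≃ A := σ.trans e₀
  have hanti (i : ι) : Antitone fun c => u i (e c) := by
    intro c c' hcc
    have h1 : ∑ i, u i (e c') ≤ ∑ i, u i (e c) := neg_le_neg_iff.1 (hσ hcc)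
    rcases hu (e c') (e c) with h | h
    · exact h i
    · exact ((Finset.sum_eq_sum_iff_of_le fun i _ => h i).1
        (le_antisymm (Finset.sum_le_sum fun i _ => h i) h1) i (Finset.mem_univ i)).ge
  have heq (i : ι) : (fun c : Fin q => d i c) = fun c => u i (e c) := by
    refine eq_of_antitone_of_sum_eq (fun c c' hcc => hd i c c' hcc c'.2) (hanti i) fun ψ => ?_
    rw [Fin.sum_univ_eq_sum_range fun c => ψ (d i c), hdu, Equiv.sum_comp e fun w => ψ (u i w)]
  rw [← Fin.sum_univ_eq_sum_range fun c => φ (∑ i, d i c),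
    ← Equiv.sum_comp e fun w => φ (∑ i, u i w)]
  exact Finset.sum_congr rfl fun c _ => by
    rw [Finset.sum_congr rfl fun i _ => congrFun (heq i) c]

/-- The lower bound `sum_min_le_imageDim_gridIdeal`, when the exponents are cardinalities of unions
of layers of `A` and the sum counts are comonotone, in terms of the sum counts. -/
theorem sum_min_sumCount_le_imageDim {k : Type*} [Field k] (p : ℕ) [Fact p.Prime] [CharP k p]
    {Z A : Type*} [AddCommGroup Z] [Fintype Z] [DecidableEq Z] [AddCommGroup A] [Fintype A]
    [DecidableEq A] {ζ : Z → k} (hinj : Function.Injective ζ)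
    (hne : ∀ z, ζ z ≠ 0) (hadd : ∀ z z', ζ (z + z') = ζ z * ζ z')
    (lev : A → ℕ) (m : ℕ) (hlev : ∀ w, lev w ≤ m)
    (hcard : ∀ n ≤ m, (Finset.univ.filter fun w => lev w ≤ n).card = p ^ n)
    (hsub : ∀ n x y, lev x ≤ n → lev y ≤ n → lev (x - y) ≤ n)
    (S S' : Z → Finset A) (hS : ∀ z, ∃ K, S z = layers lev m K)
    (hS' : ∀ z, ∃ K, S' z = layers lev m K)
    (hcom : ∀ y w w', (∀ z, sumCount (S z) (S' (y - z)) w ≤ sumCount (S z) (S' (y - z)) w') ∨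
      (∀ z, sumCount (S z) (S' (y - z)) w' ≤ sumCount (S z) (S' (y - z)) w)) (j : ℕ) :
    ∑ y, ∑ w, min j (∑ z, sumCount (S z) (S' (y - z)) w) ≤
      imageDim k (MvPolynomial.X 0 * MvPolynomial.X 1) (MvPolynomial.X 1) j
        (gridIdeal (∏ z, (X - C (ζ z)) ^ (S z).card) (∏ z, (X - C (ζ z)) ^ (S' z).card)) := by
  have hre (z y : Z) : IsRearranged k p m Finset.univ (S z) (S' y) := by
    obtain ⟨K, hK⟩ := hS z
    obtain ⟨K', hK'⟩ := hS' y
    have := isRearranged_layers k p lev m hcard hsub m le_rfl K K'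
    rw [← hK, ← hK'] at this
    rwa [Finset.filter_true_of_mem fun w _ => hlev w] at this
  have hA : Fintype.card A = p ^ m := by
    rw [← hcard m le_rfl, Finset.filter_true_of_mem fun w _ => hlev w, Finset.card_univ]
  have h := sum_min_le_imageDim_gridIdeal hinj hne hadd (fun z => (S z).card)
    (fun z => (S' z).card) (p ^ m) j
  have h2 (y : Z) : ∑ c ∈ Finset.range (p ^ m), min (j : ℤ)
      (∑ z, unipotentStep k (S z).card (S' (y - z)).card c) =
      ∑ w, min (j : ℤ) (∑ z, (sumCount (S z) (S' (y - z)) w : ℤ)) :=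
    sum_comp_sum_eq_of_comonotone hA _ (fun z w => (sumCount (S z) (S' (y - z)) w : ℤ))
      (fun z => (hre z (y - z)).antitone) (fun z φ => (hre z (y - z)).sum_eq φ)
      (fun w w' => by
        simp only [Nat.cast_le]
        exact hcom y w w') (fun z => min (j : ℤ) z)
  rw [Finset.sum_congr rfl fun y _ => h2 y] at h
  exact_mod_cast h

end Rearrangement

/-! ### Multiplicativity of `δ` and its values at prime powers -/

section DeltaMultiplicative

theorem lcm_mul_mul_of_coprime {m n m' n' : ℕ} (hnn : n.Coprime n')
    (hmn : m.Coprime n') (hnm : n.Coprime m') :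
    (m * m').gcd (n * n') = m.gcd n * m'.gcd n' ∧ (m * m').lcm (n * n') = m.lcm n * m'.lcm n' := by
  have hg : (m * m').gcd (n * n') = m.gcd n * m'.gcd n' := by
    rw [Nat.Coprime.gcd_mul _ hnn, Nat.Coprime.gcd_mul_right_cancel _ hnm.symm,
      Nat.Coprime.gcd_mul_left_cancel _ hmn]
  refine ⟨hg, ?_⟩
  rcases Nat.eq_zero_or_pos (m.gcd n * m'.gcd n') with h0 | h0
  · rcases Nat.mul_eq_zero.1 h0 with h | h
    · rw [(Nat.gcd_eq_zero_iff.1 h).1]; simp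
    · rw [(Nat.gcd_eq_zero_iff.1 h).1]; simp
  · refine Nat.eq_of_mul_eq_mul_left h0 ?_
    have h1 := Nat.gcd_mul_lcm (m * m') (n * n')
    rw [hg] at h1
    calc _ = (m * m') * (n * n') := h1
      _ = (m * n) * (m' * n') := by ring
      _ = (m.gcd n * m.lcm n) * (m'.gcd n' * m'.lcm n') := by
        rw [Nat.gcd_mul_lcm, Nat.gcd_mul_lcm]
      _ = _ := by ring

theorem beta_dvd_left {m : ℕ} (n : ℕ) (hm : m ≠ 0) : beta m n ∣ m := by
  have : m = ∏ p ∈ m.primeFactors, p ^ m.factorization p :=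
    (Nat.prod_factorization_pow_eq_self hm).symm
  rw [beta]
  conv_rhs => rw [this]
  exact Finset.prod_dvd_prod_of_subset _ _ _ (Finset.filter_subset _ _)

theorem factorization_mul_left_of_coprime {m m' r : ℕ} (h : m.Coprime m')
    (hr : ¬ r ∣ m' ∨ ¬ r.Prime) : (m * m').factorization r = m.factorization r := by
  rw [Nat.factorization_mul_of_coprime h, Finsupp.add_apply]
  have : m'.factorization r = 0 := by
    rcases hr with hr | hr
    · exact Nat.factorization_eq_zero_of_not_dvd hr
    · exact Nat.factorization_eq_zero_of_not_prime _ hr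
  rw [this, add_zero]

theorem not_dvd_of_coprime_of_mem {m m' r : ℕ} (h : m.Coprime m') (hr : r ∈ m.primeFactors) :
    ¬ r ∣ m' := fun h' =>
  (Nat.prime_of_mem_primeFactors hr).one_lt.ne'
    (Nat.eq_one_of_dvd_coprimes h (Nat.dvd_of_mem_primeFactors hr) h')

theorem beta_mul_mul {m n m' n' : ℕ} (hmm : m.Coprime m') (hnn : n.Coprime n')
    (hmn : m.Coprime n') (hnm : n.Coprime m') :
    beta (m * m') (n * n') = beta m n * beta m' n' := by
  have h1 : ∀ r ∈ m.primeFactors, (m * m').factorization r = m.factorization r ∧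
      (n * n').factorization r = n.factorization r := fun r hr =>
    ⟨factorization_mul_left_of_coprime hmm (Or.inl (not_dvd_of_coprime_of_mem hmm hr)),
      factorization_mul_left_of_coprime hnn (Or.inl (not_dvd_of_coprime_of_mem hmn hr))⟩
  have h2 : ∀ r ∈ m'.primeFactors, (m * m').factorization r = m'.factorization r ∧
      (n * n').factorization r = n'.factorization r := by
    intro r hr
    rw [mul_comm m, mul_comm n]
    exact ⟨factorization_mul_left_of_coprime hmm.symm
        (Or.inl (not_dvd_of_coprime_of_mem hmm.symm hr)),
      factorization_mul_left_of_coprime hnn.symm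
        (Or.inl (not_dvd_of_coprime_of_mem hnm.symm hr))⟩
  rw [beta, hmm.primeFactors_mul, Finset.filter_union, Finset.prod_union
    (Finset.disjoint_filter_filter hmm.disjoint_primeFactors), beta, beta]
  congr 1
  · rw [Finset.filter_congr fun r hr => by rw [(h1 r hr).1, (h1 r hr).2]]
    exact Finset.prod_congr rfl fun r hr => by rw [(h1 r (Finset.mem_filter.1 hr).1).1]
  · rw [Finset.filter_congr fun r hr => by rw [(h2 r hr).1, (h2 r hr).2]]
    exact Finset.prod_congr rfl fun r hr => by rw [(h2 r (Finset.mem_filter.1 hr).1).1]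

/-- `δ` is multiplicative over coprime parts. -/
theorem delta_mul_mul {m n l m' n' l' : ℕ} (hm : m ≠ 0) (hn : n ≠ 0) (hm' : m' ≠ 0) (hn' : n' ≠ 0)
    (h : (m * n * l).Coprime (m' * n' * l')) :
    delta (m * m') (n * n') (l * l') = delta m n l * delta m' n' l' := by
  have hmm : m.Coprime m' := h.of_dvd ⟨n * l, by ring⟩ ⟨n' * l', by ring⟩
  have hnn : n.Coprime n' := h.of_dvd ⟨m * l, by ring⟩ ⟨m' * l', by ring⟩
  have hmn : m.Coprime n' := h.of_dvd ⟨n * l, by ring⟩ ⟨m' * l', by ring⟩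
  have hnm : n.Coprime m' := h.of_dvd ⟨m * l, by ring⟩ ⟨n' * l', by ring⟩
  have hlm : l.Coprime m' := h.of_dvd ⟨m * n, by ring⟩ ⟨n' * l', by ring⟩
  have hln : l.Coprime n' := h.of_dvd ⟨m * n, by ring⟩ ⟨m' * l', by ring⟩
  have hml : m.Coprime l' := h.of_dvd ⟨n * l, by ring⟩ ⟨m' * n', by ring⟩
  have hnl : n.Coprime l' := h.of_dvd ⟨m * l, by ring⟩ ⟨m' * n', by ring⟩
  obtain ⟨hgcd, hlcm⟩ := lcm_mul_mul_of_coprime hnn hmn hnm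
  set u := m.lcm n with hu
  set u' := m'.lcm n' with hu'
  have hudvd : u ∣ m * n := Nat.lcm_dvd_mul m n
  have hudvd' : u' ∣ m' * n' := Nat.lcm_dvd_mul m' n'
  have hu0 : u ≠ 0 := Nat.lcm_ne_zero hm hn
  have hu0' : u' ≠ 0 := Nat.lcm_ne_zero hm' hn'
  have huu : u.Coprime u' := h.of_dvd (hudvd.trans ⟨l, rfl⟩) (hudvd'.trans ⟨l', rfl⟩)
  have hlu' : l.Coprime u' := h.of_dvd ⟨m * n, by ring⟩ (hudvd'.trans ⟨l', rfl⟩)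
  have hul' : u.Coprime l' := h.of_dvd (hudvd.trans ⟨l, rfl⟩) ⟨m' * n', by ring⟩
  have hb : beta m n ∣ u := (beta_dvd_left n hm).trans (Nat.dvd_lcm_left m n)
  have hb' : beta m' n' ∣ u' := (beta_dvd_left n' hm').trans (Nat.dvd_lcm_left m' n')
  have hbb : (beta m n).Coprime (beta m' n') := huu.of_dvd hb hb'
  have hdvd : l * l' ∣ u * u' ↔ l ∣ u ∧ l' ∣ u' := by
    refine ⟨fun hd => ⟨?_, ?_⟩, fun hd => Nat.mul_dvd_mul hd.1 hd.2⟩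
    · exact hlu'.dvd_of_dvd_mul_right ((Dvd.intro _ rfl).trans hd)
    · exact hul'.symm.dvd_of_dvd_mul_left ((Dvd.intro_left _ rfl).trans hd)
  unfold delta
  rw [hlcm, hgcd, beta_mul_mul hmm hnn hmn hnm, ← hu, ← hu']
  by_cases hl : l ∣ u
  swap
  · rw [if_neg (fun h => hl (hdvd.1 h.1).1), if_neg (fun h => hl h.1), zero_mul]
  by_cases hl' : l' ∣ u'
  swap
  · rw [if_neg (fun h => hl' (hdvd.1 h.1).2), if_neg (c := l' ∣ u' ∧ _) (fun h => hl' h.1), mul_zero]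
  rw [← Nat.div_mul_div_comm hl hl']
  have hc : u / l ∣ u := Nat.div_dvd_of_dvd hl
  have hc' : u' / l' ∣ u' := Nat.div_dvd_of_dvd hl'
  have hcc : (u / l).Coprime (u' / l') := huu.of_dvd hc hc'
  have hdvd2 : u / l * (u' / l') ∣ beta m n * beta m' n' ↔
      u / l ∣ beta m n ∧ u' / l' ∣ beta m' n' := by
    refine ⟨fun hd => ⟨?_, ?_⟩, fun hd => Nat.mul_dvd_mul hd.1 hd.2⟩
    · exact (huu.of_dvd hc hb').dvd_of_dvd_mul_right ((Dvd.intro _ rfl).trans hd)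
    · exact (huu.of_dvd hb hc').symm.dvd_of_dvd_mul_left ((Dvd.intro_left _ rfl).trans hd)
  simp only [hdvd, hl, hl', true_and, hdvd2]
  by_cases h1 : u / l ∣ beta m n
  swap
  · rw [if_neg (fun h => h1 h.1), if_neg h1, zero_mul]
  by_cases h2 : u' / l' ∣ beta m' n'
  swap
  · rw [if_neg (fun h => h2 h.2), if_neg (c := u' / l' ∣ _) h2, mul_zero]
  rw [if_pos ⟨h1, h2⟩, if_pos h1, if_pos h2, Nat.totient_mul
    (huu.of_dvd ((Nat.gcd_dvd_left m n).trans (Nat.dvd_lcm_left m n))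
      ((Nat.gcd_dvd_left m' n').trans (Nat.dvd_lcm_left m' n'))),
    hbb.primeFactors_mul, Finset.filter_union, Finset.prod_union
    (Finset.disjoint_filter_filter hbb.disjoint_primeFactors)]
  have e1 : ∀ r ∈ (beta m n).primeFactors,
      (u / l * (u' / l')).factorization r = (u / l).factorization r := fun r hr =>
    factorization_mul_left_of_coprime hcc
      (Or.inl (not_dvd_of_coprime_of_mem (huu.of_dvd hb hc') hr))
  have e2 : ∀ r ∈ (beta m' n').primeFactors,
      (u / l * (u' / l')).factorization r = (u' / l').factorization r := fun r hr => by
    rw [mul_comm]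
    exact factorization_mul_left_of_coprime hcc.symm
      (Or.inl (not_dvd_of_coprime_of_mem (huu.of_dvd hc hb').symm hr))
  rw [Finset.filter_congr fun r hr => by rw [e1 r hr],
    Finset.filter_congr (s := (beta m' n').primeFactors) fun r hr => by rw [e2 r hr]]
  push_cast
  ring

theorem delta_nonneg (m n l : ℕ) : 0 ≤ delta m n l := by
  unfold delta
  split_ifs
  · refine mul_nonneg (Nat.cast_nonneg _) (Finset.prod_nonneg fun r hr => ?_)
    have hr2 : (2 : ℚ) ≤ r := by
      exact_mod_cast (Nat.prime_of_mem_primeFactors (Finset.mem_filter.1 hr).1).two_le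
    exact div_nonneg (by linarith) (by linarith)
  · exact le_rfl

theorem beta_self_pow {p : ℕ} (hp : p.Prime) (i : ℕ) : beta (p ^ i) (p ^ i) = p ^ i := by
  rw [beta, Finset.filter_true_of_mem (by simp)]
  exact Nat.prod_factorization_pow_eq_self (pow_ne_zero _ hp.ne_zero)

theorem beta_pow_of_ne {p : ℕ} (hp : p.Prime) {i i' : ℕ} (h : i ≠ i') :
    beta (p ^ i) (p ^ i') = 1 := by
  rw [beta, Finset.filter_false_of_mem, Finset.prod_empty]
  intro r hr
  have : r = p := (Nat.prime_dvd_prime_iff_eq (Nat.prime_of_mem_primeFactors hr) hp).1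
    ((Nat.prime_of_mem_primeFactors hr).dvd_of_dvd_pow (Nat.dvd_of_mem_primeFactors hr))
  rw [this, hp.factorization_pow, hp.factorization_pow]
  simpa using h

theorem delta_prime_pow_of_lt {p : ℕ} (hp : p.Prime) {i i' : ℕ} (h : i < i') (c : ℕ) :
    delta (p ^ i) (p ^ i') (p ^ c) = if c = i' then ((p ^ i).totient : ℚ) else 0 := by
  have hlcm : (p ^ i).lcm (p ^ i') = p ^ i' := Nat.lcm_eq_right (pow_dvd_pow p h.le)
  have hgcd : (p ^ i).gcd (p ^ i') = p ^ i := Nat.gcd_eq_left (pow_dvd_pow p h.le)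
  unfold delta
  rw [hlcm, hgcd, beta_pow_of_ne hp h.ne]
  by_cases hc : c = i'
  · subst hc
    rw [Nat.div_self (pow_pos hp.pos _)]
    simp
  · rw [if_neg hc, if_neg]
    rintro ⟨h1, h2⟩
    rw [Nat.dvd_one] at h2
    have h3 := Nat.div_mul_cancel h1
    rw [h2, one_mul] at h3
    exact hc (Nat.pow_right_injective hp.two_le h3)

theorem delta_comm (m n l : ℕ) (hm : m ≠ 0) (hn : n ≠ 0) : delta m n l = delta n m l := by
  have hb : beta m n = beta n m := by
    unfold beta
    refine Finset.prod_congr ?_ fun r hr => by rw [(Finset.mem_filter.1 hr).2]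
    ext r
    simp only [Finset.mem_filter, Nat.mem_primeFactors]
    constructor
    · rintro ⟨⟨hr, hd, -⟩, he⟩
      have := hr.factorization_pos_of_dvd hm hd
      exact ⟨⟨hr, Nat.dvd_of_factorization_pos (by omega), hn⟩, he.symm⟩
    · rintro ⟨⟨hr, hd, -⟩, he⟩
      have := hr.factorization_pos_of_dvd hn hd
      exact ⟨⟨hr, Nat.dvd_of_factorization_pos (by omega), hm⟩, he.symm⟩
  unfold delta
  rw [hb, Nat.lcm_comm, Nat.gcd_comm]

theorem delta_prime_pow_self {p : ℕ} (hp : p.Prime) (i c : ℕ) :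
    delta (p ^ i) (p ^ i) (p ^ c) = if i < c then 0 else
      if c = i ∧ 0 < i then ((p ^ i).totient : ℚ) * (((p : ℚ) - 2) / ((p : ℚ) - 1))
      else (p ^ i).totient := by
  unfold delta
  rw [Nat.lcm_self, Nat.gcd_self, beta_self_pow hp]
  by_cases hc : i < c
  · rw [if_pos hc, if_neg]
    rintro ⟨h1, -⟩
    have := (Nat.pow_dvd_pow_iff_le_right hp.one_lt).1 h1
    omega
  · push Not at hc
    rw [if_neg (not_lt.2 hc), if_pos ⟨pow_dvd_pow p hc, Nat.div_dvd_of_dvd (pow_dvd_pow p hc)⟩,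
      Nat.pow_div hc hp.pos]
    by_cases hi : i = 0
    · subst hi
      simp
    · rw [Nat.primeFactors_prime_pow hi hp, Finset.filter_singleton, hp.factorization_pow]
      simp only [Finsupp.single_eq_same]
      by_cases hci : c = i
      · rw [if_pos (by omega), if_pos ⟨hci, by omega⟩, Finset.prod_singleton]
      · rw [if_neg (by omega), if_neg (by omega), Finset.prod_empty, mul_one]

end DeltaMultiplicative

/-! ### `δ` counts pairs of elements with a given sum -/

section Level

/-- The exponent of `p` in the order of `w`. -/
noncomputable def level {A : Type*} [AddCommGroup A] (p : ℕ) (w : A) : ℕ :=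
  (addOrderOf w).factorization p

variable {p m : ℕ} {A : Type*} [AddCommGroup A] [Fintype A]

theorem addOrderOf_eq_pow_level (hp : p.Prime) (hA : Fintype.card A = p ^ m) (w : A) :
    addOrderOf w = p ^ level p w := by
  obtain ⟨i, -, hi⟩ := (Nat.dvd_prime_pow hp).1 (hA ▸ addOrderOf_dvd_card (x := w))
  rw [level, hi, hp.factorization_pow, Finsupp.single_eq_same]

theorem level_le (hp : p.Prime) (hA : Fintype.card A = p ^ m) (w : A) : level p w ≤ m := by
  have h := addOrderOf_dvd_card (x := w)
  rwa [hA, addOrderOf_eq_pow_level hp hA w, Nat.pow_dvd_pow_iff_le_right hp.one_lt] at h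

theorem level_le_iff (hp : p.Prime) (hA : Fintype.card A = p ^ m) (w : A) (n : ℕ) :
    level p w ≤ n ↔ p ^ n • w = 0 := by
  rw [← addOrderOf_dvd_iff_nsmul_eq_zero, addOrderOf_eq_pow_level hp hA w,
    Nat.pow_dvd_pow_iff_le_right hp.one_lt]

theorem level_sub_le (hp : p.Prime) (hA : Fintype.card A = p ^ m) (n : ℕ) (x y : A)
    (hx : level p x ≤ n) (hy : level p y ≤ n) : level p (x - y) ≤ n := by
  rw [level_le_iff hp hA] at *
  rw [nsmul_sub, hx, hy, sub_zero]

theorem level_sub_of_lt (hp : p.Prime) (hA : Fintype.card A = p ^ m) {x y : A}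
    (h : level p x < level p y) : level p (y - x) = level p y := by
  refine le_antisymm (level_sub_le hp hA _ _ _ le_rfl h.le) ?_
  by_contra! hlt
  -- otherwise `y = (y - x) + x` would have a smaller level
  have h1 : level p (-x) ≤ level p x := by
    rw [level_le_iff hp hA, smul_neg, (level_le_iff hp hA _ _).1 le_rfl, neg_zero]
  have h2 := level_sub_le hp hA (level p y - 1) (y - x) (-x) (by omega) (by omega)
  rw [sub_neg_eq_add, sub_add_cancel] at h2
  omega

theorem level_sub_of_gt (hp : p.Prime) (hA : Fintype.card A = p ^ m) {x y : A}
    (h : level p y < level p x) : level p (y - x) = level p x := by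
  have h1 := level_sub_of_lt hp hA h
  rw [← neg_sub, level, addOrderOf_neg]
  exact h1

variable [IsAddCyclic A]

theorem card_level_eq (hp : p.Prime) (hA : Fintype.card A = p ^ m) {i : ℕ} (hi : i ≤ m) :
    (Finset.univ.filter fun w : A => level p w = i).card = (p ^ i).totient := by
  rw [← IsAddCyclic.card_addOrderOf_eq_totient (α := A) (hA ▸ pow_dvd_pow p hi)]
  congr 1
  ext w
  simp only [Finset.mem_filter, Finset.mem_univ, true_and]
  rw [addOrderOf_eq_pow_level hp hA w]
  exact ⟨fun h => h ▸ rfl, fun h => Nat.pow_right_injective hp.two_le h⟩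

theorem card_level_le (hp : p.Prime) (hA : Fintype.card A = p ^ m) {n : ℕ} (hn : n ≤ m) :
    (Finset.univ.filter fun w : A => level p w ≤ n).card = p ^ n := by
  classical
  induction n with
  | zero =>
    simp only [Nat.le_zero]
    rw [card_level_eq hp hA hn]
    simp
  | succ n ih =>
    have : (Finset.univ.filter fun w : A => level p w ≤ n + 1) =
        (Finset.univ.filter fun w : A => level p w ≤ n) ∪
        (Finset.univ.filter fun w : A => level p w = n + 1) := by
      ext w
      simp only [Finset.mem_filter, Finset.mem_univ, true_and, Finset.mem_union]
      omega
    rw [this, Finset.card_union_of_disjoint, ih (by omega), card_level_eq hp hA hn,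
      Nat.totient_prime_pow_succ hp, pow_succ]
    · have := hp.pos
      obtain ⟨r, rfl⟩ : ∃ r, p = r + 1 := ⟨p - 1, by omega⟩
      rw [Nat.add_sub_cancel]; ring
    · rw [Finset.disjoint_filter]
      omega

/-- On a cyclic `p`-group `δ` counts the pairs of elements of given orders with a given sum. -/
theorem card_level_eq_delta (hp : p.Prime) (hA : Fintype.card A = p ^ m) {i i' : ℕ} (hi : i ≤ m)
    (hi' : i' ≤ m) (w : A) :
    ((Finset.univ.filter fun z : A => level p z = i ∧ level p (w - z) = i').card : ℚ) =
      delta (p ^ i) (p ^ i') (p ^ level p w) := by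
  classical
  -- the case of distinct orders
  have hlt : ∀ {i i' : ℕ}, i ≤ m → i < i' → ((Finset.univ.filter fun z : A =>
      level p z = i ∧ level p (w - z) = i').card : ℚ) =
      delta (p ^ i) (p ^ i') (p ^ level p w) := by
    intro i i' hi hii
    rw [delta_prime_pow_of_lt hp hii]
    split_ifs with hw
    · rw [← card_level_eq hp hA hi]
      congr 2
      ext z
      simp only [Finset.mem_filter, Finset.mem_univ, true_and, and_iff_left_iff_imp]
      intro hz
      rw [level_sub_of_lt hp hA (by omega), hw]
    · rw [Nat.cast_eq_zero, Finset.card_eq_zero, Finset.filter_eq_empty_iff]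
      rintro z - ⟨hz, hwz⟩
      refine hw ?_
      have := level_sub_of_gt hp hA (x := w - z) (y := -z)
        (by rw [level, addOrderOf_neg, ← level]; omega)
      have e : -z - (w - z) = -w := by abel
      rw [e, level, addOrderOf_neg, ← level] at this
      omega
  rcases lt_trichotomy i i' with h | rfl | h
  · exact hlt hi h
  · rw [delta_prime_pow_self hp]
    split_ifs with h1 h2
    · rw [Nat.cast_eq_zero, Finset.card_eq_zero, Finset.filter_eq_empty_iff]
      rintro z - ⟨hz, hwz⟩
      have := level_sub_of_lt hp hA (x := z) (y := w) (by omega)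
      omega
    · obtain ⟨hwi, hi0⟩ := h2
      have h3 : (Finset.univ.filter fun z : A => level p z = i ∧ level p (w - z) = i).card +
          p ^ (i - 1) = (p ^ i).totient := by
        rw [← card_level_eq hp hA hi, ← card_level_le hp hA (n := i - 1) (by omega)]
        have e : (Finset.univ.filter fun z : A => level p z ≤ i - 1).card =
            (Finset.univ.filter fun z : A => level p z = i ∧ level p (w - z) ≤ i - 1).card := by
          refine Finset.card_bij' (fun z _ => w - z) (fun z _ => w - z) ?_ ?_ ?_ ?_
          · intro z hz
            simp only [Finset.mem_filter, Finset.mem_univ, true_and, sub_sub_cancel] at hz ⊢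
            exact ⟨by rw [level_sub_of_lt hp hA (by omega), hwi], hz⟩
          · intro z hz
            simp only [Finset.mem_filter, Finset.mem_univ, true_and] at hz ⊢
            exact hz.2
          · simp
          · simp
        rw [e, ← Finset.card_union_of_disjoint]
        · congr 1
          ext z
          simp only [Finset.mem_filter, Finset.mem_univ, true_and, Finset.mem_union]
          constructor
          · rintro (h | h) <;> exact h.1
          · intro h
            have := level_sub_le hp hA i w z (by omega) (by omega)
            by_cases hh : level p (w - z) = i
            · exact Or.inl ⟨h, hh⟩
            · exact Or.inr ⟨h, by omega⟩
        · rw [Finset.disjoint_filter]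
          intro z _ h
          omega
      obtain ⟨n, rfl⟩ : ∃ n, i = n + 1 := ⟨i - 1, by omega⟩
      rw [Nat.totient_prime_pow_succ hp, Nat.add_sub_cancel] at h3
      rw [Nat.totient_prime_pow_succ hp, Nat.cast_mul, Nat.cast_sub hp.one_lt.le]
      have h4 : (p : ℚ) - 1 ≠ 0 := by
        have : (2 : ℚ) ≤ p := by exact_mod_cast hp.two_le
        linarith
      have h5 : ((Finset.univ.filter fun z : A =>
          level p z = n + 1 ∧ level p (w - z) = n + 1).card : ℚ) + (p : ℚ) ^ n =
          (p : ℚ) ^ n * ((p : ℚ) - 1) := by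
        have := congrArg (Nat.cast (R := ℚ)) h3
        rw [Nat.cast_add, Nat.cast_mul, Nat.cast_sub hp.one_lt.le] at this
        simpa using this
      rw [eq_sub_of_add_eq h5]
      push_cast
      field_simp
      ring
    · rw [← card_level_eq hp hA hi]
      congr 2
      ext z
      simp only [Finset.mem_filter, Finset.mem_univ, true_and, and_iff_left_iff_imp]
      intro hz
      by_cases hwi : level p w = i
      · have := level_sub_le hp hA i w z (by omega) (by omega)
        omega
      · rw [level_sub_of_gt hp hA (by omega), hz]
  · rw [delta_comm _ _ _ (pow_ne_zero _ hp.ne_zero) (pow_ne_zero _ hp.ne_zero), ← hlt hi' h,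
      Nat.cast_inj]
    refine Finset.card_bij' (fun z _ => w - z) (fun z _ => w - z) ?_ ?_ ?_ ?_ <;>
      simp +contextual

end Level

section DeltaPos

/-- `δ` is positive on the orders of two elements of a finite cyclic group and of their sum. -/
theorem delta_addOrderOf_pos {Z : Type*} [AddCommGroup Z] [Fintype Z] [IsAddCyclic Z] (t s : Z) :
    0 < delta (addOrderOf t) (addOrderOf s) (addOrderOf (t + s)) := by
  classical
  have hm := (addOrderOf_pos t).ne'
  have hn := (addOrderOf_pos s).ne'
  have hl := (addOrderOf_pos (t + s)).ne'
  have hdvd : addOrderOf (t + s) ∣ (addOrderOf t).lcm (addOrderOf s) :=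
    (AddCommute.all t s).addOrderOf_add_dvd_lcm
  have hs : addOrderOf s ∣ (addOrderOf t).lcm (addOrderOf (t + s)) := by
    have := (AddCommute.all (-t) (t + s)).addOrderOf_add_dvd_lcm
    rwa [neg_add_cancel_left, addOrderOf_neg] at this
  have ht : addOrderOf t ∣ (addOrderOf s).lcm (addOrderOf (t + s)) := by
    have := (AddCommute.all (-s) (t + s)).addOrderOf_add_dvd_lcm
    rwa [add_comm t s, neg_add_cancel_left, addOrderOf_neg, add_comm s t] at this
  set m := addOrderOf t with hmdef
  set n := addOrderOf s with hndef
  set l := addOrderOf (t + s) with hldef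
  have hlcm0 : m.lcm n ≠ 0 := Nat.lcm_ne_zero hm hn
  have hb0 : beta m n ≠ 0 := fun h => hm (Nat.eq_zero_of_zero_dvd (h ▸ beta_dvd_left n hm))
  have hbeta : m.lcm n / l ∣ beta m n := by
    rw [Nat.div_dvd_iff_dvd_mul hdvd (Nat.pos_of_ne_zero hl),
      ← Nat.factorization_le_iff_dvd hlcm0 (mul_ne_zero hl hb0)]
    intro r
    rw [Nat.factorization_mul hl hb0, Nat.factorization_lcm hm hn]
    simp only [Finsupp.sup_apply, Finsupp.add_apply]
    have h1 := (Nat.factorization_le_iff_dvd hn (Nat.lcm_ne_zero hm hl)).2 hs r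
    have h2 := (Nat.factorization_le_iff_dvd hm (Nat.lcm_ne_zero hn hl)).2 ht r
    rw [Nat.factorization_lcm hm hl, Finsupp.sup_apply] at h1
    rw [Nat.factorization_lcm hn hl, Finsupp.sup_apply] at h2
    by_cases heq : m.factorization r = n.factorization r
    · have h3 : m.factorization r ≤ (beta m n).factorization r := by
        by_cases h0 : m.factorization r = 0
        · omega
        · have hr : r ∈ m.primeFactors := by
            rw [← Nat.support_factorization]; exact Finsupp.mem_support_iff.2 h0
          have hrp := Nat.prime_of_mem_primeFactors hr
          refine (hrp.pow_dvd_iff_le_factorization hb0).1 ?_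
          exact Finset.dvd_prod_of_mem (fun p => p ^ m.factorization p)
            (Finset.mem_filter.2 ⟨hr, heq⟩)
      omega
    · omega
  rw [delta, if_pos ⟨hdvd, hbeta⟩]
  refine mul_pos ?_ (Finset.prod_pos fun r hr => ?_)
  · exact_mod_cast Nat.totient_pos.2 (Nat.gcd_pos_of_pos_left _ (Nat.pos_of_ne_zero hm))
  · obtain ⟨hr, hc⟩ := Finset.mem_filter.1 hr
    have hrp := Nat.prime_of_mem_primeFactors hr
    rcases hrp.two_le.lt_or_eq with h2 | h2
    · have : (3 : ℚ) ≤ r := by exact_mod_cast h2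
      exact div_pos (by linarith) (by linarith)
    -- For `r = 2`, multiples of `t` and of `s` coincide with the unique element of order two.
    exfalso
    subst h2
    rw [Nat.factorization_div hdvd, Finsupp.tsub_apply, Nat.factorization_lcm hm hn,
      Finsupp.sup_apply] at hc
    have h2b : 2 ∣ beta m n := Nat.dvd_of_mem_primeFactors hr
    obtain ⟨r, hr', h2r⟩ := (Nat.prime_two.prime.dvd_finsetProd_iff _).1 h2b
    obtain ⟨hrm, hre⟩ := Finset.mem_filter.1 hr'
    have h2r' : 2 = r := (Nat.prime_dvd_prime_iff_eq Nat.prime_two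
      (Nat.prime_of_mem_primeFactors hrm)).1 (Nat.prime_two.dvd_of_dvd_pow h2r)
    subst h2r'
    have hepos : 0 < m.factorization 2 :=
      Nat.prime_two.factorization_pos_of_dvd hm (Nat.dvd_of_mem_primeFactors hrm)
    set e := m.factorization 2 with he
    obtain ⟨m', hm'⟩ := Nat.ordProj_dvd m 2
    obtain ⟨n', hn'⟩ := Nat.ordProj_dvd n 2
    have hodd (a a' : ℕ) (ha0 : a ≠ 0) (ha : a = 2 ^ a.factorization 2 * a') : ¬ 2 ∣ a' := by
      intro hd
      have := Nat.pow_succ_factorization_not_dvd ha0 Nat.prime_two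
      refine this ?_
      rw [pow_succ]
      conv_rhs => rw [ha]
      exact Nat.mul_dvd_mul_left _ hd
    have hm2 := hodd m m' hm hm'
    have hn2 := hodd n n' hn hn'
    rw [← he] at hm'
    rw [← hre] at hn'
    have h22 : 2 * 2 ^ (e - 1) = 2 ^ e := by rw [← pow_succ', Nat.sub_add_cancel hepos]
    set κ := 2 ^ (e - 1) * (m' * n') with hκ
    have hκt2 : 2 • κ • t = 0 := by
      rw [smul_smul, ← addOrderOf_dvd_iff_nsmul_eq_zero, ← hmdef, hm', hκ]
      exact ⟨n', by rw [← h22]; ring⟩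
    have hκs2 : 2 • κ • s = 0 := by
      rw [smul_smul, ← addOrderOf_dvd_iff_nsmul_eq_zero, ← hndef, hn', hκ]
      exact ⟨m', by rw [← h22]; ring⟩
    have hnd (d : ℕ) (hd : d.factorization 2 = e) (hd0 : d ≠ 0) : ¬ d ∣ κ := by
      intro hdk
      have h1 : 2 ^ e ∣ κ := by
        rw [← hd]; exact (Nat.ordProj_dvd d 2).trans hdk
      rw [hκ, ← h22, mul_comm 2, Nat.mul_dvd_mul_iff_left (by positivity)] at h1
      rcases Nat.prime_two.dvd_mul.1 h1 with h | h
      · exact hm2 h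
      · exact hn2 h
    have hκt : κ • t ≠ 0 := fun h =>
      hnd m rfl hm ((addOrderOf_dvd_iff_nsmul_eq_zero).2 h)
    have hκs : κ • s ≠ 0 := fun h =>
      hnd n hre.symm hn ((addOrderOf_dvd_iff_nsmul_eq_zero).2 h)
    have heq : κ • t = κ • s := by
      by_contra hne
      have hcard := IsAddCyclic.card_nsmul_eq_zero_le (α := Z) (n := 2) (by norm_num)
      have h3 : ({0, κ • t, κ • s} : Finset Z) ⊆ Finset.univ.filter fun a => 2 • a = 0 := by
        intro z hz
        simp only [Finset.mem_insert, Finset.mem_singleton] at hz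
        rcases hz with rfl | rfl | rfl <;> simp [hκt2, hκs2]
      have h4 := Finset.card_le_card h3
      rw [Finset.card_eq_three.2 ⟨0, κ • t, κ • s, hκt.symm, hκs.symm, hne, rfl⟩] at h4
      omega
    have hκl : l ∣ κ := by
      rw [hldef, addOrderOf_dvd_iff_nsmul_eq_zero, nsmul_add, ← heq, ← two_nsmul, hκt2]
    have hle : e ≤ l.factorization 2 := by omega
    have h5 : 2 ^ e ∣ κ := ((pow_dvd_pow 2 hle).trans (Nat.ordProj_dvd l 2)).trans hκl
    refine hnd (2 ^ e) ?_ (by positivity) h5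
    rw [Nat.prime_two.factorization_pow, Finsupp.single_eq_same]

end DeltaPos

/-! ### The sdiOb-condition as comonotonicity -/

section Comonotone

variable {p m : ℕ} {Z A : Type*} [AddCommGroup Z] [AddCommGroup A] [Fintype A]

/-- The elements `w` of `A` for which `(z, w)` has its order in `M`, when `A` is a `p`-group and
the order of `z` is prime to `p`. -/
noncomputable def orderLayers (A : Type*) [AddCommGroup A] [Fintype A] (p m : ℕ) (M : Finset ℕ)
    (z : Z) : Finset A :=
  layers (level p) m {i | addOrderOf z * p ^ i ∈ M}

theorem mem_orderLayers (hp : p.Prime) (hA : Fintype.card A = p ^ m) {M : Finset ℕ} {z : Z}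
    {w : A} : w ∈ orderLayers A p m M z ↔ addOrderOf z * p ^ level p w ∈ M := by
  rw [orderLayers, mem_layers]
  exact and_iff_right (level_le hp hA w)

theorem not_dvd_addOrderOf [Fintype Z] (hZ : ¬ p ∣ Fintype.card Z) (z : Z) : ¬ p ∣ addOrderOf z :=
  fun h => hZ (h.trans addOrderOf_dvd_card)

theorem primeToPart_mul_pow (hp : p.Prime) {a : ℕ} (ha : ¬ p ∣ a) (i : ℕ) :
    primeToPart p (a * p ^ i) = a := by
  have ha0 : a ≠ 0 := fun h => ha (h ▸ dvd_zero p)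
  have : (a * p ^ i).factorization p = i := by
    rw [Nat.factorization_mul ha0 (pow_ne_zero _ hp.ne_zero), Finsupp.add_apply,
      hp.factorization_pow, Finsupp.single_eq_same, Nat.factorization_eq_zero_of_not_dvd ha,
      zero_add]
  rw [primeToPart, this, Nat.mul_div_cancel _ (pow_pos hp.pos i)]

/-- On a product of cyclic groups `Z × A` with `A` a `p`-group and `p ∤ |Z|`, the part
`χ_{p,m₀,n₀}` counts sums of pairs in `A`, up to the positive factor `δ(m₀, n₀, l₀)`. -/
theorem chiPart_eq_delta_mul_sumCount [Fintype Z] [DecidableEq A] [IsAddCyclic A] (hp : p.Prime)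
    (hA : Fintype.card A = p ^ m)
    (hZ : ¬ p ∣ Fintype.card Z) {M N : Finset ℕ} (hM : ∀ x ∈ M, x.factorization p ≤ m)
    (hN : ∀ x ∈ N, x.factorization p ≤ m) (t s : Z) (w : A) :
    chiPart M N p (addOrderOf t) (addOrderOf s) (addOrderOf (t + s) * p ^ level p w) =
      delta (addOrderOf t) (addOrderOf s) (addOrderOf (t + s)) *
        sumCount (orderLayers A p m M t) (orderLayers A p m N s) w := by
  have hcop (z : Z) (i : ℕ) : (addOrderOf z).Coprime (p ^ i) :=
    (Nat.Coprime.pow_left i ((Nat.Prime.coprime_iff_not_dvd hp).2 (not_dvd_addOrderOf hZ z))).symm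
  have hmap : ∀ z ∈ (orderLayers A p m M t).filter fun z => w - z ∈ orderLayers A p m N s,
      (addOrderOf t * p ^ level p z, addOrderOf s * p ^ level p (w - z)) ∈
        (M.filter fun x => primeToPart p x = addOrderOf t) ×ˢ
          (N.filter fun x => primeToPart p x = addOrderOf s) := by
    intro z hz
    simp only [Finset.mem_filter, mem_orderLayers hp hA] at hz
    simp only [Finset.mem_product, Finset.mem_filter]
    exact ⟨⟨hz.1, primeToPart_mul_pow hp (not_dvd_addOrderOf hZ t) _⟩,
      ⟨hz.2, primeToPart_mul_pow hp (not_dvd_addOrderOf hZ s) _⟩⟩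
  rw [chiPart, sumCount, Finset.card_eq_sum_card_fiberwise hmap, Nat.cast_sum, Finset.mul_sum]
  refine Finset.sum_congr rfl fun x hx => ?_
  obtain ⟨⟨hx1, hx1'⟩, hx2, hx2'⟩ := by
    simpa only [Finset.mem_product, Finset.mem_filter] using hx
  obtain ⟨x1, x2⟩ := x
  dsimp only at *
  have e1 : x1 = addOrderOf t * p ^ x1.factorization p := by
    rw [← hx1', primeToPart, mul_comm, Nat.ordProj_mul_ordCompl_eq_self]
  have e2 : x2 = addOrderOf s * p ^ x2.factorization p := by
    rw [← hx2', primeToPart, mul_comm, Nat.ordProj_mul_ordCompl_eq_self]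
  have h1 := hM x1 hx1
  have h2 := hN x2 hx2
  generalize x1.factorization p = i at *
  generalize x2.factorization p = i' at *
  subst e1 e2
  rw [delta_mul_mul (addOrderOf_pos t).ne' (addOrderOf_pos s).ne' (pow_ne_zero _ hp.ne_zero)
    (pow_ne_zero _ hp.ne_zero), ← card_level_eq_delta hp hA h1 h2]
  · congr 3
    ext z
    simp only [Finset.mem_filter, Finset.mem_univ, true_and, mem_orderLayers hp hA, Prod.mk.injEq,
      Nat.mul_right_inj (addOrderOf_pos _).ne', Nat.pow_right_inj hp.one_lt]
    constructor
    · rintro ⟨rfl, rfl⟩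
      exact ⟨⟨hx1, hx2⟩, rfl, rfl⟩
    · exact fun h => h.2
  · rw [← pow_add, ← pow_add]
    exact Nat.Coprime.mul_left (Nat.Coprime.mul_left (hcop _ _) (hcop _ _)) (hcop _ _)

theorem chiPart_nonneg (M N : Finset ℕ) (p m₀ n₀ l : ℕ) : 0 ≤ chiPart M N p m₀ n₀ l :=
  Finset.sum_nonneg fun _ _ => delta_nonneg _ _ _

theorem chiPart_le_chi (M N : Finset ℕ) (p m₀ n₀ l : ℕ) : chiPart M N p m₀ n₀ l ≤ chi M N l :=
  Finset.sum_le_sum_of_subset_of_nonneg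
    (Finset.product_subset_product (Finset.filter_subset _ _) (Finset.filter_subset _ _))
    fun _ _ _ => delta_nonneg _ _ _

theorem chiPart_eq_zero_of_notMem {M N : Finset ℕ} {p m₀ n₀ : ℕ}
    (h : ¬ (m₀ ∈ M.image (primeToPart p) ∧ n₀ ∈ N.image (primeToPart p))) (l : ℕ) :
    chiPart M N p m₀ n₀ l = 0 := by
  rw [chiPart, Finset.sum_eq_zero]
  intro x hx
  exfalso
  refine h ⟨Finset.mem_image.2 ?_, Finset.mem_image.2 ?_⟩
  · exact ⟨x.1, Finset.mem_filter.1 (Finset.mem_product.1 hx).1⟩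
  · exact ⟨x.2, Finset.mem_filter.1 (Finset.mem_product.1 hx).2⟩

/-- The sdiOb-condition says that the sum counts over the different pairs of classes of orders
are comonotone. -/
theorem SdiObSufficient.comonotone [Fintype Z] [IsAddCyclic Z] [DecidableEq A]
    [IsAddCyclic A] (hp : p.Prime)
    (hA : Fintype.card A = p ^ m)
    (hZ : ¬ p ∣ Fintype.card Z) {M N : Finset ℕ} (hMN : SdiObSufficient M N)
    (hM : ∀ x ∈ M, x.factorization p ≤ m) (hN : ∀ x ∈ N, x.factorization p ≤ m) (y : Z)
    (w w' : A) :
    (∀ z, sumCount (orderLayers A p m M z) (orderLayers A p m N (y - z)) w ≤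
      sumCount (orderLayers A p m M z) (orderLayers A p m N (y - z)) w') ∨
    (∀ z, sumCount (orderLayers A p m M z) (orderLayers A p m N (y - z)) w' ≤
      sumCount (orderLayers A p m M z) (orderLayers A p m N (y - z)) w) := by
  have key (z : Z) (w : A) : chiPart M N p (addOrderOf z) (addOrderOf (y - z))
      (addOrderOf y * p ^ level p w) = delta (addOrderOf z) (addOrderOf (y - z)) (addOrderOf y) *
        sumCount (orderLayers A p m M z) (orderLayers A p m N (y - z)) w := by
    have := chiPart_eq_delta_mul_sumCount hp hA hZ hM hN z (y - z) w
    rwa [add_sub_cancel] at this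
  have hpos (z : Z) : 0 < delta (addOrderOf z) (addOrderOf (y - z)) (addOrderOf y) := by
    have := delta_addOrderOf_pos z (y - z)
    rwa [add_sub_cancel] at this
  have hle (z : Z) (w w' : A) : chiPart M N p (addOrderOf z) (addOrderOf (y - z))
      (addOrderOf y * p ^ level p w) ≤ chiPart M N p (addOrderOf z) (addOrderOf (y - z))
      (addOrderOf y * p ^ level p w') ↔
      sumCount (orderLayers A p m M z) (orderLayers A p m N (y - z)) w ≤
      sumCount (orderLayers A p m M z) (orderLayers A p m N (y - z)) w' := by
    rw [key, key, mul_le_mul_iff_right₀ (hpos z), Nat.cast_le]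
  simp only [← hle]
  have hwlog : ∀ w w' : A, level p w < level p w' →
      (∀ z : Z, chiPart M N p (addOrderOf z) (addOrderOf (y - z)) (addOrderOf y * p ^ level p w) ≤
        chiPart M N p (addOrderOf z) (addOrderOf (y - z)) (addOrderOf y * p ^ level p w')) ∨
      (∀ z : Z, chiPart M N p (addOrderOf z) (addOrderOf (y - z)) (addOrderOf y * p ^ level p w') ≤
        chiPart M N p (addOrderOf z) (addOrderOf (y - z)) (addOrderOf y * p ^ level p w)) := by
    intro w w' hlt
    have hl0 (i : ℕ) : 0 < addOrderOf y * p ^ i := Nat.mul_pos (addOrderOf_pos y) (pow_pos hp.pos i)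
    by_cases hb : addOrderOf y * p ^ level p w ∈ orderSet M N
    swap
    · left
      intro z
      have : chi M N (addOrderOf y * p ^ level p w) ≤ 0 := not_lt.1 fun h => hb ⟨hl0 _, h⟩
      exact ((chiPart_le_chi ..).trans this).trans (chiPart_nonneg ..)
    by_cases ha : addOrderOf y * p ^ level p w' ∈ orderSet M N
    swap
    · right
      intro z
      have : chi M N (addOrderOf y * p ^ level p w') ≤ 0 := not_lt.1 fun h => ha ⟨hl0 _, h⟩
      exact ((chiPart_le_chi ..).trans this).trans (chiPart_nonneg ..)
    have hedge : IsPrimeEdge (orderSet M N) p (addOrderOf y * p ^ level p w')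
        (addOrderOf y * p ^ level p w) := by
      refine ⟨ha, hb, level p w' - level p w, by omega, ?_⟩
      rw [mul_left_comm, ← pow_add, Nat.sub_add_cancel hlt.le]
    rcases hMN p hp _ _ hedge with h | h
    · left
      intro z
      by_cases hz : addOrderOf z ∈ M.image (primeToPart p) ∧
          addOrderOf (y - z) ∈ N.image (primeToPart p)
      · exact h _ hz.1 _ hz.2
      · rw [chiPart_eq_zero_of_notMem hz, chiPart_eq_zero_of_notMem hz]
    · right
      intro z
      by_cases hz : addOrderOf z ∈ M.image (primeToPart p) ∧
          addOrderOf (y - z) ∈ N.image (primeToPart p)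
      · exact h _ hz.1 _ hz.2
      · rw [chiPart_eq_zero_of_notMem hz, chiPart_eq_zero_of_notMem hz]
  rcases lt_trichotomy (level p w) (level p w') with h | h | h
  · exact hwlog w w' h
  · left
    intro z
    rw [h]
  · exact (hwlog w' w h).symm

end Comonotone

/-! ### Cyclotomic polynomials in characteristic `p`, and the bound in terms of sum counts -/

section RootsOfUnity

variable {K : Type*} [Field K] {n : ℕ} [NeZero n] {ζ : K}

theorem zmodChar_injective (hζ : IsPrimitiveRoot ζ n) :
    Function.Injective (AddChar.zmodChar n hζ.pow_eq_one) := by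
  intro a b hab
  rw [AddChar.zmodChar_apply, AddChar.zmodChar_apply] at hab
  exact ZMod.val_injective n (hζ.pow_inj (ZMod.val_lt a) (ZMod.val_lt b) hab)

theorem orderOf_zmodChar (hζ : IsPrimitiveRoot ζ n) (z : ZMod n) :
    orderOf (AddChar.zmodChar n hζ.pow_eq_one z) = addOrderOf z := by
  have h (i : ℕ) : orderOf (AddChar.zmodChar n hζ.pow_eq_one z) ∣ i ↔ addOrderOf z ∣ i := by
    rw [orderOf_dvd_iff_pow_eq_one, addOrderOf_dvd_iff_nsmul_eq_zero,
      ← AddChar.map_nsmul_eq_pow, ← AddChar.map_zero_eq_one (AddChar.zmodChar n hζ.pow_eq_one),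
      (zmodChar_injective hζ).eq_iff]
  exact Nat.dvd_antisymm ((h _).2 dvd_rfl) ((h _).1 dvd_rfl)

/-- `Φ_d` splits over the `n`-th roots of unity, which are indexed by `ℤ / n`. -/
theorem cyclotomic_eq_prod_zmodChar (hζ : IsPrimitiveRoot ζ n) {d : ℕ} (hd : d ∣ n) :
    cyclotomic d K = ∏ z : ZMod n with addOrderOf z = d,
      (X - C (AddChar.zmodChar n hζ.pow_eq_one z)) := by
  obtain ⟨e, he⟩ := hd
  have hprim : IsPrimitiveRoot (ζ ^ e) d := hζ.pow (Nat.pos_of_ne_zero (NeZero.ne n))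
    (by rw [he, mul_comm])
  have hd0 : 0 < d := Nat.pos_of_ne_zero fun h => NeZero.ne n (by rw [he, h, zero_mul])
  have : NeZero d := ⟨hd0.ne'⟩
  rw [cyclotomic_eq_prod_X_sub_primitiveRoots hprim]
  symm
  refine Finset.prod_bij (fun z _ => AddChar.zmodChar n hζ.pow_eq_one z) ?_ ?_ ?_ ?_
  · intro z hz
    rw [mem_primitiveRoots hd0, ← (Finset.mem_filter.1 hz).2, ← orderOf_zmodChar hζ z]
    exact IsPrimitiveRoot.orderOf _
  · intro a _ b _ h
    exact zmodChar_injective hζ h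
  · intro μ hμ
    rw [mem_primitiveRoots hd0] at hμ
    obtain ⟨i, hi, hμi⟩ := hζ.eq_pow_of_pow_eq_one
      (show μ ^ n = 1 by rw [he, pow_mul, hμ.pow_eq_one, one_pow])
    have hval : AddChar.zmodChar n hζ.pow_eq_one (i : ZMod n) = μ := by
      rw [AddChar.zmodChar_apply, ZMod.val_natCast_of_lt hi, hμi]
    refine ⟨(i : ZMod n), ?_, hval⟩
    rw [Finset.mem_filter, ← orderOf_zmodChar hζ, hval, ← hμ.eq_orderOf]
    exact ⟨Finset.mem_univ _, rfl⟩
  · intro z _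
    rfl

variable {p m : ℕ} [Fact p.Prime] [CharP K p]

/-- In characteristic `p`, with `d = d₀ p ^ i`, one has `Φ_d = Φ_{d₀} ^ φ(p ^ i)`; the exponent counts
elements of order `p ^ i` of a cyclic `p`-group `A`. -/
theorem prod_cyclotomic_eq_prod_pow_card (hζ : IsPrimitiveRoot ζ n) (hpn : ¬ p ∣ n)
    {A : Type*} [AddCommGroup A] [Fintype A] [IsAddCyclic A] (hA : Fintype.card A = p ^ m)
    {M : Finset ℕ} (hM : ∀ x ∈ M, x ∣ n * p ^ m) :
    ∏ d ∈ M, cyclotomic d K = ∏ z : ZMod n, (X - C (AddChar.zmodChar n hζ.pow_eq_one z)) ^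
      (orderLayers A p m M z).card := by
  classical
  have hp : p.Prime := Fact.out
  set ψ := AddChar.zmodChar n hζ.pow_eq_one
  have hcard : Fintype.card (ZMod n) = n := ZMod.card n
  have h1 : ∏ z : ZMod n, (X - C (ψ z)) ^ (orderLayers A p m M z).card =
      ∏ x : ZMod n × A with addOrderOf x.1 * p ^ level p x.2 ∈ M, (X - C (ψ x.1)) := by
    rw [Finset.prod_filter, Fintype.prod_prod_type]
    refine Finset.prod_congr rfl fun z _ => ?_
    rw [← Finset.prod_filter]
    dsimp only
    rw [Finset.prod_const]
    congr 2
    ext w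
    simp [mem_orderLayers hp hA]
  rw [h1, ← Finset.prod_fiberwise_of_maps_to (t := M)
    (g := fun x : ZMod n × A => addOrderOf x.1 * p ^ level p x.2)
    (fun x hx => (Finset.mem_filter.1 hx).2)]
  refine Finset.prod_congr rfl fun d hd => ?_
  have hd0 : d ≠ 0 := fun h => by
    have := hM d hd
    rw [h, zero_dvd_iff] at this
    exact mul_ne_zero (NeZero.ne n) (pow_ne_zero m hp.ne_zero) this
  obtain ⟨i, d₀, hpd, rfl⟩ := Nat.exists_eq_pow_mul_and_not_dvd hd0 p hp.ne_one
  have hdn : d₀ ∣ n := by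
    refine Nat.Coprime.dvd_of_dvd_mul_right ?_ ((Dvd.intro_left _ rfl).trans (hM _ hd))
    exact (Nat.Coprime.pow_left m ((Nat.Prime.coprime_iff_not_dvd hp).2 hpd)).symm
  have him : i ≤ m := by
    have : p ^ i ∣ p ^ m := by
      refine Nat.Coprime.dvd_of_dvd_mul_left ?_ ((Dvd.intro _ rfl).trans (hM _ hd))
      exact Nat.Coprime.pow_left i ((Nat.Prime.coprime_iff_not_dvd hp).2 hpn)
    exact (Nat.pow_dvd_pow_iff_le_right hp.one_lt).1 this
  have hcyc : cyclotomic (p ^ i * d₀) K = cyclotomic d₀ K ^ (p ^ i).totient := by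
    rcases Nat.eq_zero_or_pos i with rfl | hi
    · simp
    · rw [cyclotomic_mul_prime_pow_eq K hpd hi, Nat.totient_prime_pow hp hi, Nat.mul_sub_one,
        ← pow_succ, Nat.sub_add_cancel hi]
  have hfib : ((Finset.univ.filter fun x : ZMod n × A => addOrderOf x.1 * p ^ level p x.2 ∈ M).filter
      fun x => addOrderOf x.1 * p ^ level p x.2 = p ^ i * d₀) =
      (Finset.univ.filter fun z : ZMod n => addOrderOf z = d₀) ×ˢ
        (Finset.univ.filter fun w : A => level p w = i) := by
    ext x
    simp only [Finset.mem_filter, Finset.mem_univ, true_and, Finset.mem_product]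
    constructor
    · rintro ⟨-, h⟩
      have hx := not_dvd_addOrderOf (p := p) (hcard.symm ▸ hpn) x.1
      have e1 := primeToPart_mul_pow hp hx (level p x.2)
      rw [h, mul_comm, primeToPart_mul_pow hp hpd] at e1
      refine ⟨e1.symm, ?_⟩
      rw [← e1, mul_comm, Nat.mul_left_inj (Nat.pos_of_dvd_of_pos hdn
        (Nat.pos_of_ne_zero (NeZero.ne n))).ne'] at h
      exact Nat.pow_right_injective hp.two_le h
    · rintro ⟨h1, h2⟩
      rw [h1, h2, mul_comm d₀]
      exact ⟨hd, rfl⟩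
  rw [hfib, Finset.prod_product, hcyc, cyclotomic_eq_prod_zmodChar hζ hdn, ← Finset.prod_pow]
  refine Finset.prod_congr rfl fun z _ => ?_
  dsimp only
  rw [Finset.prod_const, card_level_eq hp hA him]

end RootsOfUnity

section Assembly

/-- The elements of `ℤ / n` whose order belongs to `M`. -/
noncomputable def orderElements (n : ℕ) [NeZero n] (M : Finset ℕ) : Finset (ZMod n) :=
  Finset.univ.filter fun z => addOrderOf z ∈ M

theorem mem_orderElements {n : ℕ} [NeZero n] {M : Finset ℕ} {z : ZMod n} :
    z ∈ orderElements n M ↔ addOrderOf z ∈ M := by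
  simp [orderElements]

/-- Under the sdiOb-condition, the dimension of `k[x]`-span of `1, S, …, S ^ (j - 1)` in
`k[T, S] / (f(T), g(S))` is in every positive characteristic at least as big as
in characteristic `0`. -/
theorem SdiObSufficient.sum_min_sumCount_le {K : Type*} [Field K] {p m n : ℕ} [Fact p.Prime]
    [CharP K p] [NeZero n] {ζ : K} (hζ : IsPrimitiveRoot ζ n) (hpn : ¬ p ∣ n)
    [NeZero (n * p ^ m)]
    {M N : Finset ℕ} (hMN : SdiObSufficient M N) (hM : ∀ x ∈ M, x ∣ n * p ^ m)
    (hN : ∀ x ∈ N, x ∣ n * p ^ m) (j : ℕ) :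
    ∑ y : ZMod (n * p ^ m), min j (sumCount (orderElements (n * p ^ m) M)
        (orderElements (n * p ^ m) N) y) ≤
      imageDim K (MvPolynomial.X 0 * MvPolynomial.X 1) (MvPolynomial.X 1) j
        (gridIdeal (∏ d ∈ M, cyclotomic d K) (∏ d ∈ N, cyclotomic d K)) := by
  classical
  have hp : p.Prime := Fact.out
  have : NeZero (p ^ m) := ⟨pow_ne_zero m hp.ne_zero⟩
  have hA : Fintype.card (ZMod (p ^ m)) = p ^ m := ZMod.card _
  have hZ : ¬ p ∣ Fintype.card (ZMod n) := by rwa [ZMod.card]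
  have hfac : ∀ x, x ∣ n * p ^ m → x.factorization p ≤ m := by
    intro x hx
    have := (Nat.factorization_le_iff_dvd (fun h => NeZero.ne (n * p ^ m)
      (Nat.eq_zero_of_zero_dvd (h ▸ hx))) (NeZero.ne (n * p ^ m))).2 hx p
    rwa [Nat.factorization_mul (NeZero.ne n) (NeZero.ne _), Finsupp.add_apply,
      hp.factorization_pow, Finsupp.single_eq_same, Nat.factorization_eq_zero_of_not_dvd hpn,
      zero_add] at this
  rw [prod_cyclotomic_eq_prod_pow_card hζ hpn hA hM, prod_cyclotomic_eq_prod_pow_card hζ hpn hA hN]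
  refine le_trans (le_of_eq ?_) (sum_min_sumCount_le_imageDim p (zmodChar_injective hζ)
    (fun z h => ?_) (fun z z' => AddChar.map_add_eq_mul _ z z') (level p) m (level_le hp hA)
    (fun i hi => card_level_le hp hA hi) (level_sub_le hp hA) (orderLayers (ZMod (p ^ m)) p m M)
    (orderLayers (ZMod (p ^ m)) p m N) (fun z => ⟨_, rfl⟩) (fun z => ⟨_, rfl⟩)
    (hMN.comonotone hp hA hZ (fun x hx => hfac x (hM x hx)) (fun x hx => hfac x (hN x hx))) j)
  · have hcop : n.Coprime (p ^ m) :=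
      (Nat.Coprime.pow_left m ((Nat.Prime.coprime_iff_not_dvd hp).2 hpn)).symm
    let e : ZMod (n * p ^ m) ≃+ ZMod n × ZMod (p ^ m) := (ZMod.chineseRemainder hcop).toAddEquiv
    have hord (y : ZMod (n * p ^ m)) :
        addOrderOf y = addOrderOf (e y).1 * p ^ level p (e y).2 := by
      rw [← addOrderOf_eq_pow_level hp hA, ← e.addOrderOf_eq y, Prod.addOrderOf]
      refine Nat.Coprime.lcm_eq_mul ?_
      refine hcop.of_dvd ?_ ?_
      · exact (addOrderOf_dvd_card).trans (ZMod.card n).dvd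
      · exact (addOrderOf_dvd_card).trans hA.dvd
    rw [← Fintype.sum_prod_type' fun y w => min j (∑ z, sumCount (orderLayers (ZMod (p ^ m)) p m M z)
      (orderLayers (ZMod (p ^ m)) p m N (y - z)) w)]
    refine Fintype.sum_equiv e.toEquiv _ _ fun y => ?_
    congr 1
    unfold sumCount
    rw [← Finset.card_sigma]
    refine Finset.card_bij' (fun x _ => ⟨(e x).1, (e x).2⟩) (fun x _ => e.symm (x.1, x.2)) ?_ ?_ ?_ ?_
    · intro x hx
      simpa [mem_orderElements, mem_orderLayers hp hA, hord] using hx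
    · rintro ⟨z, w⟩ hx
      simpa [mem_orderElements, mem_orderLayers hp hA, hord] using hx
    · intro x _
      exact e.symm_apply_apply x
    · rintro ⟨z, w⟩ _
      simp
  · rw [AddChar.zmodChar_apply] at h
    exact pow_ne_zero _ (hζ.ne_zero (NeZero.ne n)) h

end Assembly

/-! ### Spans over `ℤ[x]` and their ranks modulo primes -/

section Splitting

variable {X : Type*} [AddCommGroup X]

/-- The `ℤ[x]`-span of `u 0, …, u (j - 1)`. -/
def polySpan (x : Module.End ℤ X) (u : ℕ → X) (j : ℕ) : Submodule ℤ X where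
  carrier := {y | ∃ c : ℕ → ℤ[X], y = ∑ i ∈ Finset.range j, aeval x (c i) (u i)}
  zero_mem' := ⟨0, by simp⟩
  add_mem' := by
    rintro _ _ ⟨c, rfl⟩ ⟨d, rfl⟩
    exact ⟨c + d, by simp [Finset.sum_add_distrib]⟩
  smul_mem' := by
    rintro a _ ⟨c, rfl⟩
    exact ⟨fun i => a • c i, by simp [Finset.smul_sum]⟩

theorem aeval_mem_polySpan (x : Module.End ℤ X) (u : ℕ → X) {i j : ℕ} (hij : i < j) (c : ℤ[X]) :
    aeval x c (u i) ∈ polySpan x u j := by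
  classical
  refine ⟨fun l => if l = i then c else 0, ?_⟩
  rw [Finset.sum_eq_single_of_mem i (Finset.mem_range.2 hij)]
  · simp
  · intro l _ hl
    simp [hl]

theorem aeval_apply_mem_polySpan {x : Module.End ℤ X} {u : ℕ → X} {j : ℕ} (q : ℤ[X]) {y : X}
    (hy : y ∈ polySpan x u j) : aeval x q y ∈ polySpan x u j := by
  obtain ⟨c, rfl⟩ := hy
  exact ⟨fun i => q * c i, by simp [map_sum]⟩

theorem polySpan_le {x : Module.End ℤ X} {u : ℕ → X} {j j' : ℕ} {w : ℕ → X}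
    (h : ∀ i < j, u i ∈ polySpan x w j') : polySpan x u j ≤ polySpan x w j' := by
  rintro _ ⟨c, rfl⟩
  exact Submodule.sum_mem _ fun i hi => aeval_apply_mem_polySpan _ (h i (Finset.mem_range.1 hi))

theorem polySpan_mono (x : Module.End ℤ X) (u : ℕ → X) {j j' : ℕ} (h : j ≤ j') :
    polySpan x u j ≤ polySpan x u j' :=
  polySpan_le fun i hi => by simpa using aeval_mem_polySpan x u (hi.trans_le h) 1

theorem aeval_modByMonic_apply {x : Module.End ℤ X} {P : ℤ[X]} {w : X}
    (h : aeval x P w = 0) (c : ℤ[X]) : aeval x (c %ₘ P) w = aeval x c w := by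
  conv_rhs => rw [← modByMonic_add_div c P]
  rw [map_add, LinearMap.add_apply, mul_comm P, map_mul, Module.End.mul_apply, h, map_zero,
    add_zero]

theorem C_dvd_of_forall_dvd_coeff {p : ℤ} {c : ℤ[X]} (h : ∀ e, p ∣ c.coeff e) : C p ∣ c :=
  (C_dvd_iff_dvd_coeff p c).2 h

theorem eq_zero_of_forall_prime_dvd {c : ℤ[X]} (h : ∀ p : ℕ, p.Prime → C (p : ℤ) ∣ c) :
    c = 0 := by
  ext e
  rw [coeff_zero]
  by_contra hne
  obtain ⟨p, hle, hp⟩ := Nat.exists_infinite_primes ((c.coeff e).natAbs + 1)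
  have := Int.natAbs_dvd_natAbs.2 ((C_dvd_iff_dvd_coeff _ _).1 (h p hp) e)
  have := Nat.le_of_dvd (Int.natAbs_pos.2 hne) this
  simp at this
  omega

variable {x : Module.End ℤ X} {P : ℕ → ℤ[X]} {w : ℕ → X} {j : ℕ}

/-- If `w i` is killed by `P i` and over a field of characteristic `p` the span of
`w 0, …, w (j - 1)` has at least the dimension `deg P 0 + … + deg P (j - 1)`, then
a `ℤ[x]`-combination of the `w i` in `p X` is trivial modulo `p`. -/
theorem C_dvd_of_sum_eq_smul {k : Type*} [Field k] {p : ℕ} [CharP k p]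
    (hP : ∀ i, (P i).Monic) (hw : ∀ i < j, aeval x (P i) (w i) = 0)
    (hk : ∑ i ∈ Finset.range j, (P i).natDegree ≤ Module.finrank k
      (Submodule.span k ((fun y => (1 : k) ⊗ₜ[ℤ] y) '' (polySpan x w j : Set X))))
    {c : ℕ → ℤ[X]} (hc : ∀ i, (c i).degree < (P i).degree) {z : X}
    (h : ∑ i ∈ Finset.range j, aeval x (c i) (w i) = (p : ℤ) • z) :
    ∀ i < j, C (p : ℤ) ∣ c i := by
  let b : (Σ i : Fin j, Fin (P i).natDegree) → k ⊗[ℤ] X :=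
    fun a => (1 : k) ⊗ₜ[ℤ] ((x ^ (a.2 : ℕ)) (w a.1))
  have hexp (d : ℕ → ℤ[X]) (hd : ∀ i, (d i).degree < (P i).degree) :
      (1 : k) ⊗ₜ[ℤ] (∑ i ∈ Finset.range j, aeval x (d i) (w i)) =
        ∑ a : (Σ i : Fin j, Fin (P i).natDegree), (((d a.1).coeff a.2 : ℤ) : k) • b a := by
    rw [← Finset.univ_sigma_univ, Finset.sum_sigma, TensorProduct.tmul_sum,
      ← Fin.sum_univ_eq_sum_range fun i => (1 : k) ⊗ₜ[ℤ] (aeval x (d i) (w i))]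
    refine Finset.sum_congr rfl fun i _ => ?_
    have hdi : (d i).natDegree < (P i).natDegree ∨ d i = 0 := by
      by_cases h0 : d i = 0
      · exact Or.inr h0
      · exact Or.inl (natDegree_lt_natDegree h0 (hd i))
    have e1 : aeval x (d i) (w i) =
        ∑ e ∈ Finset.range (P i).natDegree, (d i).coeff e • (x ^ e) (w i) := by
      rcases hdi with h1 | h1
      · rw [aeval_eq_sum_range' h1, LinearMap.sum_apply]
        rfl
      · simp [h1]
    rw [e1, TensorProduct.tmul_sum,
      ← Fin.sum_univ_eq_sum_range fun e => (1 : k) ⊗ₜ[ℤ] ((d i).coeff e • (x ^ e) (w i))]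
    refine Finset.sum_congr rfl fun e _ => ?_
    rw [TensorProduct.tmul_smul, TensorProduct.smul_tmul', TensorProduct.smul_tmul', zsmul_eq_mul]
    rfl
  have hspan : Submodule.span k ((fun y => (1 : k) ⊗ₜ[ℤ] y) '' (polySpan x w j : Set X)) ≤
      Submodule.span k (Set.range b) := by
    rw [Submodule.span_le]
    rintro _ ⟨_, ⟨d, rfl⟩, rfl⟩
    have e1 : ∑ i ∈ Finset.range j, aeval x (d i) (w i) =
        ∑ i ∈ Finset.range j, aeval x (d i %ₘ P i) (w i) :=
      Finset.sum_congr rfl fun i hi =>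
        (aeval_modByMonic_apply (hw i (Finset.mem_range.1 hi)) _).symm
    dsimp only
    rw [e1, hexp _ fun i => degree_modByMonic_lt _ (hP i)]
    exact Submodule.sum_mem _ fun a _ => Submodule.smul_mem _ _ (Submodule.subset_span ⟨a, rfl⟩)
  have hli : LinearIndependent k b := by
    rw [linearIndependent_iff_card_le_finrank_span, Fintype.card_sigma]
    simp only [Fintype.card_fin]
    rw [Fin.sum_univ_eq_sum_range fun i => (P i).natDegree]
    have := FiniteDimensional.span_of_finite k (Set.finite_range b)
    exact hk.trans (Submodule.finrank_mono hspan)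
  have hzero : ∑ a : (Σ i : Fin j, Fin (P i).natDegree), (((c a.1).coeff a.2 : ℤ) : k) • b a = 0 := by
    rw [← hexp c hc, h, TensorProduct.tmul_smul, TensorProduct.smul_tmul', zsmul_eq_mul]
    simp
  have hcoef := Fintype.linearIndependent_iff.1 hli _ hzero
  intro i hi
  refine C_dvd_of_forall_dvd_coeff fun e => ?_
  by_cases he : e < (P i).natDegree
  · have := hcoef ⟨⟨i, hi⟩, ⟨e, he⟩⟩
    exact (CharP.intCast_eq_zero_iff k p _).1 this
  · rw [coeff_eq_zero_of_degree_lt]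
    · exact dvd_zero _
    · exact (hc i).trans_le ((degree_le_natDegree).trans (by exact_mod_cast not_lt.1 he))

end Splitting

/-! ### Cyclic modules, and correction of generators -/

section CyclicBlock

variable {Y : Type*} [AddCommGroup Y] {y : Module.End ℤ Y} {P : ℤ[X]} {a : Y}

theorem aeval_sum_C_mul_X_pow_apply {n : ℕ} (c : Fin n → ℤ) :
    aeval y (∑ i, C (c i) * X ^ (i : ℕ)) a = ∑ i, c i • (y ^ (i : ℕ)) a := by
  simp [map_sum, LinearMap.sum_apply]

/-- If `Y` is generated by `a` over `ℤ[y]` and `P` generates the annihilator of `a`, the powers of `y`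
below `deg P` give a basis. -/
theorem exists_basis_of_cyclic (hP : P.Monic) (ha : aeval y P a = 0)
    (hspan : ∀ z, ∃ c : ℤ[X], z = aeval y c a)
    (hinj : ∀ c : ℤ[X], c.degree < P.degree → aeval y c a = 0 → c = 0) :
    ∃ b : Module.Basis (Fin P.natDegree) ℤ Y, ∀ i, b i = (y ^ (i : ℕ)) a := by
  let v : Fin P.natDegree → Y := fun i => (y ^ (i : ℕ)) a
  have hli : LinearIndependent ℤ v := by
    rw [Fintype.linearIndependent_iff]
    intro c hc i
    have h0 := hinj (∑ i, C (c i) * X ^ (i : ℕ))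
      (by rw [degree_eq_natDegree hP.ne_zero]; exact degree_sum_fin_lt c)
      ((aeval_sum_C_mul_X_pow_apply c).trans hc)
    have := congr_arg (fun q => q.coeff (i : ℕ)) h0
    simpa [finsetSum_coeff, coeff_X_pow, Fin.val_inj] using this
  have hsp : ⊤ ≤ Submodule.span ℤ (Set.range v) := by
    rintro z -
    obtain ⟨c, rfl⟩ := hspan z
    rw [← aeval_modByMonic_apply ha c]
    by_cases h0 : c %ₘ P = 0
    · rw [h0]
      simp
    have hd : (c %ₘ P).natDegree < P.natDegree :=
      natDegree_lt_natDegree h0 (degree_modByMonic_lt _ hP)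
    rw [aeval_eq_sum_range' hd, LinearMap.sum_apply]
    refine Submodule.sum_mem _ fun e he => ?_
    rw [LinearMap.smul_apply]
    exact Submodule.smul_mem _ _ (Submodule.subset_span ⟨⟨e, Finset.mem_range.1 he⟩, rfl⟩)
  exact ⟨Module.Basis.mk hli hsp, fun i => Module.Basis.mk_apply hli hsp i⟩

theorem charpoly_eq_of_cyclic [Module.Free ℤ Y] [Module.Finite ℤ Y] (hP : P.Monic)
    (ha : aeval y P a = 0)
    (hspan : ∀ z, ∃ c : ℤ[X], z = aeval y c a)
    (hinj : ∀ c : ℤ[X], c.degree < P.degree → aeval y c a = 0 → c = 0) :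
    y.charpoly = P := by
  obtain ⟨b, -⟩ := exists_basis_of_cyclic hP ha hspan hinj
  have hdeg : y.charpoly.natDegree = P.natDegree := by
    rw [LinearMap.charpoly_natDegree, Module.finrank_eq_card_basis b, Fintype.card_fin]
  -- By the Cayley–Hamilton theorem, the remainder of the characteristic polynomial kills `a`.
  have hdvd : P ∣ y.charpoly := by
    rw [← modByMonic_eq_zero_iff_dvd hP]
    refine hinj _ (degree_modByMonic_lt _ hP) ?_
    rw [aeval_modByMonic_apply ha, LinearMap.aeval_self_charpoly, LinearMap.zero_apply]
  exact eq_of_monic_of_dvd_of_natDegree_le hP (LinearMap.charpoly_monic y) hdvd hdeg.le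

end CyclicBlock

section CyclicBlockOfModule

variable {Y : Type*} [AddCommGroup Y] [inst : Module ℤ Y] {y : Module.End ℤ Y} {P : ℤ[X]} {a : Y}

-- Submodules carry a `ℤ`-module structure which is not syntactically the canonical one, so the results are
-- needed for every `ℤ`-module structure.

theorem isCompanionBlock_of_cyclic (hP : P.Monic) (hdeg : 0 < P.natDegree)
    (ha : aeval y P a = 0)
    (hspan : ∀ z, ∃ c : ℤ[X], z = aeval y c a)
    (hinj : ∀ c : ℤ[X], c.degree < P.degree → aeval y c a = 0 → c = 0) :
    IsCompanionBlock y := by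
  obtain rfl : inst = AddCommGroup.toIntModule Y := Subsingleton.elim _ _
  obtain ⟨b, hb⟩ := exists_basis_of_cyclic hP ha hspan hinj
  exact ⟨_, hdeg, a, b, hb⟩

theorem charpoly_eq_of_cyclic_of_module [Module.Free ℤ Y] [Module.Finite ℤ Y] (hP : P.Monic)
    (ha : aeval y P a = 0)
    (hspan : ∀ z, ∃ c : ℤ[X], z = aeval y c a)
    (hinj : ∀ c : ℤ[X], c.degree < P.degree → aeval y c a = 0 → c = 0) :
    y.charpoly = P := by
  obtain rfl : inst = AddCommGroup.toIntModule Y := Subsingleton.elim _ _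
  exact charpoly_eq_of_cyclic hP ha hspan hinj

end CyclicBlockOfModule

section Splitting

variable {X : Type*} [AddCommGroup X]

/-- For every prime `p` there is a field `k` of characteristic `p` such that the image of `Y` spans a
subspace of `k ⊗ X` of dimension at least `d`. -/
def HasRankModPrimes (Y : Submodule ℤ X) (d : ℕ) : Prop :=
  ∀ p : ℕ, p.Prime → ∃ (k : Type) (_ : Field k) (_ : CharP k p),
    d ≤ Module.finrank k (Submodule.span k ((fun y => (1 : k) ⊗ₜ[ℤ] y) '' (Y : Set X)))

variable {x : Module.End ℤ X} {P : ℕ → ℤ[X]} {w u : ℕ → X} {j : ℕ}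

/-- By `C_dvd_of_sum_eq_smul` the coefficients of a relation are divisible by every prime. -/
theorem eq_zero_of_sum_eq_zero (hP : ∀ i, (P i).Monic) (hw : ∀ i < j, aeval x (P i) (w i) = 0)
    (hk : HasRankModPrimes (polySpan x w j) (∑ i ∈ Finset.range j, (P i).natDegree))
    {c : ℕ → ℤ[X]} (hc : ∀ i, (c i).degree < (P i).degree)
    (h : ∑ i ∈ Finset.range j, aeval x (c i) (w i) = 0) :
    ∀ i < j, c i = 0 := by
  intro i hi
  refine eq_zero_of_forall_prime_dvd fun p hp => ?_
  obtain ⟨k, _, _, hk⟩ := hk p hp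
  exact C_dvd_of_sum_eq_smul hP hw hk hc (z := 0) (by rw [h, smul_zero]) i hi

/-- A span `polySpan x w j` which has the full rank modulo all primes is a pure subgroup. -/
theorem mem_polySpan_of_smul_mem [Module.Free ℤ X] (hP : ∀ i, (P i).Monic)
    (hw : ∀ i < j, aeval x (P i) (w i) = 0)
    (hk : HasRankModPrimes (polySpan x w j) (∑ i ∈ Finset.range j, (P i).natDegree))
    (m : ℕ) : ∀ z : X, 0 < m → (m : ℤ) • z ∈ polySpan x w j → z ∈ polySpan x w j := by
  induction m using induction_on_primes with
  | zero => exact fun _ h => absurd h (lt_irrefl _)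
  | one => exact fun z _ h => by simpa using h
  | prime_mul p m hp ih =>
    intro z hm hz
    refine ih z (Nat.pos_of_mul_pos_left hm) ?_
    rw [Nat.cast_mul, mul_smul] at hz
    obtain ⟨c, hc⟩ := hz
    obtain ⟨k, _, _, hk⟩ := hk p hp
    have hc' : ∑ i ∈ Finset.range j, aeval x (c i %ₘ P i) (w i) = (p : ℤ) • (m : ℤ) • z := by
      rw [hc]
      exact Finset.sum_congr rfl fun i hi =>
        aeval_modByMonic_apply (hw i (Finset.mem_range.1 hi)) _
    have hdvd := C_dvd_of_sum_eq_smul hP hw hk (c := fun i => c i %ₘ P i)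
      (fun i => degree_modByMonic_lt _ (hP i)) hc'
    choose! d hd using hdvd
    refine ⟨d, ?_⟩
    refine smul_right_injective X (Int.natCast_ne_zero.2 hp.ne_zero) ?_
    dsimp only
    rw [← hc', Finset.smul_sum]
    refine Finset.sum_congr rfl fun i hi => ?_
    rw [hd i (Finset.mem_range.1 hi), map_mul, aeval_C, Module.End.mul_apply,
      Module.algebraMap_end_apply]

theorem polySpan_congr {w w' : ℕ → X} (h : ∀ i < j, w i = w' i) :
    polySpan x w j = polySpan x w' j :=
  le_antisymm (polySpan_le fun i hi => by simpa [h i hi] using aeval_mem_polySpan x w' hi 1)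
    (polySpan_le fun i hi => by simpa [← h i hi] using aeval_mem_polySpan x w hi 1)

/-- If `P 0` is squarefree, `P (i + 1) ∣ P i`, and `P j` maps `u j` into the rational span of
`u 0, …, u (j - 1)`, then `u j` can be corrected by an element of `polySpan x u j` such that
`P j` kills it. -/
theorem exists_sub_aeval_eq_zero [Module.Free ℤ X] (hP : ∀ i, (P i).Monic)
    (hdvd : ∀ i, i ≤ j → P j ∣ P i) (hsq : Squarefree (P 0))
    (hw : ∀ i < j, aeval x (P i) (w i) = 0)
    (hk : HasRankModPrimes (polySpan x w j) (∑ i ∈ Finset.range j, (P i).natDegree))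
    {u : X} (hu : ∃ m : ℕ, 0 < m ∧ (m : ℤ) • aeval x (P j) u ∈ polySpan x w j)
    (h0 : aeval x (P 0) u = 0) (hdvd0 : ∀ i, P i ∣ P 0) :
    ∃ y ∈ polySpan x w j, aeval x (P j) (u - y) = 0 := by
  obtain ⟨m, hm, hmem⟩ := hu
  obtain ⟨c, hc⟩ := mem_polySpan_of_smul_mem hP hw hk m _ hm hmem
  obtain ⟨Q, hQ⟩ := hdvd0 j
  have hrel : IsRelPrime (P j) Q := by
    rw [hQ] at hsq
    exact (squarefree_mul_iff.1 hsq).1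
  -- `Q = P 0 / P j` kills `P j u`, so that `P i ∣ Q c i`, and `P j ∣ c i` as `P 0` is squarefree.
  have hsum : ∑ i ∈ Finset.range j, aeval x ((Q * c i) %ₘ P i) (w i) = 0 := by
    have e : ∑ i ∈ Finset.range j, aeval x ((Q * c i) %ₘ P i) (w i) =
        aeval x Q (aeval x (P j) u) := by
      rw [hc, map_sum]
      refine Finset.sum_congr rfl fun i hi => ?_
      rw [aeval_modByMonic_apply (hw i (Finset.mem_range.1 hi)), map_mul, Module.End.mul_apply]
    rw [e, ← Module.End.mul_apply, ← map_mul, mul_comm, ← hQ, h0]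
  have hz := eq_zero_of_sum_eq_zero hP hw hk (c := fun i => (Q * c i) %ₘ P i)
    (fun i => degree_modByMonic_lt _ (hP i)) hsum
  have hdc : ∀ i < j, P j ∣ c i := fun i hi =>
    hrel.dvd_of_dvd_mul_left
      ((hdvd i hi.le).trans ((modByMonic_eq_zero_iff_dvd (hP i)).1 (hz i hi)))
  choose! d hd using hdc
  refine ⟨∑ i ∈ Finset.range j, aeval x (d i) (w i), ⟨d, rfl⟩, ?_⟩
  rw [map_sub, hc, map_sum, sub_eq_zero]
  refine Finset.sum_congr rfl fun i hi => ?_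
  rw [hd i (Finset.mem_range.1 hi), map_mul, Module.End.mul_apply]

/-- The generators `u i` can be replaced one after the other by generators `w i` with `P i (x) (w i) = 0`,
without changing the filtration. -/
theorem exists_generators_killed [Module.Free ℤ X] (hP : ∀ i, (P i).Monic)
    (hdvd : ∀ i j, i ≤ j → P j ∣ P i) (hsq : Squarefree (P 0))
    (hk : ∀ j, HasRankModPrimes (polySpan x u j) (∑ i ∈ Finset.range j, (P i).natDegree))
    (hu : ∀ j, ∃ m : ℕ, 0 < m ∧ (m : ℤ) • aeval x (P j) (u j) ∈ polySpan x u j)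
    (h0 : ∀ j, aeval x (P 0) (u j) = 0) (j : ℕ) :
    ∃ w : ℕ → X, (∀ i < j, aeval x (P i) (w i) = 0) ∧ polySpan x w j = polySpan x u j := by
  induction j with
  | zero => exact ⟨u, by simp, rfl⟩
  | succ j ih =>
    obtain ⟨w, hw, hwu⟩ := ih
    obtain ⟨y, hy, hyj⟩ := exists_sub_aeval_eq_zero (u := u j) hP (fun i hi => hdvd i j hi) hsq hw
      (hwu ▸ hk j) (hwu ▸ hu j) (h0 j) fun i => hdvd 0 i (Nat.zero_le i)
    let w' := Function.update w j (u j - y)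
    have hw' : ∀ i < j, w' i = w i := fun i hi => Function.update_of_ne hi.ne _ _
    have hw'j : w' j = u j - y := Function.update_self _ _ _
    have hspan : polySpan x w' j = polySpan x u j := (polySpan_congr hw').trans hwu
    refine ⟨w', fun i hi => ?_, le_antisymm (polySpan_le fun i hi => ?_)
      (polySpan_le fun i hi => ?_)⟩
    · obtain hi | rfl := Nat.lt_succ_iff_lt_or_eq.1 hi
      · rw [hw' i hi, hw i hi]
      · rw [hw'j, hyj]
    · obtain hi | rfl := Nat.lt_succ_iff_lt_or_eq.1 hi
      · refine polySpan_mono x u j.le_succ (hspan ▸ ?_)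
        simpa using aeval_mem_polySpan x w' hi 1
      · rw [hw'j]
        refine Submodule.sub_mem _ ?_ (polySpan_mono x u (Nat.le_succ _) (hwu ▸ hy))
        simpa using aeval_mem_polySpan x u (Nat.lt_succ_self i) 1
    · obtain hi | rfl := Nat.lt_succ_iff_lt_or_eq.1 hi
      · refine polySpan_mono x w' j.le_succ (hspan.symm ▸ ?_)
        simpa using aeval_mem_polySpan x u hi 1
      · have h1 : u i = w' i + y := by rw [hw'j]; abel
        rw [h1]
        refine Submodule.add_mem _ ?_ (polySpan_mono x w' (Nat.le_succ _) (hspan.symm ▸ hwu ▸ hy))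
        simpa using aeval_mem_polySpan x w' (Nat.lt_succ_self i) 1

end Splitting

/-! ### The splitting criterion -/

section Splitting

variable {X : Type*} [AddCommGroup X] {x : Module.End ℤ X}

theorem coe_aeval_restrict {B : Submodule ℤ X} (h : ∀ y ∈ B, x y ∈ B) (c : ℤ[X]) (z : B) :
    ((aeval (x.restrict h) c z : B) : X) = aeval x c (z : X) := by
  induction c using Polynomial.induction_on' with
  | add p q hp hq => simp [hp, hq]
  | monomial n a =>
    rw [aeval_monomial, aeval_monomial, Module.End.mul_apply, Module.End.mul_apply,
      Module.algebraMap_end_apply, Module.algebraMap_end_apply, Module.End.pow_restrict n h,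
      Submodule.coe_smul, LinearMap.coe_restrict_apply]

variable {P : ℕ → ℤ[X]} {w : ℕ → X} {r : ℕ}

/-- If `X` is generated over `ℤ[x]` by elements `w i` killed by `P i`, and has dimension at least
`∑ deg P i` modulo each prime, then the cyclic modules `ℤ[x] (w i)` with `P i ≠ 1` form a standard
decomposition. -/
theorem hasStandardOrlikDecomposition_of_generators [Module.Free ℤ X] [Module.Finite ℤ X]
    (hx : IsOfFinOrder x) (hP : ∀ i, (P i).Monic) (hdvd : ∀ i j, i ≤ j → P j ∣ P i)
    (hr : P r = 1) (hw : ∀ i < r, aeval x (P i) (w i) = 0)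
    (hk : HasRankModPrimes (polySpan x w r) (∑ i ∈ Finset.range r, (P i).natDegree))
    (htop : polySpan x w r = ⊤) :
    HasStandardOrlikDecomposition x := by
  classical
  have hex : ∃ i, P i = 1 := ⟨r, hr⟩
  -- The number of blocks; the generators with `P i = 1` vanish.
  let l := Nat.find hex
  have hlr : l ≤ r := Nat.find_min' hex hr
  have hl1 : ∀ i, l ≤ i → P i = 1 := fun i hi =>
    (hP i).eq_one_of_isUnit (isUnit_of_dvd_one (Nat.find_spec hex ▸ hdvd l i hi))
  have hpos : ∀ i < l, 0 < (P i).natDegree := fun i hi =>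
    Nat.pos_of_ne_zero fun h => Nat.find_min hex hi ((hP i).natDegree_eq_zero.1 h)
  have hw0 : ∀ i < r, l ≤ i → w i = 0 := fun i hi hli => by
    have := hw i hi
    rwa [hl1 i hli, map_one, Module.End.one_apply] at this
  let B : Fin l → Submodule ℤ X := fun i => polySpan x (fun _ => w i) 1
  have hmem : ∀ i (z : X), z ∈ B i ↔ ∃ c, z = aeval x c (w i) := fun i z => by
    constructor
    · rintro ⟨c, rfl⟩
      exact ⟨c 0, by simp⟩
    · rintro ⟨c, hc⟩
      exact ⟨fun _ => c, by simp [hc]⟩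
  have hinv : ∀ i, ∀ z ∈ B i, x z ∈ B i := fun i z hz => by
    simpa using aeval_apply_mem_polySpan (x := x) Polynomial.X hz
  -- Combinations of the generators are determined by their coefficients.
  have huniq (c : ℕ → ℤ[X]) (hc : ∑ i : Fin l, aeval x (c i) (w i) = 0) :
      ∀ i : Fin l, P i ∣ c i := by
    have hsum : ∑ i ∈ Finset.range r, aeval x (c i %ₘ P i) (w i) = 0 := by
      rw [← hc, Fin.sum_univ_eq_sum_range fun i => aeval x (c i) (w i)]
      symm
      rw [← Finset.sum_subset (Finset.range_subset_range.2 hlr)]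
      · exact Finset.sum_congr rfl fun i hi => (aeval_modByMonic_apply
          (hw i ((Finset.mem_range.1 hi).trans_le hlr)) _).symm
      · intro i hi hi'
        rw [hw0 i (Finset.mem_range.1 hi) (by simpa using hi'), map_zero]
    intro i
    exact (modByMonic_eq_zero_iff_dvd (hP i)).1 (eq_zero_of_sum_eq_zero hP hw hk
      (c := fun i => c i %ₘ P i) (fun i => degree_modByMonic_lt _ (hP i)) hsum i (i.2.trans_le hlr))
  have huniq1 (i : Fin l) (c : ℤ[X]) (hc : aeval x c (w i) = 0) : P i ∣ c := by
    have := huniq (fun e => if e = i then c else 0) (by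
      rw [Finset.sum_eq_single_of_mem i (Finset.mem_univ i)]
      · simpa using hc
      · intro b _ hb
        simp [Fin.val_inj, hb]) i
    simpa using this
  have hind : iSupIndep B := by
    rw [iSupIndep_iff_finsetSum_eq_zero_imp_eq_zero]
    intro s v hv hsum i hi
    choose! c hc using fun i hi => (hmem i _).1 (hv i hi)
    have := huniq (fun e => if h : e < l then (if (⟨e, h⟩ : Fin l) ∈ s then c ⟨e, h⟩ else 0) else 0)
      (by
        rw [← hsum, ← Finset.sum_subset (Finset.subset_univ s)]
        · refine Finset.sum_congr rfl fun e he => ?_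
          simp [he, ← hc e he]
        · intro e _ he
          simp [he]) i
    simp only [Fin.is_lt, dite_true, Fin.eta, hi, if_true] at this
    obtain ⟨q, hq⟩ := this
    rw [hc i hi, hq, mul_comm, map_mul, Module.End.mul_apply, hw i (i.2.trans_le hlr), map_zero]
  have hsup : iSup B = ⊤ := by
    rw [eq_top_iff, ← htop]
    refine polySpan_le (w := fun i => w i) (j' := r) (fun i hi => ?_) |>.trans ?_
    · simpa using aeval_mem_polySpan x w hi 1
    rintro _ ⟨c, rfl⟩
    refine Submodule.sum_mem _ fun i hi => ?_
    by_cases hil : i < l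
    · exact Submodule.mem_iSup_of_mem ⟨i, hil⟩ ((hmem _ _).2 ⟨c i, rfl⟩)
    · dsimp only
      rw [hw0 i (Finset.mem_range.1 hi) (not_lt.1 hil), map_zero]
      exact Submodule.zero_mem _
  let a : ∀ i, B i := fun i => ⟨w i, (hmem _ _).2 ⟨1, by simp⟩⟩
  have ha : ∀ i, aeval (x.restrict (hinv i)) (P i) (a i) = 0 := fun i =>
    Subtype.ext (by rw [coe_aeval_restrict]; exact hw i (i.2.trans_le hlr))
  have hspan : ∀ i (z : B i), ∃ c : ℤ[X], z = aeval (x.restrict (hinv i)) c (a i) := fun i z => by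
    obtain ⟨c, hc⟩ := (hmem i z).1 z.2
    exact ⟨c, Subtype.ext (by rw [coe_aeval_restrict]; exact hc)⟩
  have hinj : ∀ (i : Fin l) (c : ℤ[X]), c.degree < (P i).degree →
      aeval (x.restrict (hinv i)) c (a i) = 0 → c = 0 := fun i c hcd hc => by
    refine eq_zero_of_dvd_of_degree_lt (huniq1 i c ?_) hcd
    rw [← coe_aeval_restrict (hinv i) c (a i), hc, Submodule.coe_zero]
  have hfin : ∀ i, IsOfFinOrder (x.restrict (hinv i)) := fun i => by
    obtain ⟨n, hn, hxn⟩ := isOfFinOrder_iff_pow_eq_one.1 hx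
    refine isOfFinOrder_iff_pow_eq_one.2 ⟨n, hn, ?_⟩
    rw [Module.End.pow_restrict n (hinv i)]
    exact LinearMap.ext fun z => Subtype.ext (by simp [hxn])
  have hchar : ∀ i, (x.restrict (hinv i)).charpoly = P i := fun i =>
    charpoly_eq_of_cyclic_of_module (hP i) (ha i) (hspan i) (hinj i)
  refine ⟨l, B, ⟨hinv, DirectSum.isInternal_submodule_of_iSupIndep_of_iSup_eq_top hind hsup,
    fun i => ⟨isCompanionBlock_of_cyclic (hP i) (hpos i i.2) (ha i) (hspan i) (hinj i),
      (hfin i).isUnit, hfin i⟩⟩, fun i j hij => ?_⟩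
  rw [hchar, hchar]
  exact hdvd i j hij

/-- The splitting criterion: let `X` be generated over `ℤ[x]` by `u 0, …, u (r - 1)`, let `P 0` be squarefree
with `P (i + 1) ∣ P i`, and suppose that rationally `P j` is a relation for `u j` modulo the previous
generators. If modulo each prime the first `j` generators span at least
`deg P 0 + … + deg P (j - 1)` dimensions for all `j`, there is a standard decomposition. -/
theorem hasStandardOrlikDecomposition_of_filtration [Module.Free ℤ X] [Module.Finite ℤ X]
    {u : ℕ → X} (hx : IsOfFinOrder x) (hP : ∀ i, (P i).Monic) (hdvd : ∀ i j, i ≤ j → P j ∣ P i)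
    (hsq : Squarefree (P 0)) (hr : P r = 1)
    (hk : ∀ j, HasRankModPrimes (polySpan x u j) (∑ i ∈ Finset.range j, (P i).natDegree))
    (hu : ∀ j, ∃ m : ℕ, 0 < m ∧ (m : ℤ) • aeval x (P j) (u j) ∈ polySpan x u j)
    (h0 : ∀ j, aeval x (P 0) (u j) = 0) (htop : polySpan x u r = ⊤) :
    HasStandardOrlikDecomposition x := by
  obtain ⟨w, hw, hwu⟩ := exists_generators_killed hP hdvd hsq hk hu h0 r
  exact hasStandardOrlikDecomposition_of_generators hx hP hdvd hr hw (hwu ▸ hk r) (hwu.trans htop)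

end Splitting

/-! ### Orders of sums, and products of cyclotomic polynomials -/

section SumOrders

variable {n : ℕ}

theorem addOrderOf_units_mul (u : (ZMod n)ˣ) (y : ZMod n) : addOrderOf (u * y) = addOrderOf y :=
  addOrderOf_injective (AddMonoidHom.mulLeft (u : ZMod n))
    (fun _ _ h => u.isUnit.mul_left_cancel h) y

variable [NeZero n]

theorem exists_unit_mul_eq_of_addOrderOf_eq {y y' : ZMod n} (h : addOrderOf y = addOrderOf y') :
    ∃ u : (ZMod n)ˣ, y' = u * y := by
  obtain ⟨d, hd, u, hu, rfl⟩ := ZMod.eq_unit_mul_divisor y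
  obtain ⟨d', hd', u', hu', rfl⟩ := ZMod.eq_unit_mul_divisor y'
  obtain ⟨u, rfl⟩ := hu
  obtain ⟨u', rfl⟩ := hu'
  rw [addOrderOf_units_mul, addOrderOf_units_mul, ZMod.addOrderOf_coe _ (NeZero.ne n), ZMod.addOrderOf_coe _ (NeZero.ne n),
    Nat.gcd_eq_right hd, Nat.gcd_eq_right hd'] at h
  have hdd : d = d' := by
    rw [← Nat.div_div_self hd (NeZero.ne n), h, Nat.div_div_self hd' (NeZero.ne n)]
  subst hdd
  exact ⟨u' * u⁻¹, by simp [mul_assoc]⟩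

/-- Multiplication by units of `ℤ / n` permutes the elements of each order, and is transitive on them. -/
theorem sumCount_orderElements_eq (M N : Finset ℕ) {y y' : ZMod n}
    (h : addOrderOf y = addOrderOf y') :
    sumCount (orderElements n M) (orderElements n N) y =
      sumCount (orderElements n M) (orderElements n N) y' := by
  obtain ⟨u, rfl⟩ := exists_unit_mul_eq_of_addOrderOf_eq h
  unfold sumCount
  refine Finset.card_bij' (fun z _ => u * z) (fun z _ => (u⁻¹ : (ZMod n)ˣ) * z) ?_ ?_ ?_ ?_
  · intro z hz
    simpa only [Finset.mem_filter, mem_orderElements, ← mul_sub, addOrderOf_units_mul] using hz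
  · intro z hz
    have : y - (u⁻¹ : (ZMod n)ˣ) * z = (u⁻¹ : (ZMod n)ˣ) * (u * y - z) := by
      rw [mul_sub, Units.inv_mul_cancel_left]
    simpa only [Finset.mem_filter, mem_orderElements, this, addOrderOf_units_mul] using hz
  · intro z _
    simp
  · intro z _
    simp

theorem sumCount_le_card_right {A : Type*} [AddCommGroup A] [DecidableEq A] (S S' : Finset A)
    (w : A) : sumCount S S' w ≤ S'.card := by
  rw [sumCount_comm]
  exact Finset.card_filter_le _ _

/-- The orders of the elements of `ℤ / n` which are in more than `j` ways a sum of an element whose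
order is in `M` and one whose order is in `N`. -/
noncomputable def sumOrders (n : ℕ) [NeZero n] (M N : Finset ℕ) (j : ℕ) : Finset ℕ :=
  (Finset.univ.filter fun y => j < sumCount (orderElements n M) (orderElements n N) y).image addOrderOf

theorem mem_orderElements_sumOrders {M N : Finset ℕ} {j : ℕ} {y : ZMod n} :
    y ∈ orderElements n (sumOrders n M N j) ↔
      j < sumCount (orderElements n M) (orderElements n N) y := by
  rw [mem_orderElements, sumOrders, Finset.mem_image]
  constructor
  · rintro ⟨y', hy', h⟩
    rw [← sumCount_orderElements_eq M N h]
    exact (Finset.mem_filter.1 hy').2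
  · exact fun h => ⟨y, Finset.mem_filter.2 ⟨Finset.mem_univ _, h⟩, rfl⟩

theorem dvd_of_mem_sumOrders {M N : Finset ℕ} {j d : ℕ} (h : d ∈ sumOrders n M N j) : d ∣ n := by
  obtain ⟨y, -, rfl⟩ := Finset.mem_image.1 h
  exact addOrderOf_dvd_card.trans (ZMod.card n).dvd

theorem sumOrders_subset (M N : Finset ℕ) {i j : ℕ} (h : i ≤ j) :
    sumOrders n M N j ⊆ sumOrders n M N i :=
  Finset.image_subset_image (Finset.monotone_filter_right _ fun _ _ hy => h.trans_lt hy)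

theorem sumOrders_eq_empty {M N : Finset ℕ} {j : ℕ} (h : (orderElements n N).card ≤ j) :
    sumOrders n M N j = ∅ := by
  rw [sumOrders, Finset.image_eq_empty, Finset.filter_eq_empty_iff]
  exact fun y _ => not_lt.2 ((sumCount_le_card_right _ _ y).trans h)

theorem sum_card_orderElements_sumOrders (M N : Finset ℕ) (j : ℕ) :
    ∑ i ∈ Finset.range j, (orderElements n (sumOrders n M N i)).card =
      ∑ y : ZMod n, min j (sumCount (orderElements n M) (orderElements n N) y) := by
  have h1 (i : ℕ) : (orderElements n (sumOrders n M N i)).card =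
      ∑ y : ZMod n, if i < sumCount (orderElements n M) (orderElements n N) y then 1 else 0 := by
    rw [Finset.card_eq_sum_ones, ← Finset.sum_filter]
    refine Finset.sum_congr (Finset.ext fun y => ?_) fun _ _ => rfl
    rw [mem_orderElements_sumOrders, Finset.mem_filter]
    exact (and_iff_right (Finset.mem_univ _)).symm
  rw [Finset.sum_congr rfl fun i _ => h1 i, Finset.sum_comm]
  refine Finset.sum_congr rfl fun y _ => ?_
  rw [← Finset.sum_filter, Finset.sum_const, smul_eq_mul, mul_one]
  have : (Finset.range j).filter (fun i => i < sumCount (orderElements n M) (orderElements n N) y) =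
      Finset.range (min j (sumCount (orderElements n M) (orderElements n N) y)) := by
    ext i
    simp
  rw [this, Finset.card_range]

end SumOrders

section CyclotomicProducts

theorem pairwise_isRelPrime_cyclotomic {D : Finset ℕ} (hD : ∀ d ∈ D, 0 < d) :
    (D : Set ℕ).Pairwise (Function.onFun IsRelPrime fun d => cyclotomic d ℤ) := by
  intro d hd e he hde
  refine (cyclotomic.irreducible (hD d hd)).isRelPrime_iff_not_dvd.2 fun h => hde ?_
  refine cyclotomic_injective (R := ℤ) (eq_of_monic_of_associated (cyclotomic.monic d ℤ)
    (cyclotomic.monic e ℤ) ?_)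
  exact (cyclotomic.irreducible (hD d hd)).associated_of_dvd (cyclotomic.irreducible (hD e he)) h

theorem squarefree_prod_cyclotomic {D : Finset ℕ} (hD : ∀ d ∈ D, 0 < d) :
    Squarefree (∏ d ∈ D, cyclotomic d ℤ) :=
  Finset.squarefree_prod_of_pairwise_isCoprime (pairwise_isRelPrime_cyclotomic hD)
    fun d hd => (cyclotomic.irreducible (hD d hd)).squarefree

theorem prod_cyclotomic_dvd_X_pow_sub_one {D : Finset ℕ} {n : ℕ} (hn : 0 < n)
    (hD : ∀ d ∈ D, d ∣ n) : ∏ d ∈ D, cyclotomic d ℤ ∣ X ^ n - 1 := by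
  rw [← prod_cyclotomic_eq_X_pow_sub_one hn]
  exact Finset.prod_dvd_prod_of_subset _ _ _ fun d hd => Nat.mem_divisors.2 ⟨hD d hd, hn.ne'⟩

theorem monic_prod_cyclotomic (D : Finset ℕ) (K : Type*) [CommRing K] :
    (∏ d ∈ D, cyclotomic d K).Monic :=
  monic_prod_of_monic _ _ fun d _ => cyclotomic.monic d K

theorem map_prod_cyclotomic (D : Finset ℕ) (K : Type*) [CommRing K] :
    (∏ d ∈ D, cyclotomic d ℤ).map (Int.castRingHom K) = ∏ d ∈ D, cyclotomic d K := by
  rw [Polynomial.map_prod]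
  exact Finset.prod_congr rfl fun d _ => map_cyclotomic d _

theorem prod_cyclotomic_eq_prod_orderElements {K : Type*} [Field K] {n : ℕ} [NeZero n] {ζ : K}
    (hζ : IsPrimitiveRoot ζ n) {D : Finset ℕ} (hD : ∀ d ∈ D, d ∣ n) :
    ∏ d ∈ D, cyclotomic d K =
      ∏ z ∈ orderElements n D, (X - C (AddChar.zmodChar n hζ.pow_eq_one z)) := by
  rw [← Finset.prod_fiberwise_of_maps_to (t := D) (g := fun z : ZMod n => addOrderOf z)
    fun z hz => mem_orderElements.1 hz]
  refine Finset.prod_congr rfl fun d hd => ?_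
  rw [cyclotomic_eq_prod_zmodChar hζ (hD d hd)]
  refine Finset.prod_congr (Finset.ext fun z => ?_) fun _ _ => rfl
  simp only [Finset.mem_filter, Finset.mem_univ, true_and, mem_orderElements]
  exact ⟨fun h => ⟨h ▸ hd, h⟩, fun h => h.2⟩

theorem natDegree_prod_cyclotomic {n : ℕ} [NeZero n] {D : Finset ℕ} (hD : ∀ d ∈ D, d ∣ n) :
    (∏ d ∈ D, cyclotomic d ℤ).natDegree = (orderElements n D).card := by
  rw [← (monic_prod_cyclotomic D ℤ).natDegree_map (Int.castRingHom ℂ), map_prod_cyclotomic,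
    prod_cyclotomic_eq_prod_orderElements (Complex.isPrimitiveRoot_exp n (NeZero.ne n)) hD,
    natDegree_prod_of_monic _ _ fun z _ => monic_X_sub_C _]
  simp

end CyclotomicProducts

/-! ### Commuting diagonalizable endomorphisms -/

section Semisimple

variable {K Y A : Type*} [Field K] [AddCommGroup Y] [Module K Y] {ψ : A → K}

theorem aeval_apply_of_eigenvector {t : Module.End K Y} {a : K} {e : Y} (h : t e = a • e)
    (Q : K[X]) : aeval t Q e = Q.eval a • e := by
  induction Q using Polynomial.induction_on' with
  | add p q hp hq => rw [map_add, LinearMap.add_apply, hp, hq, eval_add, add_smul]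
  | monomial n b =>
    have hpow : (t ^ n) e = a ^ n • e := by
      induction n with
      | zero => simp
      | succ n ih => rw [pow_succ', Module.End.mul_apply, ih, map_smul, h, smul_smul, pow_succ]
    rw [aeval_monomial, Module.End.mul_apply, hpow, Module.algebraMap_end_apply, smul_smul,
      eval_monomial]

/-- An endomorphism killed by a product of distinct linear factors is diagonalizable: each vector is
the sum of its components in the eigenspaces, which are polynomials in the endomorphism. -/
theorem exists_eigenprojections [DecidableEq A] {t : Module.End K Y} {S : Finset A}
    (hψ : Function.Injective ψ) (ht : aeval t (∏ z ∈ S, (X - C (ψ z))) = 0) :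
    ∃ π : A → K[X], (∀ z ∈ S, ∀ v, t (aeval t (π z) v) = ψ z • aeval t (π z) v) ∧
      ∑ z ∈ S, aeval t (π z) = 1 := by
  refine ⟨Lagrange.basis S ψ, fun z hz v => ?_, ?_⟩
  · have h : aeval t ((X - C (ψ z)) * Lagrange.basis S ψ z) = 0 := by
      rw [Lagrange.basis_eq_prod_sub_inv_mul_nodal_div hz, mul_left_comm,
        EuclideanDomain.mul_div_cancel' (X_sub_C_ne_zero _) (Lagrange.X_sub_C_dvd_nodal ψ hz),
        map_mul, Lagrange.nodal, ht, mul_zero]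
    have h' := congr_arg (fun u => u v) h
    simpa [sub_eq_zero] using h'
  · rcases S.eq_empty_or_nonempty with rfl | hne
    · simpa using ht.symm
    · rw [← map_sum, Lagrange.sum_basis hψ.injOn hne, map_one]

theorem commute_aeval {t s : Module.End K Y} (h : Commute t s) (Q : K[X]) :
    Commute t (aeval s Q) := by
  induction Q using Polynomial.induction_on' with
  | add p q hp hq => rw [map_add]; exact hp.add_right hq
  | monomial n a =>
    rw [aeval_monomial]
    exact Commute.mul_right (Algebra.commutes a t).symm (h.pow_right n)

/-- On a set with at most `j` elements the function `z ^ j` is a combination of smaller powers, since some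
monic polynomial of degree `j` vanishes on the set. -/
theorem exists_pow_eq_sum (F : Finset K) {j : ℕ} (h : F.card ≤ j) :
    ∃ a : ℕ → K, ∀ z ∈ F, z ^ j = ∑ i ∈ Finset.range j, a i * z ^ i := by
  let Q : K[X] := (∏ z ∈ F, (X - C z)) * X ^ (j - F.card)
  have hQ : Q.Monic := (monic_prod_of_monic _ _ fun z _ => monic_X_sub_C z).mul (monic_X_pow _)
  have hdeg : Q.natDegree = j := by
    rw [(monic_prod_of_monic _ _ fun z _ => monic_X_sub_C z).natDegree_mul (monic_X_pow _),
      natDegree_prod_of_monic _ _ fun z _ => monic_X_sub_C z]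
    simp [Nat.add_sub_cancel' h]
  refine ⟨fun i => -Q.coeff i, fun z hz => ?_⟩
  have h0 : Q.eval z = 0 := by
    rw [eval_mul, eval_prod, Finset.prod_eq_zero hz (by simp), zero_mul]
  rw [eval_eq_sum_range, hdeg, Finset.sum_range_succ, ← hdeg, hQ.coeff_natDegree, hdeg, one_mul] at h0
  rw [eq_neg_of_add_eq_zero_right h0, ← Finset.sum_neg_distrib]
  exact Finset.sum_congr rfl fun i _ => (neg_mul _ _).symm

/-- Let `t` and `s` be commuting diagonalizable endomorphisms with eigenvalues in `ψ S` and `ψ S'`. If `P`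
vanishes at those eigenvalues of `t s` which come from more than `j` pairs, then `P (t s)` maps `s ^ j v`
into the `K[t s]`-span of `v, …, s ^ (j - 1) v`. -/
theorem exists_aeval_pow_apply_eq_sum [AddCommGroup A] [Fintype A] [DecidableEq A]
    (hψ : Function.Injective ψ) (hadd : ∀ z z', ψ (z + z') = ψ z * ψ z')
    {t s : Module.End K Y} (hts : Commute t s) {S S' : Finset A}
    (ht : aeval t (∏ z ∈ S, (X - C (ψ z))) = 0) (hs : aeval s (∏ z ∈ S', (X - C (ψ z))) = 0)
    {P : K[X]} {j : ℕ} (hP : ∀ y, j < sumCount S S' y → P.eval (ψ y) = 0) (v : Y) :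
    ∃ c : ℕ → K[X], aeval (t * s) P ((s ^ j) v) =
      ∑ i ∈ Finset.range j, aeval (t * s) (c i) ((s ^ i) v) := by
  classical
  obtain ⟨π, hπ, hπ1⟩ := exists_eigenprojections hψ ht
  obtain ⟨ρ, hρ, hρ1⟩ := exists_eigenprojections hψ hs
  let e : A → A → Y := fun z z' => aeval t (π z) (aeval s (ρ z') v)
  have hv : v = ∑ z ∈ S, ∑ z' ∈ S', e z z' := by
    have h1 : ∀ w : Y, w = ∑ z ∈ S, aeval t (π z) w := fun w => by
      rw [← LinearMap.sum_apply, hπ1, Module.End.one_apply]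
    have h2 : v = ∑ z ∈ S', aeval s (ρ z) v := by
      rw [← LinearMap.sum_apply, hρ1, Module.End.one_apply]
    rw [h1 v]
    refine Finset.sum_congr rfl fun z _ => ?_
    conv_lhs => rw [h2]
    rw [map_sum]
  have hse : ∀ z ∈ S, ∀ z' ∈ S', s (e z z') = ψ z' • e z z' := fun z _ z' hz' => by
    have := (commute_aeval hts.symm (π z)).eq
    rw [← Module.End.mul_apply, this, Module.End.mul_apply, hρ z' hz' v, map_smul]
  have hte : ∀ z ∈ S, ∀ z' ∈ S', (t * s) (e z z') = ψ (z + z') • e z z' := fun z hz z' hz' => by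
    rw [Module.End.mul_apply, hse z hz z' hz', map_smul, hπ z hz, smul_smul, hadd, mul_comm]
  have hQ (Q : K[X]) (i : ℕ) : aeval (t * s) Q ((s ^ i) v) =
      ∑ z ∈ S, ∑ z' ∈ S', (Q.eval (ψ (z + z')) * ψ z' ^ i) • e z z' := by
    conv_lhs => rw [hv]
    simp only [map_sum]
    refine Finset.sum_congr rfl fun z hz => Finset.sum_congr rfl fun z' hz' => ?_
    have := aeval_apply_of_eigenvector (hse z hz z' hz') (X ^ i)
    rw [map_pow, aeval_X, eval_pow, eval_X] at this
    rw [this, map_smul, aeval_apply_of_eigenvector (hte z hz z' hz'), smul_smul, mul_comm]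
  have hfib (y : A) : ∃ a : ℕ → K, ∀ z ∈ S, ∀ z' ∈ S', z + z' = y →
      P.eval (ψ y) * ψ z' ^ j = ∑ i ∈ Finset.range j, a i * ψ z' ^ i := by
    by_cases hy : j < sumCount S S' y
    · exact ⟨0, fun z _ z' _ _ => by simp [hP y hy]⟩
    · have hcard : ((S'.filter fun z' => y - z' ∈ S).image ψ).card ≤ j := by
        refine Finset.card_image_le.trans ?_
        rw [sumCount_comm] at hy
        exact not_lt.1 hy
      obtain ⟨a, ha⟩ := exists_pow_eq_sum _ hcard
      refine ⟨fun i => P.eval (ψ y) * a i, fun z hz z' hz' hzz => ?_⟩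
      rw [ha (ψ z') (Finset.mem_image_of_mem _ (Finset.mem_filter.2 ⟨hz', ?_⟩)), Finset.mul_sum]
      · exact Finset.sum_congr rfl fun i _ => (mul_assoc _ _ _).symm
      · rw [← hzz, add_sub_cancel_right]
        exact hz
  choose a ha using hfib
  -- The coefficients at the eigenvalues `ψ y` are interpolated by polynomials.
  refine ⟨fun i => Lagrange.interpolate Finset.univ ψ fun y => a y i, ?_⟩
  simp only [hQ, Lagrange.eval_interpolate_at_node _ hψ.injOn (Finset.mem_univ _)]
  symm
  rw [Finset.sum_comm]
  refine Finset.sum_congr rfl fun z hz => ?_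
  rw [Finset.sum_comm]
  refine Finset.sum_congr rfl fun z' hz' => ?_
  rw [ha _ z hz z' hz' rfl, Finset.sum_smul]

end Semisimple

/-! ### Base change to a field -/

section BaseChange

variable {X : Type*} [AddCommGroup X] {k : Type*} [Field k]

theorem pow_baseChange_tmul (x : Module.End ℤ X) (i : ℕ) (u : X) :
    (x.baseChange k ^ i) ((1 : k) ⊗ₜ[ℤ] u) = (1 : k) ⊗ₜ[ℤ] (x ^ i) u := by
  rw [← LinearMap.baseChange_pow, LinearMap.baseChange_tmul]

theorem aeval_baseChange_map_tmul (x : Module.End ℤ X) (P : ℤ[X]) (u : X) :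
    aeval (x.baseChange k) (P.map (Int.castRingHom k)) ((1 : k) ⊗ₜ[ℤ] u) =
      (1 : k) ⊗ₜ[ℤ] aeval x P u := by
  induction P using Polynomial.induction_on' with
  | add p q hp hq => simp [hp, hq, TensorProduct.tmul_add]
  | monomial n a =>
    rw [map_monomial, aeval_monomial, aeval_monomial, Module.End.mul_apply, Module.End.mul_apply,
      pow_baseChange_tmul, Module.algebraMap_end_apply, Module.algebraMap_end_apply,
      TensorProduct.smul_tmul', TensorProduct.tmul_smul, TensorProduct.smul_tmul', zsmul_eq_mul]
    simp

theorem aeval_baseChange_eq_zero {x : Module.End ℤ X} {P : ℤ[X]} (h : aeval x P = 0) :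
    aeval (x.baseChange k) (P.map (Int.castRingHom k)) = 0 := by
  refine TensorProduct.AlgebraTensorModule.ext fun a u => ?_
  have : a ⊗ₜ[ℤ] u = a • ((1 : k) ⊗ₜ[ℤ] u) := by
    rw [TensorProduct.smul_tmul', smul_eq_mul, mul_one]
  rw [this, map_smul, aeval_baseChange_map_tmul, h]
  simp

variable (k) in
/-- The subspace of `k ⊗ X` spanned by a subgroup of `X`. -/
def baseChangeSpan (Z : Submodule ℤ X) : Submodule k (k ⊗[ℤ] X) :=
  Submodule.span k ((fun y => (1 : k) ⊗ₜ[ℤ] y) '' (Z : Set X))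

theorem aeval_baseChange_mem (x : Module.End ℤ X) (u : ℕ → X) {i j : ℕ} (hij : i < j) (Q : k[X]) :
    aeval (x.baseChange k) Q ((1 : k) ⊗ₜ[ℤ] u i) ∈ baseChangeSpan k (polySpan x u j) := by
  rw [aeval_eq_sum_range, LinearMap.sum_apply]
  refine Submodule.sum_mem _ fun e _ => ?_
  rw [LinearMap.smul_apply, pow_baseChange_tmul]
  refine Submodule.smul_mem _ _ (Submodule.subset_span ⟨_, ?_, rfl⟩)
  simpa using aeval_mem_polySpan x u hij (Polynomial.X ^ e)

/-- Rational dependence descends: if over a field of characteristic `0` the vector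
`1 ⊗ y` is in the span of `Z`, then a multiple of `y`
is in `Z`. The map `ℤ → X / Z`, `1 ↦ y`, is otherwise injective, and stays so over the flat
`ℤ`-algebra `k`. -/
theorem exists_smul_mem_of_tmul_mem [CharZero k] {Z : Submodule ℤ X} {y : X}
    (h : (1 : k) ⊗ₜ[ℤ] y ∈ baseChangeSpan k Z) : ∃ m : ℕ, 0 < m ∧ (m : ℤ) • y ∈ Z := by
  by_contra! hcon
  let φ : ℤ →ₗ[ℤ] X ⧸ Z := LinearMap.toSpanSingleton ℤ _ (Z.mkQ y)
  have hφ : Function.Injective φ := by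
    rw [← LinearMap.ker_eq_bot, LinearMap.ker_eq_bot']
    intro a ha
    by_contra ha0
    have hmem : a • y ∈ Z := by
      rwa [LinearMap.toSpanSingleton_apply, ← map_smul, Submodule.mkQ_apply,
        Submodule.Quotient.mk_eq_zero] at ha
    refine hcon a.natAbs (Int.natAbs_pos.2 ha0) ?_
    rcases Int.natAbs_eq a with h | h
    · rwa [← h]
    · rw [h, neg_smul] at hmem
      exact (Submodule.neg_mem_iff Z).1 hmem
  have hinj := Module.Flat.lTensor_preserves_injective_linearMap (M := k) φ hφ
  have h1 : (Z.mkQ.baseChange k) ((1 : k) ⊗ₜ[ℤ] y) = 0 := by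
    have hle : baseChangeSpan k Z ≤ LinearMap.ker (Z.mkQ.baseChange k) := by
      rw [baseChangeSpan, Submodule.span_le]
      rintro _ ⟨z, hz, rfl⟩
      have : Z.mkQ z = 0 := (Submodule.Quotient.mk_eq_zero Z).2 hz
      simp [LinearMap.mem_ker, LinearMap.baseChange_tmul, this]
    exact hle h
  have h2 : LinearMap.lTensor k φ ((1 : k) ⊗ₜ[ℤ] (1 : ℤ)) = 0 := by
    rw [LinearMap.lTensor_tmul, LinearMap.toSpanSingleton_apply, one_smul, ← h1,
      LinearMap.baseChange_tmul]
  have h3 := hinj (h2.trans (map_zero _).symm)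
  have h4 := congr_arg (TensorProduct.rid ℤ k) h3
  simp at h4

end BaseChange

section Grid

variable {K Y : Type*} [Field K] [AddCommGroup Y] [Module K Y]

/-- The linear map `P(T, S) ↦ P(t, s) v`, given on the basis of monomials. -/
noncomputable def gridMap (t s : Module.End K Y) (v : Y) : MvPolynomial (Fin 2) K →ₗ[K] Y :=
  (MvPolynomial.basisMonomials (Fin 2) K).constr K fun m => (t ^ m 0 * s ^ m 1) v

theorem gridMap_monomial (t s : Module.End K Y) (v : Y) (m : Fin 2 →₀ ℕ) :
    gridMap t s v (MvPolynomial.monomial m 1) = (t ^ m 0 * s ^ m 1) v := by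
  have := (MvPolynomial.basisMonomials (Fin 2) K).constr_basis K
    (fun m => (t ^ m 0 * s ^ m 1) v) m
  rwa [MvPolynomial.coe_basisMonomials] at this

variable {t s : Module.End K Y} (v : Y)

theorem gridMap_one : gridMap t s v 1 = v := by
  simpa using gridMap_monomial t s v 0

theorem gridMap_X_zero_mul (P : MvPolynomial (Fin 2) K) :
    gridMap t s v (MvPolynomial.X 0 * P) = t (gridMap t s v P) := by
  have : gridMap t s v ∘ₗ LinearMap.mulLeft K (MvPolynomial.X 0) = t ∘ₗ gridMap t s v := by
    refine (MvPolynomial.basisMonomials (Fin 2) K).ext fun m => ?_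
    simp only [MvPolynomial.coe_basisMonomials, LinearMap.comp_apply, LinearMap.mulLeft_apply,
      MvPolynomial.X, MvPolynomial.monomial_mul, gridMap_monomial, mul_one]
    simp [pow_add, mul_assoc]
  exact LinearMap.congr_fun this P

theorem gridMap_X_one_mul (hts : Commute t s) (P : MvPolynomial (Fin 2) K) :
    gridMap t s v (MvPolynomial.X 1 * P) = s (gridMap t s v P) := by
  have : gridMap t s v ∘ₗ LinearMap.mulLeft K (MvPolynomial.X 1) = s ∘ₗ gridMap t s v := by
    refine (MvPolynomial.basisMonomials (Fin 2) K).ext fun m => ?_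
    simp only [MvPolynomial.coe_basisMonomials, LinearMap.comp_apply, LinearMap.mulLeft_apply,
      MvPolynomial.X, MvPolynomial.monomial_mul, gridMap_monomial, mul_one]
    have h : s * (t ^ m 0 * s ^ m 1) = t ^ m 0 * s ^ (1 + m 1) := by
      rw [← mul_assoc, (hts.symm.pow_right (m 0)).eq, mul_assoc, pow_add, pow_one]
    rw [← Module.End.mul_apply s, h]
    simp
  exact LinearMap.congr_fun this P

theorem gridMap_aeval_mul {r : MvPolynomial (Fin 2) K} {x : Module.End K Y}
    (h : ∀ P, gridMap t s v (r * P) = x (gridMap t s v P)) (F : K[X])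
    (P : MvPolynomial (Fin 2) K) :
    gridMap t s v (aeval r F * P) = aeval x F (gridMap t s v P) := by
  induction F using Polynomial.induction_on' with
  | add p q hp hq => simp only [map_add, add_mul, hp, hq, LinearMap.add_apply]
  | monomial n a =>
    have hpow : gridMap t s v (r ^ n * P) = (x ^ n) (gridMap t s v P) := by
      induction n with
      | zero => simp
      | succ n ih => rw [pow_succ', mul_assoc, h, ih, pow_succ', Module.End.mul_apply]
    rw [aeval_monomial, aeval_monomial, Module.End.mul_apply, ← hpow, mul_assoc,
      ← Algebra.smul_def, map_smul, Module.algebraMap_end_apply]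

theorem gridIdeal_le_ker_gridMap (hts : Commute t s) {f g : K[X]} (hf : aeval t f = 0)
    (hg : aeval s g = 0) {P : MvPolynomial (Fin 2) K} (hP : P ∈ gridIdeal f g) :
    gridMap t s v P = 0 := by
  obtain ⟨P₁, h₁, P₂, h₂, rfl⟩ := Submodule.mem_sup.1 hP
  obtain ⟨Q₁, rfl⟩ := Ideal.mem_span_singleton.1 h₁
  obtain ⟨Q₂, rfl⟩ := Ideal.mem_span_singleton.1 h₂
  rw [map_add, gridMap_aeval_mul v (gridMap_X_zero_mul v), hf,
    gridMap_aeval_mul v (gridMap_X_one_mul v hts), hg]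
  simp

/-- If `Y` has dimension `deg f * deg g` and is generated by `v`, it is the regular module of
`K[T, S] / (f(T), g(S))`, so that `imageDim` is a dimension of a subspace of `Y`. -/
theorem imageDim_gridIdeal_eq_finrank (hts : Commute t s) {f g : K[X]} (hfm : f.Monic)
    (hgm : g.Monic) (hf : aeval t f = 0) (hg : aeval s g = 0) [Module.Finite K Y]
    (hsurj : Function.Surjective (gridMap t s v))
    (hdim : Module.finrank K Y = f.natDegree * g.natDegree) (j : ℕ) :
    imageDim K (MvPolynomial.X 0 * MvPolynomial.X 1) (MvPolynomial.X 1) j (gridIdeal f g) =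
      Module.finrank K (Submodule.span K
        {y | ∃ e i : ℕ, i < j ∧ y = ((t * s) ^ e * s ^ i) v}) := by
  have := finite_quotient_gridIdeal hfm hgm
  let π := (Ideal.Quotient.mkₐ K (gridIdeal f g)).toLinearMap
  let φ : (MvPolynomial (Fin 2) K ⧸ gridIdeal f g) →ₗ[K] Y :=
    ((gridIdeal f g).restrictScalars K).liftQ (gridMap t s v)
      fun P hP => gridIdeal_le_ker_gridMap v hts hf hg hP
  have hφ : φ ∘ₗ π = gridMap t s v := LinearMap.ext fun P => rfl
  have hφs : Function.Surjective φ := fun y => by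
    obtain ⟨P, rfl⟩ := hsurj y
    exact ⟨π P, LinearMap.congr_fun hφ P⟩
  have hφi : Function.Injective φ :=
    (LinearMap.injective_iff_surjective_of_finrank_eq_finrank
      ((finrank_quotient_gridIdeal hfm hgm).trans hdim.symm)).2 hφs
  have hmul (P : MvPolynomial (Fin 2) K) : gridMap t s v (MvPolynomial.X 0 * MvPolynomial.X 1 * P) =
      (t * s) (gridMap t s v P) := by
    rw [mul_assoc, gridMap_X_zero_mul, gridMap_X_one_mul v hts, Module.End.mul_apply]
  let φe := LinearEquiv.ofBijective φ ⟨hφi, hφs⟩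
  rw [imageDim, ← φe.finrank_map_eq]
  change Module.finrank K ((Submodule.map π _).map φ) = _
  rw [← Submodule.map_comp, hφ, powerSpan,
    Submodule.map_span]
  have key (e i : ℕ) : gridMap t s v
      ((MvPolynomial.X 0 * MvPolynomial.X 1) ^ e * MvPolynomial.X 1 ^ i) =
        ((t * s) ^ e * s ^ i) v := by
    have h1 := gridMap_aeval_mul v hmul (X ^ e) (MvPolynomial.X 1 ^ i)
    have h2 := gridMap_aeval_mul v (gridMap_X_one_mul v hts) (X ^ i) 1
    simp only [map_pow, aeval_X, mul_one, gridMap_one] at h1 h2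
    rw [h1, h2, Module.End.mul_apply]
  refine congr_arg (fun Z : Set Y => Module.finrank K (Submodule.span K Z))
    (Set.ext fun y => ⟨?_, ?_⟩)
  · rintro ⟨_, ⟨e, i, hi, rfl⟩, rfl⟩
    exact ⟨e, i, hi, key e i⟩
  · rintro ⟨e, i, hi, rfl⟩
    exact ⟨_, ⟨e, i, hi, rfl⟩, key e i⟩

end Grid

/-! ### The filtration of the lattice of two commuting endomorphisms -/

section Main

variable {X : Type*} [AddCommGroup X] {t s : Module.End ℤ X} {v : X} {n : ℕ} [NeZero n]
  {M N : Finset ℕ}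

theorem pow_eq_one_of_aeval_eq_zero {D : Finset ℕ} (hD : ∀ d ∈ D, d ∣ n)
    (h : aeval t (∏ d ∈ D, cyclotomic d ℤ) = 0) : t ^ n = 1 := by
  obtain ⟨Q, hQ⟩ := prod_cyclotomic_dvd_X_pow_sub_one (NeZero.pos n) hD
  have := congr_arg (aeval t) hQ
  rw [map_mul, h, zero_mul, map_sub, map_pow, aeval_X, map_one] at this
  exact sub_eq_zero.1 this

/-- Rationally, `P_j(x) s ^ j v` is in the span of `s ^ i v`, `i < j`, over `ℤ[x]`, where `x = t s` and `P_j`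
is the product of the cyclotomic polynomials of the eigenvalues of multiplicity greater than `j`. -/
theorem exists_smul_aeval_mem_polySpan (hts : Commute t s) (hM : ∀ d ∈ M, d ∣ n)
    (hN : ∀ d ∈ N, d ∣ n) (ht : aeval t (∏ d ∈ M, cyclotomic d ℤ) = 0)
    (hs : aeval s (∏ d ∈ N, cyclotomic d ℤ) = 0) (j : ℕ) :
    ∃ m : ℕ, 0 < m ∧ (m : ℤ) • aeval (t * s) (∏ d ∈ sumOrders n M N j, cyclotomic d ℤ) ((s ^ j) v)
      ∈ polySpan (t * s) (fun i => (s ^ i) v) j := by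
  have hζ := Complex.isPrimitiveRoot_exp n (NeZero.ne n)
  have hcomm : Commute (t.baseChange ℂ) (s.baseChange ℂ) := by
    change _ * _ = _ * _
    rw [← LinearMap.baseChange_mul, hts.eq, LinearMap.baseChange_mul]
  have hbc {D : Finset ℕ} {x : Module.End ℤ X} (hD : ∀ d ∈ D, d ∣ n)
      (h : aeval x (∏ d ∈ D, cyclotomic d ℤ) = 0) :
      aeval (x.baseChange ℂ) (∏ z ∈ orderElements n D,
        (Polynomial.X - C (AddChar.zmodChar n hζ.pow_eq_one z))) = 0 := by
    rw [← prod_cyclotomic_eq_prod_orderElements hζ hD, ← map_prod_cyclotomic]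
    exact aeval_baseChange_eq_zero h
  refine exists_smul_mem_of_tmul_mem (k := ℂ) ?_
  obtain ⟨c, hc⟩ := exists_aeval_pow_apply_eq_sum (zmodChar_injective hζ)
    (fun z z' => AddChar.map_add_eq_mul _ z z') hcomm (hbc hM ht) (hbc hN hs)
    (P := ∏ d ∈ sumOrders n M N j, cyclotomic d ℂ) (j := j) (fun y hy => by
      rw [prod_cyclotomic_eq_prod_orderElements hζ fun d hd => dvd_of_mem_sumOrders hd, eval_prod]
      exact Finset.prod_eq_zero (mem_orderElements_sumOrders.2 hy) (by simp)) ((1 : ℂ) ⊗ₜ[ℤ] v)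
  have hx : t.baseChange ℂ * s.baseChange ℂ = (t * s).baseChange ℂ :=
    (LinearMap.baseChange_mul ..).symm
  rw [← map_prod_cyclotomic, hx, pow_baseChange_tmul, aeval_baseChange_map_tmul] at hc
  rw [hc]
  refine Submodule.sum_mem _ fun i hi => ?_
  rw [pow_baseChange_tmul]
  exact aeval_baseChange_mem (t * s) (fun i => (s ^ i) v) (Finset.mem_range.1 hi) (c i)

theorem aeval_prod_sumOrders_eq_zero [Module.Free ℤ X] (hts : Commute t s) (hM : ∀ d ∈ M, d ∣ n)
    (hN : ∀ d ∈ N, d ∣ n) (ht : aeval t (∏ d ∈ M, cyclotomic d ℤ) = 0)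
    (hs : aeval s (∏ d ∈ N, cyclotomic d ℤ) = 0) (u : X) :
    aeval (t * s) (∏ d ∈ sumOrders n M N 0, cyclotomic d ℤ) u = 0 := by
  obtain ⟨m, hm, c, hc⟩ := exists_smul_aeval_mem_polySpan (v := u) hts hM hN ht hs 0
  rw [Finset.sum_range_zero] at hc
  exact smul_right_injective X (Int.natCast_ne_zero.2 hm.ne')
    (hc.trans (smul_zero (m : ℤ)).symm)

/-- The dimensions of the spans over a field of characteristic `p` are at least those over `ℚ`. -/
theorem sum_natDegree_le_finrank_baseChangeSpan [Module.Free ℤ X] [Module.Finite ℤ X]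
    {k : Type*} [Field k] {p m n : ℕ} [Fact p.Prime] [CharP k p] [NeZero n] {ζ : k}
    (hζ : IsPrimitiveRoot ζ n) (hpn : ¬ p ∣ n) [NeZero (n * p ^ m)] (hts : Commute t s)
    (hM : ∀ d ∈ M, d ∣ n * p ^ m) (hN : ∀ d ∈ N, d ∣ n * p ^ m)
    (ht : aeval t (∏ d ∈ M, cyclotomic d ℤ) = 0)
    (hs : aeval s (∏ d ∈ N, cyclotomic d ℤ) = 0)
    (hspan : Submodule.span ℤ {y | ∃ i j : ℕ, y = (t ^ i * s ^ j) v} = ⊤)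
    (hrank : Module.finrank ℤ X =
      (∏ d ∈ M, cyclotomic d ℤ).natDegree * (∏ d ∈ N, cyclotomic d ℤ).natDegree)
    (hMN : SdiObSufficient M N) (j : ℕ) :
    ∑ i ∈ Finset.range j, (∏ d ∈ sumOrders (n * p ^ m) M N i, cyclotomic d ℤ).natDegree ≤
      Module.finrank k (baseChangeSpan k (polySpan (t * s) (fun i => (s ^ i) v) j)) := by
  have hcomm : Commute (t.baseChange k) (s.baseChange k) := by
    change _ * _ = _ * _
    rw [← LinearMap.baseChange_mul, hts.eq, LinearMap.baseChange_mul]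
  have hbc {D : Finset ℕ} {x : Module.End ℤ X} (h : aeval x (∏ d ∈ D, cyclotomic d ℤ) = 0) :
      aeval (x.baseChange k) (∏ d ∈ D, cyclotomic d k) = 0 := by
    rw [← map_prod_cyclotomic]
    exact aeval_baseChange_eq_zero h
  have hmon (i j : ℕ) : ((t.baseChange k) ^ i * (s.baseChange k) ^ j) ((1 : k) ⊗ₜ[ℤ] v) =
      (1 : k) ⊗ₜ[ℤ] (t ^ i * s ^ j) v := by
    rw [Module.End.mul_apply, pow_baseChange_tmul, pow_baseChange_tmul, Module.End.mul_apply]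
  have hsurj : Function.Surjective
      (gridMap (t.baseChange k) (s.baseChange k) ((1 : k) ⊗ₜ[ℤ] v)) := by
    rw [← LinearMap.range_eq_top, eq_top_iff]
    have key : ∀ u : X, (1 : k) ⊗ₜ[ℤ] u ∈
        LinearMap.range (gridMap (t.baseChange k) (s.baseChange k) ((1 : k) ⊗ₜ[ℤ] v)) := by
      intro u
      have hu : u ∈ Submodule.span ℤ {y | ∃ i j : ℕ, y = (t ^ i * s ^ j) v} :=
        hspan ▸ Submodule.mem_top
      induction hu using Submodule.span_induction with
      | mem u hu =>
        obtain ⟨i, j, rfl⟩ := hu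
        refine ⟨MvPolynomial.monomial (Finsupp.single 0 i + Finsupp.single 1 j) 1, ?_⟩
        rw [gridMap_monomial, ← hmon]
        simp
      | zero => simp
      | add a b _ _ ha hb => rw [TensorProduct.tmul_add]; exact Submodule.add_mem _ ha hb
      | smul a b _ hb =>
        rw [TensorProduct.tmul_smul, TensorProduct.smul_tmul', zsmul_eq_mul, ← smul_eq_mul,
          ← TensorProduct.smul_tmul']
        exact Submodule.smul_mem _ _ hb
    rintro y -
    induction y using TensorProduct.induction_on with
    | zero => exact Submodule.zero_mem _
    | add a b ha hb => exact Submodule.add_mem _ ha hb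
    | tmul a u =>
      have : a ⊗ₜ[ℤ] u = a • ((1 : k) ⊗ₜ[ℤ] u) := by
        rw [TensorProduct.smul_tmul', smul_eq_mul, mul_one]
      rw [this]
      exact Submodule.smul_mem _ _ (key u)
  have hdeg (D : Finset ℕ) : (∏ d ∈ D, cyclotomic d k).natDegree =
      (∏ d ∈ D, cyclotomic d ℤ).natDegree := by
    rw [← map_prod_cyclotomic, (monic_prod_cyclotomic D ℤ).natDegree_map]
  have hdim := imageDim_gridIdeal_eq_finrank ((1 : k) ⊗ₜ[ℤ] v) hcomm (monic_prod_cyclotomic M k)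
    (monic_prod_cyclotomic N k) (hbc ht) (hbc hs) hsurj
    (by rw [Module.finrank_baseChange, hrank, hdeg, hdeg]) j
  have hbound := hMN.sum_min_sumCount_le hζ hpn hM hN j
  rw [hdim, ← sum_card_orderElements_sumOrders] at hbound
  rw [Finset.sum_congr rfl fun i _ => natDegree_prod_cyclotomic
    fun d hd => dvd_of_mem_sumOrders (M := M) (N := N) (j := i) hd]
  refine hbound.trans (Submodule.finrank_mono ?_)
  rw [Submodule.span_le]
  rintro _ ⟨e, i, hi, rfl⟩
  refine Submodule.subset_span ⟨((t * s) ^ e * s ^ i) v, ?_, ?_⟩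
  · simpa using aeval_mem_polySpan (t * s) (fun i => (s ^ i) v) hi (Polynomial.X ^ e)
  · rw [← LinearMap.baseChange_mul]
    simp only [Module.End.mul_apply, pow_baseChange_tmul]

theorem hasRankModPrimes_polySpan [Module.Free ℤ X] [Module.Finite ℤ X] (hts : Commute t s)
    (hM : ∀ d ∈ M, d ∣ n) (hN : ∀ d ∈ N, d ∣ n)
    (ht : aeval t (∏ d ∈ M, cyclotomic d ℤ) = 0)
    (hs : aeval s (∏ d ∈ N, cyclotomic d ℤ) = 0)
    (hspan : Submodule.span ℤ {y | ∃ i j : ℕ, y = (t ^ i * s ^ j) v} = ⊤)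
    (hrank : Module.finrank ℤ X =
      (∏ d ∈ M, cyclotomic d ℤ).natDegree * (∏ d ∈ N, cyclotomic d ℤ).natDegree)
    (hMN : SdiObSufficient M N) (j : ℕ) :
    HasRankModPrimes (polySpan (t * s) (fun i => (s ^ i) v) j)
      (∑ i ∈ Finset.range j, (∏ d ∈ sumOrders n M N i, cyclotomic d ℤ).natDegree) := by
  intro p hp
  have : Fact p.Prime := ⟨hp⟩
  let k := AlgebraicClosure (ZMod p)
  have : CharP k p := charP_of_injective_algebraMap (algebraMap (ZMod p) k).injective p
  refine ⟨k, inferInstance, this, ?_⟩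
  obtain ⟨m, n₀, hpn, hn⟩ := Nat.exists_eq_pow_mul_and_not_dvd (NeZero.ne n) p hp.ne_one
  rw [mul_comm] at hn
  subst hn
  have : NeZero n₀ := ⟨fun h => hpn (h ▸ dvd_zero p)⟩
  have : NeZero (n₀ : k) := ⟨fun h => hpn ((CharP.cast_eq_zero_iff k p n₀).1 h)⟩
  obtain ⟨ζ, hζ⟩ := HasEnoughRootsOfUnity.exists_primitiveRoot k n₀
  exact sum_natDegree_le_finrank_baseChangeSpan hζ hpn hts hM hN ht hs hspan hrank hMN j

/-- The powers of `s` below `deg g` generate, because `t = (t s) s ^ (n - 1)`. -/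
theorem polySpan_eq_top (hts : Commute t s) (hN : ∀ d ∈ N, d ∣ n)
    (hs : aeval s (∏ d ∈ N, cyclotomic d ℤ) = 0)
    (hspan : Submodule.span ℤ {y | ∃ i j : ℕ, y = (t ^ i * s ^ j) v} = ⊤) :
    polySpan (t * s) (fun i => (s ^ i) v) (∏ d ∈ N, cyclotomic d ℤ).natDegree = ⊤ := by
  set g := ∏ d ∈ N, cyclotomic d ℤ with hg
  have hgm : g.Monic := monic_prod_cyclotomic N ℤ
  have hsn := pow_eq_one_of_aeval_eq_zero hN hs
  have hpow (e : ℕ) : (s ^ e) v ∈ polySpan (t * s) (fun i => (s ^ i) v) g.natDegree := by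
    have e1 : (s ^ e) v = aeval s (Polynomial.X ^ e %ₘ g) v := by
      rw [aeval_modByMonic_apply (by rw [hs, LinearMap.zero_apply]), map_pow, aeval_X]
    by_cases h0 : Polynomial.X ^ e %ₘ g = 0
    · rw [e1, h0, map_zero, LinearMap.zero_apply]
      exact Submodule.zero_mem _
    rw [e1, aeval_eq_sum_range' (natDegree_lt_natDegree h0 (degree_modByMonic_lt _ hgm)),
      LinearMap.sum_apply]
    refine Submodule.sum_mem _ fun i hi => ?_
    rw [LinearMap.smul_apply]
    refine Submodule.smul_mem _ _ ?_
    simpa using aeval_mem_polySpan (t * s) (fun i => (s ^ i) v) (Finset.mem_range.1 hi) 1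
  rw [eq_top_iff, ← hspan, Submodule.span_le]
  rintro _ ⟨i, j, rfl⟩
  have ht' : t = t * s * s ^ (n - 1) := by
    rw [mul_assoc, ← pow_succ', Nat.sub_add_cancel (NeZero.pos n), hsn, mul_one]
  have hc : Commute (t * s) (s ^ (n - 1)) := (hts.mul_left (Commute.refl s)).pow_right _
  have e2 : (t ^ i * s ^ j) v = aeval (t * s) (Polynomial.X ^ i : ℤ[X]) ((s ^ ((n - 1) * i + j)) v) := by
    conv_lhs => rw [ht', hc.mul_pow, mul_assoc, ← pow_mul, ← pow_add, Module.End.mul_apply]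
    rw [map_pow, aeval_X]
  rw [e2]
  exact aeval_apply_mem_polySpan _ (hpow _)

/-- The theorem for a lattice which is the regular module of `ℤ[t, s] = ℤ[T, S] / (f(T), g(S))`: it is generated
by `v`, and its rank is `deg f * deg g`. -/
theorem hasStandardOrlikDecomposition_mul [Module.Free ℤ X] [Module.Finite ℤ X]
    (hts : Commute t s) (hM : ∀ d ∈ M, d ∣ n) (hN : ∀ d ∈ N, d ∣ n)
    (ht : aeval t (∏ d ∈ M, cyclotomic d ℤ) = 0)
    (hs : aeval s (∏ d ∈ N, cyclotomic d ℤ) = 0)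
    (hspan : Submodule.span ℤ {y | ∃ i j : ℕ, y = (t ^ i * s ^ j) v} = ⊤)
    (hrank : Module.finrank ℤ X =
      (∏ d ∈ M, cyclotomic d ℤ).natDegree * (∏ d ∈ N, cyclotomic d ℤ).natDegree)
    (hMN : SdiObSufficient M N) :
    HasStandardOrlikDecomposition (t * s) := by
  have hfin : IsOfFinOrder (t * s) := isOfFinOrder_iff_pow_eq_one.2 ⟨n, NeZero.pos n, by
    rw [hts.mul_pow, pow_eq_one_of_aeval_eq_zero hM ht, pow_eq_one_of_aeval_eq_zero hN hs, mul_one]⟩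
  refine hasStandardOrlikDecomposition_of_filtration (u := fun i => (s ^ i) v)
    (P := fun j => ∏ d ∈ sumOrders n M N j, cyclotomic d ℤ)
    (r := (∏ d ∈ N, cyclotomic d ℤ).natDegree) hfin (fun i => monic_prod_cyclotomic _ _)
    (fun i j hij => Finset.prod_dvd_prod_of_subset _ _ _ (sumOrders_subset M N hij))
    (squarefree_prod_cyclotomic fun d hd =>
      Nat.pos_of_dvd_of_pos (dvd_of_mem_sumOrders hd) (NeZero.pos n)) ?_
    (hasRankModPrimes_polySpan hts hM hN ht hs hspan hrank hMN)
    (exists_smul_aeval_mem_polySpan hts hM hN ht hs)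
    (fun j => aeval_prod_sumOrders_eq_zero hts hM hN ht hs _)
    (polySpan_eq_top hts hN hs hspan)
  rw [natDegree_prod_cyclotomic hN, sumOrders_eq_empty le_rfl, Finset.prod_empty]

end Main

/-! ### Tensor products of Orlik blocks -/

section OrlikBlock

variable {H : Type*} [AddCommGroup H]

/-- The remainder of `P` modulo the characteristic polynomial is a relation between the basis elements
`h ^ i a`. -/
theorem charpoly_dvd_of_aeval_eq_zero [Module.Free ℤ H] [Module.Finite ℤ H] {h : Module.End ℤ H}
    (hh : IsCompanionBlock h) {P : ℤ[X]} (hP : aeval h P = 0) : h.charpoly ∣ P := by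
  obtain ⟨n, hn, a, b, hb⟩ := hh
  have hmon := LinearMap.charpoly_monic h
  have hdeg : h.charpoly.natDegree = n := by
    rw [LinearMap.charpoly_natDegree, Module.finrank_eq_card_basis b, Fintype.card_fin]
  rw [← modByMonic_eq_zero_iff_dvd hmon]
  by_contra h0
  have hlt := natDegree_lt_natDegree h0 (degree_modByMonic_lt P hmon)
  rw [hdeg] at hlt
  have hker : aeval h (P %ₘ h.charpoly) a = 0 := by
    rw [aeval_modByMonic_apply (by rw [LinearMap.aeval_self_charpoly, LinearMap.zero_apply]), hP,
      LinearMap.zero_apply]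
  rw [aeval_eq_sum_range' hlt, LinearMap.sum_apply,
    ← Fin.sum_univ_eq_sum_range fun i => ((P %ₘ h.charpoly).coeff i • h ^ i) a] at hker
  simp only [LinearMap.smul_apply, ← hb] at hker
  refine h0 (Polynomial.ext fun i => ?_)
  by_cases hi : i < n
  · exact Fintype.linearIndependent_iff.1 b.linearIndependent _ hker ⟨i, hi⟩
  · exact coeff_eq_zero_of_natDegree_lt (hlt.trans_le (not_lt.1 hi))

theorem hasEigenvalue_baseChange_iff [Module.Free ℤ H] [Module.Finite ℤ H] (h : Module.End ℤ H)
    (z : ℂ) : Module.End.HasEigenvalue (h.baseChange ℂ) z ↔ aeval z h.charpoly = 0 := by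
  rw [Module.End.hasEigenvalue_iff_isRoot_charpoly, LinearMap.charpoly_baseChange, IsRoot.def,
    eval_map_algebraMap]

/-- The characteristic polynomial of an Orlik block divides some `X ^ n - 1`, hence it is the product
of the cyclotomic polynomials of its roots. -/
theorem IsOrlikBlock.exists_charpoly_eq [Module.Free ℤ H] [Module.Finite ℤ H]
    {h : Module.End ℤ H} (hh : IsOrlikBlock h) {N : Finset ℕ}
    (hN : (N : Set ℕ) = eigenvalueOrders h) :
    ∃ n : ℕ, 0 < n ∧ (∀ d ∈ N, d ∣ n) ∧ h.charpoly = ∏ d ∈ N, cyclotomic d ℤ := by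
  obtain ⟨hcomp, -, hfin⟩ := hh
  obtain ⟨n, hn, hpow⟩ := isOfFinOrder_iff_pow_eq_one.1 hfin
  have hmem (d : ℕ) : d ∈ N ↔ 0 < d ∧ ∃ z : ℂ, aeval z h.charpoly = 0 ∧ orderOf z = d := by
    rw [← Finset.mem_coe, hN]
    simp only [← hasEigenvalue_baseChange_iff]
    rfl
  have hdvd : h.charpoly ∣ X ^ n - 1 :=
    charpoly_dvd_of_aeval_eq_zero hcomp (by rw [map_sub, map_pow, aeval_X, hpow, map_one, sub_self])
  have hroot (z : ℂ) (hz : aeval z h.charpoly = 0) : z ^ n = 1 := by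
    obtain ⟨Q, hQ⟩ := hdvd
    have := congr_arg (aeval z) hQ
    rw [map_mul, hz, zero_mul, map_sub, map_pow, aeval_X, map_one] at this
    exact sub_eq_zero.1 this
  have hpos : ∀ d ∈ N, 0 < d := fun d hd => ((hmem d).1 hd).1
  refine ⟨n, hn, fun d hd => ?_, ?_⟩
  · obtain ⟨-, z, hz, rfl⟩ := (hmem d).1 hd
    exact orderOf_dvd_of_pow_eq_one (hroot z hz)
  have hmon := LinearMap.charpoly_monic h
  have h1 : ∏ d ∈ N, cyclotomic d ℤ ∣ h.charpoly := by
    refine Finset.prod_dvd_of_isRelPrime (pairwise_isRelPrime_cyclotomic hpos) fun d hd => ?_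
    obtain ⟨hd0, z, hz, rfl⟩ := (hmem d).1 hd
    rw [cyclotomic_eq_minpoly (IsPrimitiveRoot.orderOf z) hd0]
    exact minpoly.isIntegrallyClosed_dvd ⟨_, hmon, hz⟩ hz
  have h2 : h.charpoly ∣ ∏ d ∈ N, cyclotomic d ℤ := by
    have hsep : (h.charpoly.map (Int.castRingHom ℂ)).Separable := by
      have hX : (X ^ n - 1 : ℂ[X]).Separable :=
        X_pow_sub_one_separable_iff.2 (Nat.cast_ne_zero.2 hn.ne')
      have hd := Polynomial.map_dvd (Int.castRingHom ℂ) hdvd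
      rw [Polynomial.map_sub, Polynomial.map_pow, map_X, Polynomial.map_one] at hd
      exact hX.of_dvd hd
    rw [← map_dvd_map (Int.castRingHom ℂ) Int.cast_injective hmon, map_prod_cyclotomic]
    refine (IsAlgClosed.splits _).dvd_of_roots_le_roots (hmon.map _).ne_zero ?_
    rw [Multiset.le_iff_subset (nodup_roots hsep)]
    intro z hz
    have hz0 : aeval z h.charpoly = 0 := by
      have := (mem_roots'.1 hz).2
      rwa [IsRoot.def, eval_map, ← algebraMap_int_eq, ← aeval_def] at this
    have hz1 : 0 < orderOf z := orderOf_pos_iff.2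
      (isOfFinOrder_iff_pow_eq_one.2 ⟨n, hn, hroot z hz0⟩)
    have : NeZero ((orderOf z : ℕ) : ℂ) := ⟨Nat.cast_ne_zero.2 hz1.ne'⟩
    rw [mem_roots (monic_prod_cyclotomic N ℂ).ne_zero, IsRoot.def, eval_prod]
    exact Finset.prod_eq_zero ((hmem _).2 ⟨hz1, z, hz0, rfl⟩)
      (isRoot_cyclotomic_iff.2 (IsPrimitiveRoot.orderOf z))
  exact (eq_of_dvd_of_natDegree_le_of_leadingCoeff h2 (natDegree_le_of_dvd h1 hmon.ne_zero)
    (by rw [hmon, (monic_prod_cyclotomic N ℤ)]))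

end OrlikBlock

section TensorProduct

/-- The `ℤ`-module structure of `X` is unique, so that `hasStandardOrlikDecomposition_mul` applies
to every presentation of it. -/
theorem hasStandardOrlikDecomposition_mul_of_module {X : Type*} [AddCommGroup X]
    [inst : Module ℤ X] [Module.Free ℤ X] [Module.Finite ℤ X] {t s : Module.End ℤ X} {v : X}
    {n : ℕ} [NeZero n] {M N : Finset ℕ}
    (hts : Commute t s) (hM : ∀ d ∈ M, d ∣ n) (hN : ∀ d ∈ N, d ∣ n)
    (ht : aeval t (∏ d ∈ M, cyclotomic d ℤ) = 0)
    (hs : aeval s (∏ d ∈ N, cyclotomic d ℤ) = 0)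
    (hspan : Submodule.span ℤ {y | ∃ i j : ℕ, y = (t ^ i * s ^ j) v} = ⊤)
    (hrank : Module.finrank ℤ X =
      (∏ d ∈ M, cyclotomic d ℤ).natDegree * (∏ d ∈ N, cyclotomic d ℤ).natDegree)
    (hMN : SdiObSufficient M N) :
    HasStandardOrlikDecomposition (t * s) := by
  obtain rfl : inst = AddCommGroup.toIntModule X := Subsingleton.elim _ _
  exact hasStandardOrlikDecomposition_mul hts hM hN ht hs hspan hrank hMN

variable {G H : Type*} [AddCommGroup G] [AddCommGroup H]

theorem map_aeval_int {A B : Type*} [Ring A] [Ring B] [Algebra ℤ A] [Algebra ℤ B] (ρ : A →+* B)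
    (g : A) (P : ℤ[X]) : aeval (ρ g) P = ρ (aeval g P) := by
  rw [aeval_def, aeval_def, hom_eval₂]
  congr 1
  exact RingHom.ext_int _ _

theorem aeval_map_one (g : Module.End ℤ G) (P : ℤ[X]) :
    aeval (TensorProduct.map g (1 : Module.End ℤ H)) P = TensorProduct.map (aeval g P) 1 :=
  map_aeval_int (A := Module.End ℤ G) (B := Module.End ℤ (G ⊗[ℤ] H))
    { toFun := fun f => TensorProduct.map f 1
      map_one' := TensorProduct.map_one
      map_mul' := fun f f' => TensorProduct.map_mul f f' (1 : Module.End ℤ H) 1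
      map_zero' := TensorProduct.map_zero_left _
      map_add' := fun _ _ => TensorProduct.map_add_left _ _ _ } g P

theorem aeval_one_map (h : Module.End ℤ H) (P : ℤ[X]) :
    aeval (TensorProduct.map (1 : Module.End ℤ G) h) P = TensorProduct.map 1 (aeval h P) :=
  map_aeval_int (A := Module.End ℤ H) (B := Module.End ℤ (G ⊗[ℤ] H))
    { toFun := fun f => TensorProduct.map 1 f
      map_one' := TensorProduct.map_one
      map_mul' := fun f f' => TensorProduct.map_mul (1 : Module.End ℤ G) 1 f f'
      map_zero' := TensorProduct.map_zero_right _
      map_add' := fun _ _ => TensorProduct.map_add_right _ _ _ } h P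

end TensorProduct

end Orlik

theorem theorem7p4 {G H : Type*}
    [AddCommGroup G] [Module.Free ℤ G] [Module.Finite ℤ G]
    [AddCommGroup H] [Module.Free ℤ H] [Module.Finite ℤ H]
    (g : Module.End ℤ G) (h : Module.End ℤ H)
    (hg : Orlik.IsOrlikBlock g) (hh : Orlik.IsOrlikBlock h)
    (M N : Finset ℕ)
    (hM : (M : Set ℕ) = Orlik.eigenvalueOrders g)
    (hN : (N : Set ℕ) = Orlik.eigenvalueOrders h)
    (hMN : Orlik.SdiObSufficient M N) :
    Orlik.HasStandardOrlikDecomposition (H := G ⊗[ℤ] H) (TensorProduct.map g h) := by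
  obtain ⟨n₁, hn₁, hMn, hgM⟩ := hg.exists_charpoly_eq hM
  obtain ⟨n₂, hn₂, hNn, hhN⟩ := hh.exists_charpoly_eq hN
  obtain ⟨⟨r₁, -, a, b, hb⟩, -⟩ := hg
  obtain ⟨⟨r₂, -, a', b', hb'⟩, -⟩ := hh
  have : NeZero (n₁ * n₂) := ⟨(Nat.mul_pos hn₁ hn₂).ne'⟩
  have hmap : TensorProduct.map g h = TensorProduct.map g 1 * TensorProduct.map 1 h := by
    rw [← TensorProduct.map_mul, mul_one, one_mul]
  rw [hmap]
  refine Orlik.hasStandardOrlikDecomposition_mul_of_module (n := n₁ * n₂) (v := a ⊗ₜ[ℤ] a') ?_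
    (fun d hd => (hMn d hd).mul_right n₂) (fun d hd => (hNn d hd).mul_left n₁) ?_ ?_ ?_ ?_ hMN
  · change _ * _ = _ * _
    rw [← TensorProduct.map_mul, ← TensorProduct.map_mul, mul_one, one_mul, mul_one, one_mul]
  · rw [Orlik.aeval_map_one, ← hgM, LinearMap.aeval_self_charpoly, TensorProduct.map_zero_left]
  · rw [Orlik.aeval_one_map, ← hhN, LinearMap.aeval_self_charpoly, TensorProduct.map_zero_right]
  · rw [eq_top_iff, ← (b.tensorProduct b').span_eq, Submodule.span_le]
    rintro _ ⟨⟨i, j⟩, rfl⟩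
    refine Submodule.subset_span ⟨i, j, ?_⟩
    rw [Module.Basis.tensorProduct_apply, hb, hb', TensorProduct.map_pow, TensorProduct.map_pow,
      ← TensorProduct.map_mul, TensorProduct.map_tmul, one_pow, one_pow, mul_one, one_mul]
  · rw [Module.finrank_tensorProduct, ← hgM, ← hhN, LinearMap.charpoly_natDegree,
      LinearMap.charpoly_natDegree]
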